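/- **Theorem (correctness of MultiBagsPlus).** *Executions.* A program with general futures is executed in depth-first eager order. Besides reads and writes of memory locations, the execution issues the following control instructions: $\mathtt{spawn}$ and $\mathtt{create}$ (call a function instance, respectively a future, whose body is executed at once, before the continuation of the caller); return; $\mathtt{sync}$ (join the most recently spawned child that the current function has not yet joined; a sync of several children is a succession of such binary ones); and $\mathtt{get}(h)$ (wait for the future $h$, which is already completed; a future may be gotten any number of times, from anywhere). A function joins all its spawned children before it returns. Each control instruction ends the current strand and begins a new one. The nodes of the computation dag are the strands. Its edges are: from the strand ending with a spawn or create to the first strand of the callee (spawn, create edge) and to the continuation strand (continue edge); from the last strand before a sync (continue edge) and from the last strand of the joined child (join edge) to the strand after the sync; from the last strand before a get (continue edge) and from the last strand of the future (get edge) to the strand after the get. Write $u\prec v$ if there is a nonempty path from $u$ to $v$ in the full computation dag; distinct strands $u,v$ are logically parallel if neither $u\prec v$ nor $v\prec u$. *Data structures.* $D_{SP}$ is a partition of the executed strands into bags, each marked $S$ or $P$; $D_{NSP}$ is a partition of them into sets, each attached or unattached; $\mathcal R$ is a dag on the attached sets. An unattached set $U$ has an attached predecessor $\mathrm{attPred}(U)$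 and possibly an attached successor $\mathrm{attSucc}(U)$; for an attached set $A$ put $\mathrm{attPred}(A)=\mathrm{attSucc}(A)=A$. For a strand $u$, $A_u$ is the set containing it, $\mathrm{attPred}(u)=\mathrm{attPred}(A_u)$ and $\mathrm{attSucc}(u)=\mathrm{attSucc}(A_u)$. $\mathrm{Attachify}(u)$ does nothing if $A_u$ is attached; otherwise it makes $A_u$ attached and adds the arc $(\mathrm{attPred}(A_u),A_u)$ to $\mathcal R$. Initially the first strand is in the $S$-bag of the main function and forms an attached set. *Updates of $D_{SP}$.* When $G$ is spawned or created, an $S$-bag $S_G$ containing its first strand is made; every further strand of a function $F$ is put into $S_F$ when it begins; when $G$ returns, $S_G$ becomes the $P$-bag $P_G$; when $F$ syncs with $G$, $P_G$ is merged into $S_F$; a get merges no bags. *Updates of $D_{NSP}$ and $\mathcal R$* (each strand is entered when it begins). - Strand $u$ spawns: the first strand of the callee and the continuation strand become unattached singletons with attached predecessor $\mathrm{attPred}(u)$. - Strand $u$ creates a future: $\mathrm{Attachify}(u)$; the first strand $v$ of the future and the continuation strand $w$ become attached singletons, with arcs $(A_u,A_v)$ and $(A_u,A_w)$. - Strand $u$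 gets a future with last strand $t$: $\mathrm{Attachify}(u)$; the strand $v$ after the get becomes an attached singleton, with arcs $(A_u,A_v)$ and $(A_t,A_v)$. - A sync with join strand $j$ joins two subdags with sources $s_1,s_2$ and sinks $t_1,t_2$ that were forked by the strand $f$. If $A_{t_1},A_{t_2}$ are both unattached, they and $j$ are merged into $A_f$. If both are attached, then $\mathrm{Attachify}(f)$, arcs $(A_f,A_{s_1})$ and $(A_f,A_{s_2})$ are added, and $j$ becomes an attached singleton, with arcs $(A_{t_1},A_j)$ and $(A_{t_2},A_j)$. If exactly one is attached, say $A_{t_a}$ and not $A_{t_b}$, $\{a,b\}=\{1,2\}$, then $A_f$ is merged into $A_{s_a}$ if it is unattached, $j$ is added to $A_{t_a}$, and $\mathrm{attSucc}(A_{t_b}):=A_j$. *Query.* $\mathrm{Query}(u,v)$ answers yes if $u$ is in an $S$-bag. Otherwise it answers no if $u$ is in an unattached set without attached successor, and else answers whether there is a (possibly empty) path in $\mathcal R$ from $\mathrm{attSucc}(u)$ to $\mathrm{attPred}(v)$. *Detector.* For each location $\ell$ the detector stores its last writer and the strands that have read it since. When the current strand $v$ reads $\ell$, it reports a race on $\ell$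 between $v$ and the last writer $u$ if $\mathrm{Query}(u,v)$ answers no, and stores $v$ as a reader. When $v$ writes $\ell$, it reports a race between $v$ and each such $u$ among the last writer and the stored readers, makes $v$ the last writer and empties the list of readers. *Claim.* At every point of the execution: 1. if $v$ is the currently executing strand and $u$ is any strand executed earlier, then $\mathrm{Query}(u,v)$ answers yes if and only if $u\prec v$; 2. whenever the detector has reported a race on $\ell$ between $u$ and $v$, the strands $u$ and $v$ are logically parallel and have made accesses to $\ell$ at least one of which is a write; and for every location $\ell$, the detector has reported a race on $\ell$ if and only if two logically parallel strands have made accesses to $\ell$ at least one of which is a write. -/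

import Mathlib

namespace MultiBagsPlus

/-! ## Programs with futures, executed in depth-first eager order

The depth-first eager execution of a program with general futures issues a sequence of
instructions: memory accesses and the parallel control instructions `spawn`, `create`, `ret`,
`sync`, `get`. A strand is a maximal piece of the execution without parallel control, so each
control instruction ends the current strand and begins a new one. Strands are numbered in the
order in which they are executed, function instances in the order in which they are called;
strand `0` is the first strand of the main function `0`. -/

/-- The instructions issued by an execution. `get h` waits for the future computed by the function
instance `h`; a future may be gotten any number of times, from anywhere. `sync` joins the most
recently spawned child that the current function has not joined yet (a `sync` that joins several
children is a succession of such binary ones). -/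
inductive Instr (Loc : Type*) where
  | read (l : Loc)
  | write (l : Loc)
  | spawn
  | create
  | ret
  | sync
  | get (h : ℕ)

/-- The kinds of edges of the computation dag. -/
inductive EdgeKind where
  | spawn
  | create
  | cont
  | join
  | get
  deriving DecidableEq

/-- An edge of the computation dag. -/
structure Edge where
  src : ℕ
  kind : EdgeKind
  dst : ℕ
  deriving DecidableEq

/-- The two ways of starting a parallel function instance. -/
inductive CallKind where
  | spawn
  | create
  deriving DecidableEq

/-- A spawned child that has returned and has not been joined yet: the instance `child`, the
strand `f` that ended with the spawn, the first strand `s₁` and the last strand `t₁` of the child,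
and the first strand `s₂` of the continuation of the parent. -/
structure Fork where
  child : ℕ
  f : ℕ
  s₁ : ℕ
  t₁ : ℕ
  s₂ : ℕ

/-- A suspended function instance `fn`: its strand `caller` ended with a call of kind `kind`, the
callee began with the strand `first`, and `pending` are its children that are still to be joined,
the most recent one first. -/
structure Frame where
  fn : ℕ
  caller : ℕ
  kind : CallKind
  first : ℕ
  pending : List Fork

/-- A memory access: strand, location, and whether it is a write. -/
structure Access (Loc : Type*) where
  strand : ℕ
  loc : Loc
  isWrite : Bool

/-- The state of a depth-first eager execution, with the part of the computation dag and the
memory accesses seen so far. -/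
structure Exec (Loc : Type*) where
  /-- the currently executing strand -/
  cur : ℕ
  /-- the function instance it belongs to -/
  fn : ℕ
  /-- the returned and unjoined spawned children of `fn`, the most recent one first -/
  pending : List Fork
  /-- the suspended ancestors of `fn`, innermost first -/
  stack : List Frame
  /-- the number of function instances so far -/
  numFns : ℕ
  /-- the last strand of each completed future -/
  futureLast : ℕ → Option ℕ
  /-- the edges of the computation dag -/
  edges : List Edge
  /-- the memory accesses, the most recent one first -/
  accesses : List (Access Loc)

namespace Exec

variable {Loc : Type*}

/-- The start of the execution: the first strand of the main function. -/
def init : Exec Loc where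
  cur := 0
  fn := 0
  pending := []
  stack := []
  numFns := 1
  futureLast := fun _ => none
  edges := []
  accesses := []

/-- A call executes the callee eagerly: its first strand is executed next, and the caller is
suspended. -/
def call (E : Exec Loc) (k : CallKind) (e : EdgeKind) : Exec Loc :=
  { E with
    cur := E.cur + 1
    fn := E.numFns
    pending := []
    stack := ⟨E.fn, E.cur, k, E.cur + 1, E.pending⟩ :: E.stack
    numFns := E.numFns + 1
    edges := ⟨E.cur, e, E.cur + 1⟩ :: E.edges }

/-- One instruction; `none` if it is not possible. A function returns only after it has joined all
its spawned children, and in depth-first eager order a `get` finds its future completed. -/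
def step (E : Exec Loc) : Instr Loc → Option (Exec Loc)
  | .read l => some { E with accesses := ⟨E.cur, l, false⟩ :: E.accesses }
  | .write l => some { E with accesses := ⟨E.cur, l, true⟩ :: E.accesses }
  | .spawn => some (E.call .spawn .spawn)
  | .create => some (E.call .create .create)
  | .ret =>
    match E.pending, E.stack with
    | [], fr :: stack =>
      match fr.kind with
      | .spawn => some { E with
          cur := E.cur + 1
          fn := fr.fn
          pending := ⟨E.fn, fr.caller, fr.first, E.cur, E.cur + 1⟩ :: fr.pending
          stack := stack
          edges := ⟨fr.caller, .cont, E.cur + 1⟩ :: E.edges }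
      | .create => some { E with
          cur := E.cur + 1
          fn := fr.fn
          pending := fr.pending
          stack := stack
          futureLast := Function.update E.futureLast E.fn (some E.cur)
          edges := ⟨fr.caller, .cont, E.cur + 1⟩ :: E.edges }
    | _, _ => none
  | .sync =>
    match E.pending with
    | k :: pending => some { E with
        cur := E.cur + 1
        pending := pending
        edges := ⟨E.cur, .cont, E.cur + 1⟩ :: ⟨k.t₁, .join, E.cur + 1⟩ :: E.edges }
    | [] => none
  | .get h =>
    match E.futureLast h with
    | some t => some { E with
        cur := E.cur + 1
        edges := ⟨E.cur, .cont, E.cur + 1⟩ :: ⟨t, .get, E.cur + 1⟩ :: E.edges }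
    | none => none

/-- The execution of a sequence of instructions. -/
def run (p : List (Instr Loc)) : Option (Exec Loc) :=
  p.foldlM step init

/-- `u ≺ v`: there is a nonempty path from `u` to `v` in the computation dag, along edges of any
kind. -/
def Precedes (E : Exec Loc) (u v : ℕ) : Prop :=
  Relation.TransGen (fun a b => ∃ e ∈ E.edges, e.src = a ∧ e.dst = b) u v

/-- Logically parallel strands. -/
def Parallel (E : Exec Loc) (u v : ℕ) : Prop :=
  u ≠ v ∧ ¬ E.Precedes u v ∧ ¬ E.Precedes v u

end Exec

/-! ## The data structures of MultiBagsPlus -/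

/-- In a labelling of disjoint sets, merge the set labelled `b` into the set labelled `a`. -/
def relabel (a b c : ℕ) : ℕ := if c = b then a else c

/-- The two kinds of bags. -/
inductive BagKind where
  | S
  | P
  deriving DecidableEq

/-- The disjoint-set structure `D_SP` over strands. Every set is the bag of one function instance,
which serves as its label; `find u` is the label of the bag that holds `u`. -/
structure DSP where
  find : ℕ → ℕ
  kind : ℕ → BagKind

namespace DSP

/-- Put the new strand `v` into the bag of `F`. -/
def add (D : DSP) (F v : ℕ) : DSP :=
  { D with find := Function.update D.find v F }

/-- Create the bag `S_G`, containing the first strand `v` of `G`. -/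
def makeS (D : DSP) (G v : ℕ) : DSP where
  find := Function.update D.find v G
  kind := Function.update D.kind G .S

/-- The bag `S_G` becomes `P_G`. -/
def toP (D : DSP) (G : ℕ) : DSP :=
  { D with kind := Function.update D.kind G .P }

/-- Merge the bag of `G` into the bag of `F`. -/
def union (D : DSP) (F G : ℕ) : DSP :=
  { D with find := fun x => relabel F G (D.find x) }

end DSP

/-- The disjoint-set structure `D_NSP` over strands, with its attached and unattached sets, and the
reachability dag `R` over the attached sets. Sets are labelled by natural numbers, and `find u` is
the label of the set that holds `u`. An unattached set has an attached predecessor, and it may have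
an attached successor. `R` is kept transitively closed: it holds the pairs `(A, B)` of
attached sets that are joined by a nonempty path. -/
structure DNSP where
  find : ℕ → ℕ
  attached : ℕ → Bool
  attPred : ℕ → ℕ
  attSucc : ℕ → Option ℕ
  R : Finset (ℕ × ℕ)

namespace DNSP

/-- Make the set `{v}`, unattached, with attached predecessor `A`. -/
def makeUnattached (D : DNSP) (v A : ℕ) : DNSP :=
  { D with
    find := Function.update D.find v v
    attached := Function.update D.attached v false
    attPred := Function.update D.attPred v A
    attSucc := Function.update D.attSucc v none }

/-- Make the set `{v}`, attached. -/
def makeAttached (D : DNSP) (v : ℕ) : DNSP :=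
  { D with
    find := Function.update D.find v v
    attached := Function.update D.attached v true }

/-- Merge the set of `b` into the set of `a`, which keeps its label and its attributes. -/
def union (D : DNSP) (a b : ℕ) : DNSP :=
  { D with find := fun x => relabel (D.find a) (D.find b) (D.find x) }

/-- Put the new strand `v` into the set of `a`. -/
def add (D : DNSP) (a v : ℕ) : DNSP :=
  { D with find := Function.update D.find v (D.find a) }

/-- Add the arc `(A, B)` to `R`, and restore the transitive closure. -/
def arcSets (D : DNSP) (A B : ℕ) : DNSP :=
  { D with R := D.R ∪
      insert A ((D.R.filter fun e => e.2 = A).image Prod.fst) ×ˢ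
        insert B ((D.R.filter fun e => e.1 = B).image Prod.snd) }

/-- Add to `R` the arc from the set of `a` to the set of `b`. -/
def arc (D : DNSP) (a b : ℕ) : DNSP :=
  D.arcSets (D.find a) (D.find b)

/-- Is the set of `u` attached? -/
def isAttached (D : DNSP) (u : ℕ) : Bool :=
  D.attached (D.find u)

/-- The attached set that stands for `v` as the target of a query: the set of `v` if it is attached,
and its attached predecessor otherwise. -/
def predOf (D : DNSP) (v : ℕ) : ℕ :=
  if D.isAttached v then D.find v else D.attPred (D.find v)

/-- The attached set, if there is one, that stands for `u` as the source of a query: the set of `u`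
if it is attached, and its attached successor otherwise. -/
def succOf (D : DNSP) (u : ℕ) : Option ℕ :=
  if D.isAttached u then some (D.find u) else D.attSucc (D.find u)

/-- Turn the set of `u` into an attached set, with an arc in `R` from its attached predecessor;
nothing happens if it is attached already. -/
def attachify (D : DNSP) (u : ℕ) : DNSP :=
  if D.isAttached u then D
  else
    { D with attached := Function.update D.attached (D.find u) true }.arcSets
      (D.attPred (D.find u)) (D.find u)

/-- The strand `u` spawns a function with first strand `v`, or `v` is the first strand of the
continuation of `u` after a spawn. -/
def onSpawnEdge (D : DNSP) (u v : ℕ) : DNSP :=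
  D.makeUnattached v (D.predOf u)

/-- The strand `u` creates a future with first strand `v`. -/
def onCreate (D : DNSP) (u v : ℕ) : DNSP :=
  ((D.attachify u).makeAttached v).arc u v

/-- `v` is the first strand of the continuation of the strand `u`, which created a future. -/
def onCreateCont (D : DNSP) (u v : ℕ) : DNSP :=
  (D.makeAttached v).arc u v

/-- The strand `u` gets a future with last strand `t`; the strand after the get is `v`. -/
def onGet (D : DNSP) (u t v : ℕ) : DNSP :=
  (((D.attachify u).makeAttached v).arc u v).arc t v

/-- Join of two parallel subdags with sinks `tA` (attached) and `tU` (unattached), at the join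
strand `j`; `sA` is the source of the attached subdag and `f` the strand that spawned. -/
def joinOne (D : DNSP) (f sA tA tU j : ℕ) : DNSP :=
  let D₁ := if D.isAttached f then D else D.union sA f
  let D₂ := D₁.add tA j
  { D₂ with attSucc := Function.update D₂.attSucc (D₂.find tU) (some (D₂.find j)) }

/-- Join, at the strand `j`, of the two parallel subdags with sources `s₁`, `s₂` and sinks `t₁`,
`t₂` that were forked by the strand `f`. -/
def onSync (D : DNSP) (f s₁ t₁ s₂ t₂ j : ℕ) : DNSP :=
  match D.isAttached t₁, D.isAttached t₂ with
  | false, false => ((D.union f t₁).union f t₂).add f j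
  | true, true =>
    ((((((D.attachify f).arc f s₁).arc f s₂).makeAttached j).arc t₁ j).arc t₂ j)
  | true, false => D.joinOne f s₁ t₁ t₂ j
  | false, true => D.joinOne f s₂ t₂ t₁ j

end DNSP

/-- A reported race: the location, the earlier strand and the later strand. -/
structure Race (Loc : Type*) where
  loc : Loc
  fst : ℕ
  snd : ℕ

/-- The state of the race detector: the reachability structures, the access history (the last
writer of each location and its readers since then), and the reported races. -/
structure Detector (Loc : Type*) where
  sp : DSP
  nsp : DNSP
  lastWriter : Loc → Option ℕ
  readers : Loc → List ℕ
  races : List (Race Loc)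

namespace Detector

variable {Loc : Type*}

/-- At the start, the first strand is in the `S`-bag of the main function and in an attached set. -/
def init : Detector Loc where
  sp := ⟨fun _ => 0, fun _ => .S⟩
  nsp := ⟨id, fun A => decide (A = 0), fun _ => 0, fun _ => none, ∅⟩
  lastWriter := fun _ => none
  readers := fun _ => []
  races := []

/-- The query whether `u` precedes the currently executing strand `v`: yes if `u` is in an `S`-bag;
otherwise, no if the set of `u` is unattached without an attached successor, and else whether `R`
has a path from the attached set that stands for `u` to the one that stands for `v`. -/
def query (D : Detector Loc) (u v : ℕ) : Bool :=
  if D.sp.kind (D.sp.find u) = .S then true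
  else
    match D.nsp.succOf u with
    | none => false
    | some A => decide (A = D.nsp.predOf v ∨ (A, D.nsp.predOf v) ∈ D.nsp.R)

/-- The races between an access to `l` by the current strand `v` and the earlier accesses by the
strands in `us`. -/
def check (D : Detector Loc) (l : Loc) (v : ℕ) (us : List ℕ) : List (Race Loc) :=
  (us.filter fun u => !D.query u v).map fun u => ⟨l, u, v⟩

/-- The action of the detector on an instruction that is issued in the state `E` of the execution.
Each strand is entered into `D_SP` and `D_NSP` when it begins. -/
def step [DecidableEq Loc] (E : Exec Loc) (D : Detector Loc) : Instr Loc → Detector Loc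
  | .read l =>
    { D with
      readers := Function.update D.readers l (E.cur :: D.readers l)
      races := D.check l E.cur (D.lastWriter l).toList ++ D.races }
  | .write l =>
    { D with
      lastWriter := Function.update D.lastWriter l (some E.cur)
      readers := Function.update D.readers l []
      races := D.check l E.cur ((D.lastWriter l).toList ++ D.readers l) ++ D.races }
  | .spawn =>
    { D with
      sp := D.sp.makeS E.numFns (E.cur + 1)
      nsp := D.nsp.onSpawnEdge E.cur (E.cur + 1) }
  | .create =>
    { D with
      sp := D.sp.makeS E.numFns (E.cur + 1)
      nsp := D.nsp.onCreate E.cur (E.cur + 1) }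
  | .ret =>
    match E.stack with
    | fr :: _ =>
      { D with
        sp := (D.sp.toP E.fn).add fr.fn (E.cur + 1)
        nsp := match fr.kind with
          | .spawn => D.nsp.onSpawnEdge fr.caller (E.cur + 1)
          | .create => D.nsp.onCreateCont fr.caller (E.cur + 1) }
    | [] => D
  | .sync =>
    match E.pending with
    | k :: _ =>
      { D with
        sp := (D.sp.union E.fn k.child).add E.fn (E.cur + 1)
        nsp := D.nsp.onSync k.f k.s₁ k.t₁ k.s₂ E.cur (E.cur + 1) }
    | [] => D
  | .get h =>
    match E.futureLast h with
    | some t =>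
      { D with
        sp := D.sp.add E.fn (E.cur + 1)
        nsp := D.nsp.onGet E.cur t (E.cur + 1) }
    | none => D

/-- The execution of a sequence of instructions together with the detector. -/
def run [DecidableEq Loc] (p : List (Instr Loc)) : Option (Exec Loc × Detector Loc) :=
  p.foldlM (fun s i => (s.1.step i).map fun E => (E, s.2.step s.1 i)) (Exec.init, init)

end Detector

/-- Two accesses in `as` to the location `l`, by the strands `u` and `v`, conflict: at least one of
them is a write. -/
def Conflict {Loc : Type*} (as : List (Access Loc)) (l : Loc) (u v : ℕ) : Prop :=
  ∃ a ∈ as, ∃ b ∈ as, a.loc = l ∧ b.loc = l ∧ a.strand = u ∧ b.strand = v ∧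
    (a.isWrite = true ∨ b.isWrite = true)

end MultiBagsPlus

/-!
What a query sees of the set of a strand is its cell: an attached set stands for itself, an
unattached set is entered from its attached predecessor and left through its attached successor, if
it has one. The central invariant is that these cells represent reachability: `u ≺ v` amounts to a
path of attached sets from `attSucc u` to `attPred v`, unless `v` lies in the attached set
`attSucc u` itself.

The series-parallel pieces of the dag that can still be extended form a stack of blocks, and a new
strand extends, forks or joins the topmost ones or follows a completed future. Hence new paths can
leave only the sets that end with the sink of a block and the attached sets that end with a future,
and every unattached set without attached successor is of the first kind. Such a set is contained in
the bag of the function that executed its block. An `S`-bag belongs to a function on the call stack,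
all of whose strands precede the current one, and from such a set in a `P`-bag no path leads to the
current strand. This settles the queries that the attached sets do not decide.

For the detector it is enough to follow a location until the first race on it is reported. Up to
then all earlier accesses precede the last writer, except the reads made since, which are stored: a
new access that is parallel to some conflicting access is parallel to a stored one.
-/

namespace MultiBagsPlus

/-! ## Cells and reachability -/

/-- The properties of reflexive reachability in a computation dag whose strands are numbered in
execution order: a partial order that is contained in the order of the numbers. -/
structure StrandOrder (r : ℕ → ℕ → Prop) : Prop where
  refl : ∀ x, r x x
  trans : ∀ {x y z}, r x y → r y z → r x z
  le : ∀ {x y}, r x y → x ≤ y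

theorem StrandOrder.antisymm {r : ℕ → ℕ → Prop} (hr : StrandOrder r) {x y : ℕ} (hxy : r x y)
    (hyx : r y x) : x = y :=
  le_antisymm (hr.le hxy) (hr.le hyx)

/-- The edges into the strand `v` come from the strands `ps`, expressed by reachability. -/
def ImmediatePreds (r : ℕ → ℕ → Prop) (v : ℕ) (ps : List ℕ) : Prop :=
  ∀ x, r x v ↔ x = v ∨ ∃ p ∈ ps, r x p

theorem ImmediatePreds.rel {r : ℕ → ℕ → Prop} (hr : StrandOrder r) {v p : ℕ} {ps : List ℕ}
    (h : ImmediatePreds r v ps) (hp : p ∈ ps) : r p v :=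
  (h p).2 (.inr ⟨p, hp, hr.refl p⟩)

/-- The part of a set of `D_NSP` that a query can see. `attached A` is the attached set with label
`A`, `opened U P` the unattached set with label `U` and attached predecessor `P` that has no
attached successor, and `closed A` stands for every unattached set with attached successor `A`: the
current strand is never in such a set again, so that its attached predecessor does not matter. -/
inductive Cell where
  | attached (A : ℕ)
  | opened (U P : ℕ)
  | closed (A : ℕ)

namespace Cell

/-- The attached successor `attSucc` of a set. -/
def succ : Cell → Option ℕ
  | attached A => some A
  | opened _ _ => none
  | closed A => some A

/-- The attached predecessor `attPred` of a set that can still be the target of a query. -/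
def pred : Cell → Option ℕ
  | attached A => some A
  | opened _ P => some P
  | closed _ => none

/-- Equal cells, or the unattached cell whose attached successor is `κ'`. -/
def FeedsInto (κ κ' : Cell) : Prop :=
  κ = κ' ∨ ∃ A, κ = closed A ∧ κ' = attached A

theorem feedsInto_attached_iff {κ : Cell} {A : ℕ} : κ.FeedsInto (attached A) ↔ A ∈ κ.succ := by
  cases κ <;> simp [FeedsInto, succ, eq_comm]

theorem mem_succ_of_eq {κ : Cell} {A : ℕ} (h : κ = attached A) : A ∈ κ.succ :=
  h ▸ rfl

theorem mem_pred_of_eq {κ : Cell} {A : ℕ} (h : κ = attached A) : A ∈ κ.pred :=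
  h ▸ rfl

theorem mem_pred_of_eq_opened {κ : Cell} {U P : ℕ} (h : κ = opened U P) : P ∈ κ.pred :=
  h ▸ rfl

theorem feedsInto_iff_eq {κ κ' : Cell} (h : ∀ A, κ' ≠ attached A) : κ.FeedsInto κ' ↔ κ = κ' := by
  simp [FeedsInto, h]

theorem eq_of_feedsInto {κ κ' : Cell} (hκ : κ.pred.isSome) (h : κ.FeedsInto κ') : κ = κ' := by
  obtain h | ⟨A, rfl, -⟩ := h
  · exact h
  · simp [pred] at hκ

theorem eq_attached_of_mem_succ {κ : Cell} {A : ℕ} (hκ : κ.pred.isSome) (hA : A ∈ κ.succ) :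
    κ = attached A :=
  eq_of_feedsInto hκ (feedsInto_attached_iff.2 hA)

end Cell

section

variable {r : ℕ → ℕ → Prop} {n : ℕ} {c c' : ℕ → Cell}

/-- `t` comes last among the strands up to `n` whose cell feeds into that of `t`. -/
def IsLast (r : ℕ → ℕ → Prop) (n : ℕ) (c : ℕ → Cell) (t : ℕ) : Prop :=
  ∀ x ≤ n, (c x).FeedsInto (c t) → r x t

theorem IsLast.rel_iff_exists_exit (hr : StrandOrder r) {t : ℕ} {exits : List ℕ}
    (hlast : IsLast r n c t) (hexits : ∀ s ∈ exits, r t s)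
    (hout : ∀ x ≤ n, ∀ y ≤ n, (c y).pred.isSome → c x = c t → r x y →
      c y = c t ∨ ∃ s ∈ exits, r s y)
    {u v : ℕ} (hu : u ≤ n) (hv : v ≤ n) (hcu : c u = c t) (hcv : c v ≠ c t)
    (hlive : (c v).pred.isSome) : r u v ↔ ∃ s ∈ exits, r s v :=
  ⟨fun h => (hout u hu v hv hlive hcu h).resolve_left hcv,
    fun ⟨s, hs, h⟩ => hr.trans (hlast u hu (.inl hcu)) (hr.trans (hexits s hs) h)⟩

/-- `s` comes first among the strands up to `n` in the cell of `s`. -/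
def IsFirst (r : ℕ → ℕ → Prop) (n : ℕ) (c : ℕ → Cell) (s : ℕ) : Prop :=
  ∀ x ≤ n, c x = c s → r s x

/-- The cells `c'` arise from the cells `c` by attaching the set `opened U P`. -/
structure AttachesSet (n : ℕ) (c c' : ℕ → Cell) (U P : ℕ) : Prop where
  attached : ∀ x ≤ n, c x = .opened U P → c' x = .attached U
  other : ∀ x ≤ n, c x ≠ .opened U P → c' x = c x

/-- The cells `c` represent the order `r` of the strands up to `n`: between strands that are not in
the same attached set, it is the order of the attached sets that stand for them. -/
structure Faithful (r : ℕ → ℕ → Prop) (n : ℕ) (c : ℕ → Cell) : Prop where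
  label : ∀ {x A}, x ≤ n → A ∈ (c x).succ ∨ A ∈ (c x).pred → A ≤ n ∧ c A = .attached A
  opened_label : ∀ {x U P}, x ≤ n → c x = .opened U P → U ≤ n ∧ c U = .opened U P
  rel_iff : ∀ {u v A B}, u ≤ n → v ≤ n → A ∈ (c u).succ → B ∈ (c v).pred → c v ≠ .attached A →
    (r u v ↔ r A B)

namespace Faithful

theorem succ_label (hc : Faithful r n c) {x A : ℕ} (hx : x ≤ n) (hA : A ∈ (c x).succ) :
    A ≤ n ∧ c A = .attached A :=
  hc.label hx (.inl hA)

theorem pred_label (hc : Faithful r n c) {x A : ℕ} (hx : x ≤ n) (hA : A ∈ (c x).pred) :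
    A ≤ n ∧ c A = .attached A :=
  hc.label hx (.inr hA)

theorem rel_iff_of_isLast (hr : StrandOrder r) (hc : Faithful r n c) {u p A B : ℕ} (hu : u ≤ n)
    (hp : p ≤ n) (hlast : IsLast r n c p) (hA : A ∈ (c u).succ) (hB : B ∈ (c p).pred) :
    r u p ↔ r A B := by
  by_cases h : c p = .attached A
  · obtain rfl : A = B := by simpa [h, Cell.pred] using hB
    exact iff_of_true (hlast u hu (by rw [h]; exact Cell.feedsInto_attached_iff.2 hA)) (hr.refl A)
  · exact hc.rel_iff hu hp hA hB h

theorem rel_iff_label_of_isLast (hr : StrandOrder r) (hc : Faithful r n c) {u p A : ℕ} (hu : u ≤ n)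
    (hp : p ≤ n) (hlast : IsLast r n c p) (hA : A ∈ (c u).succ) (hlive : (c p).pred.isSome) :
    r u p ↔ r A p := by
  obtain ⟨B, hB⟩ := Option.isSome_iff_exists.1 hlive
  obtain ⟨hAn, hcA⟩ := hc.succ_label hu hA
  rw [hc.rel_iff_of_isLast hr hu hp hlast hA hB,
    hc.rel_iff_of_isLast hr hAn hp hlast (Cell.mem_succ_of_eq hcA) hB]

theorem rel_iff_of_isFirst (hr : StrandOrder r) (hc : Faithful r n c) {s v S B : ℕ} (hs : s ≤ n)
    (hv : v ≤ n) (hcs : c s = .attached S) (hfirst : IsFirst r n c s) (hB : B ∈ (c v).pred) :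
    r s v ↔ r S B := by
  by_cases h : c v = .attached S
  · obtain rfl : S = B := by simpa [h, Cell.pred] using hB
    exact iff_of_true (hfirst v hv (h.trans hcs.symm)) (hr.refl S)
  · exact hc.rel_iff hs hv (by simp [hcs, Cell.succ]) hB h

theorem rel_iff_label_of_isFirst (hr : StrandOrder r) (hc : Faithful r n c) {s v S B : ℕ}
    (hs : s ≤ n) (hv : v ≤ n) (hcs : c s = .attached S) (hfirst : IsFirst r n c s)
    (hB : B ∈ (c v).pred) : r s v ↔ r s B := by
  obtain ⟨hBn, hcB⟩ := hc.pred_label hv hB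
  rw [hc.rel_iff_of_isFirst hr hs hv hcs hfirst hB,
    hc.rel_iff_of_isFirst hr hs hBn hcs hfirst (Cell.mem_pred_of_eq hcB)]

/-- An unattached set whose last strand `t` is followed by the first strands of the attached sets of
`exits` precedes other sets exactly through them: this is what makes arcs from the set to theirs
sufficient when it is attached. -/
theorem attach (hr : StrandOrder r) (hc : Faithful r n c) {t U P : ℕ} {exits : List ℕ}
    (htn : t ≤ n) (ht : c t = .opened U P) (hlast : IsLast r n c t)
    (hexits : ∀ s ∈ exits, r t s ∧ s ≤ n ∧ IsFirst r n c s ∧ ∃ S, c s = .attached S)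
    (hout : ∀ x ≤ n, ∀ y ≤ n, (c y).pred.isSome → c x = c t → r x y →
      c y = c t ∨ ∃ s ∈ exits, r s y)
    (ha : AttachesSet n c c' U P) : Faithful r n c' := by
  have hU := hc.opened_label htn ht
  refine ⟨fun {x A} hx hA => ?_, fun {x V Q} hx hV => ?_, fun {u v A B} hu hv hA hB hne => ?_⟩
  · by_cases hxU : c x = .opened U P
    · obtain rfl : U = A := by simpa [ha.attached x hx hxU, Cell.succ, Cell.pred] using hA
      exact ⟨hU.1, ha.attached U hU.1 hU.2⟩
    · obtain ⟨hAn, hcA⟩ := hc.label hx (ha.other x hx hxU ▸ hA)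
      exact ⟨hAn, by rw [ha.other A hAn (by simp [hcA]), hcA]⟩
  · have hxU : c x ≠ .opened U P := fun h => by simp [ha.attached x hx h] at hV
    have hcx : c x = .opened V Q := by rwa [← ha.other x hx hxU]
    obtain ⟨hVn, hcV⟩ := hc.opened_label hx hcx
    exact ⟨hVn, by rw [ha.other V hVn (by rwa [hcV, ← hcx]), hcV]⟩
  by_cases huU : c u = .opened U P <;> by_cases hvU : c v = .opened U P
  · obtain rfl : U = A := by simpa [ha.attached u hu huU, Cell.succ] using hA
    exact absurd (ha.attached v hv hvU) hne
  · obtain rfl : U = A := by simpa [ha.attached u hu huU, Cell.succ] using hA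
    rw [ha.other v hv hvU] at hB
    obtain ⟨hBn, hcB⟩ := hc.pred_label hv hB
    rw [hlast.rel_iff_exists_exit hr (fun s hs => (hexits s hs).1) hout hu hv
        (huU.trans ht.symm) (by rwa [ht]) (Option.isSome_iff_exists.2 ⟨B, hB⟩),
      hlast.rel_iff_exists_exit hr (fun s hs => (hexits s hs).1) hout hU.1 hBn
        (hU.2.trans ht.symm) (by simp [hcB, ht]) (by simp [hcB, Cell.pred])]
    refine exists_congr fun s => and_congr_right fun hs => ?_
    obtain ⟨-, hsn, hfirst, S, hcs⟩ := hexits s hs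
    exact hc.rel_iff_label_of_isFirst hr hsn hv hcs hfirst hB
  · obtain rfl : U = B := by simpa [ha.attached v hv hvU, Cell.pred] using hB
    rw [ha.other u hu huU] at hA
    obtain ⟨hAn, hcA⟩ := hc.succ_label hu hA
    rw [hc.rel_iff hu hv hA (Cell.mem_pred_of_eq_opened hvU) (by simp [hvU]),
      hc.rel_iff hAn hU.1 (Cell.mem_succ_of_eq hcA) (Cell.mem_pred_of_eq_opened hU.2)
        (by simp [hU.2])]
  · rw [ha.other u hu huU] at hA
    rw [ha.other v hv hvU] at hB hne
    exact hc.rel_iff hu hv hA hB hne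

theorem addStrand (hr : StrandOrder r) (hc : Faithful r n c) (hold : ∀ x ≤ n, c' x = c x)
    (hlabel : ∀ {A}, A ∈ (c' (n + 1)).succ ∨ A ∈ (c' (n + 1)).pred →
      A ≤ n + 1 ∧ c' A = .attached A)
    (hopened : ∀ {U P}, c' (n + 1) = .opened U P → U ≤ n + 1 ∧ c' U = .opened U P)
    (hsucc : ∀ {A}, A ∈ (c' (n + 1)).succ → A = n + 1 ∧ c' (n + 1) = .attached A)
    (hpred : ∀ {u A B}, u ≤ n → A ∈ (c u).succ → B ∈ (c' (n + 1)).pred →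
      (r u (n + 1) ↔ r A B)) : Faithful r (n + 1) c' := by
  refine ⟨fun {x A} hx hA => ?_, fun {x U P} hx hU => ?_, fun {u v A B} hu hv hA hB hne => ?_⟩
  · rcases Nat.le_add_one_iff.1 hx with hx | rfl
    · obtain ⟨hAn, hcA⟩ := hc.label hx (hold x hx ▸ hA)
      exact ⟨by omega, by rw [hold A hAn, hcA]⟩
    · exact hlabel hA
  · rcases Nat.le_add_one_iff.1 hx with hx | rfl
    · obtain ⟨hUn, hcU⟩ := hc.opened_label hx (hold x hx ▸ hU)
      exact ⟨by omega, by rw [hold U hUn, hcU]⟩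
    · exact hopened hU
  rcases Nat.le_add_one_iff.1 hu with hu | rfl <;> rcases Nat.le_add_one_iff.1 hv with hv | rfl
  · rw [hold u hu] at hA
    rw [hold v hv] at hB hne
    exact hc.rel_iff hu hv hA hB hne
  · exact hpred hu (hold u hu ▸ hA) hB
  · obtain ⟨rfl, -⟩ := hsucc hA
    obtain ⟨hBn, -⟩ := hc.pred_label hv (hold v hv ▸ hB)
    exact iff_of_false (fun h => by have := hr.le h; omega) (fun h => by have := hr.le h; omega)
  · exact absurd (hsucc hA).2 hne

theorem newAttached (hr : StrandOrder r) (hc : Faithful r n c) {ps : List ℕ}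
    (hps : ImmediatePreds r (n + 1) ps)
    (hlast : ∀ p ∈ ps, p ≤ n ∧ IsLast r n c p ∧ (c p).pred.isSome)
    (hold : ∀ x ≤ n, c' x = c x) (hnew : c' (n + 1) = .attached (n + 1)) :
    Faithful r (n + 1) c' := by
  refine hc.addStrand hr hold (fun hA => ?_) (fun hU => by simp [hnew] at hU)
    (fun {A} hA => ?_) (fun {u A B} hu hA hB => ?_)
  · obtain rfl := by simpa [hnew, Cell.succ, Cell.pred] using hA
    exact ⟨le_rfl, hnew⟩
  · obtain rfl : n + 1 = A := by simpa [hnew, Cell.succ] using hA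
    exact ⟨rfl, hnew⟩
  · obtain rfl : n + 1 = B := by simpa [hnew, Cell.pred] using hB
    obtain ⟨hAn, -⟩ := hc.succ_label hu hA
    rw [hps u, hps A, or_iff_right (by omega), or_iff_right (by omega)]
    refine exists_congr fun p => and_congr_right fun hp => ?_
    obtain ⟨hpn, hlast, hlive⟩ := hlast p hp
    exact hc.rel_iff_label_of_isLast hr hu hpn hlast hA hlive

theorem newOpened (hr : StrandOrder r) (hc : Faithful r n c) {p P : ℕ}
    (hps : ImmediatePreds r (n + 1) [p]) (hp : p ≤ n) (hlast : IsLast r n c p)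
    (hP : P ∈ (c p).pred) (hold : ∀ x ≤ n, c' x = c x) (hnew : c' (n + 1) = .opened (n + 1) P) :
    Faithful r (n + 1) c' := by
  refine hc.addStrand hr hold (fun {A} hA => ?_) (fun {U Q} hU => ?_)
    (fun hA => by simp [hnew, Cell.succ] at hA) (fun {u A B} hu hA hB => ?_)
  · obtain rfl : P = A := by simpa [hnew, Cell.succ, Cell.pred] using hA
    obtain ⟨hPn, hcP⟩ := hc.pred_label hp hP
    exact ⟨by omega, by rw [hold P hPn, hcP]⟩
  · obtain ⟨rfl, rfl⟩ : n + 1 = U ∧ P = Q := by simpa [hnew] using hU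
    exact ⟨le_rfl, hnew⟩
  · obtain rfl : P = B := by simpa [hnew, Cell.pred] using hB
    rw [hps u, or_iff_right (by omega), ← hc.rel_iff_of_isLast hr hu hp hlast hA hP]
    simp

end Faithful

end

/-! ## Blocks -/

/-- A series-parallel piece of the computation dag that has been executed by the function instance
`fn` and can still be extended at its last strand: it begins with the strand `src` and ends with the
strand `snk`, and `exits` are the strands that have been forked at `snk`. -/
structure Block where
  fn : ℕ
  src : ℕ
  snk : ℕ
  exits : List ℕ

namespace Block

/-- The position of the block `d` relative to a block `e` that begins later. -/
def Below (r : ℕ → ℕ → Prop) (d e : Block) : Prop :=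
  d.snk < e.src ∧ (d.exits ≠ [] → r d.snk e.src)

/-- The place of the block `e` in the order `r` of the strands up to `n`, and the shape of its part
of `D_NSP`. By `out`, the set of its sink can be left only through the exits. -/
structure Inv (r : ℕ → ℕ → Prop) (n : ℕ) (c : ℕ → Cell) (e : Block) : Prop where
  rel : r e.src e.snk
  snk_le : e.snk ≤ n
  src_first : IsFirst r n c e.src
  src_le : ∀ x ≤ n, c x = c e.snk → r e.src x
  snk_last : IsLast r n c e.snk
  cells : (∃ A B, c e.src = .attached A ∧ c e.snk = .attached B) ∨
    ∃ U P, c e.src = .opened U P ∧ c e.snk = .opened U P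
  out : ∀ x ≤ n, ∀ y ≤ n, (c y).pred.isSome → c x = c e.snk → r x y →
    c y = c e.snk ∨ ∃ s ∈ e.exits, r s y
  exits : ∀ s ∈ e.exits, ImmediatePreds r s [e.snk]

end Block

section

variable {r : ℕ → ℕ → Prop} {n n' : ℕ} {c c' : ℕ → Cell} {e d : Block}

theorem IsLast.eq_of_cell_eq (hr : StrandOrder r) {t t' : ℕ} (ht : t ≤ n) (ht' : t' ≤ n)
    (hlast : IsLast r n c t) (hlast' : IsLast r n c t') (h : c t = c t') : t = t' :=
  hr.antisymm (hlast' t ht (.inl h)) (hlast t' ht' (.inl h.symm))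

/-- In passing from `c` to `c'`, the cell of `t` and those that feed into it stay as they are, and
no strand is added to them. -/
def KeepsSet (n : ℕ) (c : ℕ → Cell) (n' : ℕ) (c' : ℕ → Cell) (t : ℕ) : Prop :=
  t ≤ n ∧ ∀ x ≤ n', (c' x).FeedsInto (c' t) ∨ x ≤ n ∧ c x = c t → x ≤ n ∧ c' x = c x

theorem KeepsSet.cell_eq (h : KeepsSet n c n' c' e.snk) (hn : n ≤ n') : c' e.snk = c e.snk :=
  (h.2 _ (h.1.trans hn) (.inr ⟨h.1, rfl⟩)).2

theorem IsLast.of_keepsSet {t : ℕ} (ht : IsLast r n c t) (hn : n ≤ n')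
    (hkeep : KeepsSet n c n' c' t) : IsLast r n' c' t := by
  intro x hx hfeeds
  obtain ⟨hxn, hcx⟩ := hkeep.2 x hx (.inl hfeeds)
  have hct : c' t = c t := (hkeep.2 t (hkeep.1.trans hn) (.inr ⟨hkeep.1, rfl⟩)).2
  exact ht x hxn (by rwa [hcx, hct] at hfeeds)

namespace Block

theorem Below.snk_lt_snk (hr : StrandOrder r) (h : Below r d e) (he : e.Inv r n c) :
    d.snk < e.snk :=
  h.1.trans_le (hr.le he.rel)

theorem Below.cell_ne (hr : StrandOrder r) (h : Below r d e) (hd : d.Inv r n c)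
    (he : e.Inv r n c) : c d.snk ≠ c e.snk := fun heq =>
  (h.snk_lt_snk hr he).ne (hd.snk_last.eq_of_cell_eq hr hd.snk_le he.snk_le he.snk_last heq)

namespace Inv

theorem src_le_n (hr : StrandOrder r) (he : e.Inv r n c) : e.src ≤ n :=
  (hr.le he.rel).trans he.snk_le

theorem live (he : e.Inv r n c) : (c e.snk).pred.isSome := by
  obtain ⟨A, B, -, h⟩ | ⟨U, P, -, h⟩ := he.cells <;> simp [h, Cell.pred]

theorem src_cell_of_snk_attached (he : e.Inv r n c) {B : ℕ} (h : c e.snk = .attached B) :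
    ∃ A, c e.src = .attached A := by
  obtain ⟨A, -, hA, -⟩ | ⟨U, P, -, hU⟩ := he.cells
  · exact ⟨A, hA⟩
  · simp [h] at hU

theorem snk_cell_of_src_attached (he : e.Inv r n c) {A : ℕ} (h : c e.src = .attached A) :
    ∃ B, c e.snk = .attached B := by
  obtain ⟨-, B, -, hB⟩ | ⟨U, P, hU, -⟩ := he.cells
  · exact ⟨B, hB⟩
  · simp [h] at hU

theorem src_cell_of_snk_opened (he : e.Inv r n c) {U P : ℕ} (h : c e.snk = .opened U P) :
    c e.src = .opened U P := by
  obtain ⟨A, B, -, hB⟩ | ⟨V, Q, hsrc, hsnk⟩ := he.cells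
  · simp [h] at hB
  · rw [hsrc, ← hsnk, h]

theorem mono (hr : StrandOrder r) (he : e.Inv r n c) (hn : n ≤ n') {exits : List ℕ}
    (hkeep : KeepsSet n c n' c' e.snk) (hfirst : IsFirst r n' c' e.src)
    (hattached : ∀ A, c e.src = .attached A → c' e.src = .attached A)
    (hlive : ∀ y ≤ n, (c' y).pred.isSome → (c y).pred.isSome)
    (hsub : e.exits ⊆ exits) (hexits : ∀ s ∈ exits, ImmediatePreds r s [e.snk])
    (hnew : ∀ x ≤ n, c x = c e.snk → ∀ y ≤ n', n < y → r x y → ∃ s ∈ exits, r s y) :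
    Inv r n' c' { e with exits := exits } := by
  have hsnk := hkeep.cell_eq hn
  have hold : ∀ x ≤ n', c' x = c' e.snk → x ≤ n ∧ c x = c e.snk := fun x hx h => by
    obtain ⟨hxn, hcx⟩ := hkeep.2 x hx (.inl (.inl h))
    exact ⟨hxn, by rw [← hcx, h, hsnk]⟩
  refine ⟨he.rel, he.snk_le.trans hn, hfirst,
    fun x hx h => he.src_le x (hold x hx h).1 (hold x hx h).2, he.snk_last.of_keepsSet hn hkeep,
    ?_, fun x hx y hy hylive hxc hxy => ?_, hexits⟩
  · obtain ⟨A, B, hA, hB⟩ | ⟨U, P, hU, hU'⟩ := he.cells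
    · exact .inl ⟨A, B, hattached A hA, hsnk.trans hB⟩
    · have hsrc := he.src_le_n hr
      have hkept := (hkeep.2 _ (hsrc.trans hn) (.inr ⟨hsrc, hU.trans hU'.symm⟩)).2
      exact .inr ⟨U, P, hkept.trans hU, hsnk.trans hU'⟩
  · obtain ⟨hxn, hcx⟩ := hold x hx hxc
    rcases le_or_gt y n with hyn | hyn
    · refine (he.out x hxn y hyn (hlive y hyn hylive) hcx hxy).imp (fun h => ?_)
        fun ⟨s, hs, h⟩ => ⟨s, hsub hs, h⟩
      exact ((hkeep.2 y hy (.inr ⟨hyn, h⟩)).2.trans h).trans hsnk.symm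
    · exact .inr (hnew x hxn hcx y hy hyn hxy)

theorem not_rel_of_preds (he : e.Inv r n c) (hr : StrandOrder r) {ps : List ℕ}
    (hps : ImmediatePreds r (n + 1) ps)
    (hne : ∀ p ∈ ps, p ≤ n ∧ (c p).pred.isSome ∧ c p ≠ c e.snk) {x : ℕ} (hx : x ≤ n)
    (hcx : c x = c e.snk) (h : r x (n + 1)) : ∃ s ∈ e.exits, r s (n + 1) := by
  obtain rfl | ⟨p, hp, hxp⟩ := (hps x).1 h
  · omega
  obtain ⟨hpn, hlive, hcp⟩ := hne p hp
  obtain ⟨s, hs, hsp⟩ := (he.out x hx p hpn hlive hcx hxp).resolve_left hcp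
  exact ⟨s, hs, hr.trans hsp (hps.rel hr hp)⟩

end Inv

end Block

end

section

variable {r : ℕ → ℕ → Prop} {n : ℕ} {c c' : ℕ → Cell}

/-- The cells `c'` arise from cells `c` of the strands up to `n` by putting the strand `n + 1` into
a new set. -/
structure AddsStrand (r : ℕ → ℕ → Prop) (n : ℕ) (c c' : ℕ → Cell) : Prop where
  old : ∀ x ≤ n, c' x = c x
  faithful : Faithful r (n + 1) c'
  new_not_feedsInto : ∀ x ≤ n, ¬ (c' (n + 1)).FeedsInto (c x)
  not_feedsInto_new : ∀ x ≤ n, ¬ (c x).FeedsInto (c' (n + 1))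
  live : (c' (n + 1)).pred.isSome

namespace AddsStrand

theorem of_attached (hr : StrandOrder r) (hc : Faithful r n c) {ps : List ℕ}
    (hps : ImmediatePreds r (n + 1) ps)
    (hlast : ∀ p ∈ ps, p ≤ n ∧ IsLast r n c p ∧ (c p).pred.isSome)
    (hold : ∀ x ≤ n, c' x = c x) (hnew : c' (n + 1) = .attached (n + 1)) :
    AddsStrand r n c c' where
  old := hold
  faithful := hc.newAttached hr hps hlast hold hnew
  new_not_feedsInto x hx h := by
    have hx' : n + 1 ∈ (c x).succ := by
      rw [Cell.eq_of_feedsInto (by simp [hnew, Cell.pred]) h |>.symm.trans hnew]; rfl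
    have := (hc.succ_label hx hx').1
    omega
  not_feedsInto_new x hx h := by
    have := (hc.succ_label hx (Cell.feedsInto_attached_iff.1 (hnew ▸ h))).1
    omega
  live := by simp [hnew, Cell.pred]

theorem of_opened (hr : StrandOrder r) (hc : Faithful r n c) {p P : ℕ}
    (hps : ImmediatePreds r (n + 1) [p]) (hp : p ≤ n) (hlast : IsLast r n c p)
    (hP : P ∈ (c p).pred) (hold : ∀ x ≤ n, c' x = c x) (hnew : c' (n + 1) = .opened (n + 1) P) :
    AddsStrand r n c c' := by
  have hne : ∀ x ≤ n, c x ≠ .opened (n + 1) P := fun x hx h => by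
    have := (hc.opened_label hx h).1
    omega
  exact {
    old := hold
    faithful := hc.newOpened hr hps hp hlast hP hold hnew
    new_not_feedsInto := fun x hx h => hne x hx
      (Cell.eq_of_feedsInto (by simp [hnew, Cell.pred]) h |>.symm.trans hnew)
    not_feedsInto_new := fun x hx h => hne x hx
      ((Cell.feedsInto_iff_eq (by simp [hnew])).1 h |>.trans hnew)
    live := by simp [hnew, Cell.pred] }

theorem keepsSet (h : AddsStrand r n c c') {t : ℕ} (ht : t ≤ n) :
    KeepsSet n c (n + 1) c' t := by
  refine ⟨ht, fun x hx hxt => ?_⟩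
  rcases Nat.le_add_one_iff.1 hx with hx | rfl
  · exact ⟨hx, h.old x hx⟩
  · obtain hxt | ⟨hx, -⟩ := hxt
    · exact absurd (h.old t ht ▸ hxt) (h.new_not_feedsInto t ht)
    · omega

theorem isFirst (h : AddsStrand r n c c') {s : ℕ} (hs : s ≤ n) (hfirst : IsFirst r n c s) :
    IsFirst r (n + 1) c' s := fun x hx hxs => by
  obtain ⟨hxn, hcx⟩ := (h.keepsSet hs).2 x hx (.inl (.inl hxs))
  exact hfirst x hxn (by rw [← hcx, hxs, h.old s hs])

theorem eq_new (h : AddsStrand r n c c') {x : ℕ} (hx : x ≤ n + 1)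
    (hxc : (c' x).FeedsInto (c' (n + 1))) : x = n + 1 := by
  rcases Nat.le_add_one_iff.1 hx with hx | rfl
  · exact absurd (h.old x hx ▸ hxc) (h.not_feedsInto_new x hx)
  · rfl

theorem block_inv (h : AddsStrand r n c c') (hr : StrandOrder r) {e : Block} (he : e.Inv r n c)
    {exits : List ℕ} (hsub : e.exits ⊆ exits) (hexits : ∀ s ∈ exits, ImmediatePreds r s [e.snk])
    (hnew : ∀ x ≤ n, c x = c e.snk → r x (n + 1) → ∃ s ∈ exits, r s (n + 1)) :
    Block.Inv r (n + 1) c' { e with exits := exits } := by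
  refine he.mono hr n.le_succ (h.keepsSet he.snk_le) (h.isFirst (he.src_le_n hr) he.src_first)
    (fun A hA => by rw [h.old _ (he.src_le_n hr), hA]) (fun y hy => by rw [h.old y hy]; exact id)
    hsub hexits fun x hx hcx y hy hyn hxy => ?_
  obtain rfl : y = n + 1 := by omega
  exact hnew x hx hcx hxy

theorem block_inv_new (h : AddsStrand r n c c') (hr : StrandOrder r) {src : ℕ} (fn : ℕ)
    (hsrc : r src (n + 1)) (hfirst : IsFirst r (n + 1) c' src)
    (hcells : (∃ A B, c' src = .attached A ∧ c' (n + 1) = .attached B) ∨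
      ∃ U P, c' src = .opened U P ∧ c' (n + 1) = .opened U P) :
    Block.Inv r (n + 1) c' ⟨fn, src, n + 1, []⟩ where
  rel := hsrc
  snk_le := le_rfl
  src_first := hfirst
  src_le x hx hxc := by rwa [h.eq_new hx (.inl hxc)]
  snk_last x hx hxc := by rw [h.eq_new hx hxc]; exact hr.refl _
  cells := hcells
  out x hx y hy _ hxc hxy := by
    obtain rfl := h.eq_new hx (.inl hxc)
    exact .inl (by rw [le_antisymm hy (hr.le hxy)])
  exits := by simp

theorem block_inv_singleton (h : AddsStrand r n c c') (hr : StrandOrder r) (fn : ℕ) :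
    Block.Inv r (n + 1) c' ⟨fn, n + 1, n + 1, []⟩ := by
  refine h.block_inv_new hr fn (hr.refl _)
    (fun x hx hxc => by rw [h.eq_new hx (.inl hxc)]; exact hr.refl _) ?_
  have hlive := h.live
  rcases hcell : c' (n + 1) with A | ⟨U, P⟩ | A <;> simp_all [Cell.pred]

end AddsStrand

/-- The cells of the strands up to `n` when `L` are the blocks of the execution, the most recent one
first, and `fut` the last strands of the completed futures. -/
structure Shape (r : ℕ → ℕ → Prop) (n : ℕ) (L : List Block) (fut : Set ℕ) (c : ℕ → Cell) :
    Prop where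
  faithful : Faithful r n c
  block : ∀ e ∈ L, e.Inv r n c
  order : L.Pairwise fun e d => d.Below r e
  opened_mem : ∀ x ≤ n, ∀ U P, c x = .opened U P → ∃ e ∈ L, c x = c e.snk
  fut : ∀ t ∈ fut, t ≤ n ∧ (∃ A, c t = .attached A) ∧ IsLast r n c t ∧ ∀ e ∈ L, t ≠ e.snk

namespace Shape

variable {L L' : List Block} {fut : Set ℕ}

theorem cell_ne_of_mem_fut (hr : StrandOrder r) (h : Shape r n L fut c) {t : ℕ} (ht : t ∈ fut)
    {e : Block} (he : e ∈ L) : c t ≠ c e.snk := fun heq => by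
  obtain ⟨htn, -, hlast, hne⟩ := h.fut t ht
  exact hne e he (hlast.eq_of_cell_eq hr htn (h.block e he).snk_le (h.block e he).snk_last heq)

theorem addStrand (h : Shape r n L fut c) (hadd : AddsStrand r n c c')
    (hblock : ∀ e ∈ L', e.Inv r (n + 1) c') (horder : L'.Pairwise fun e d => d.Below r e)
    (hnew : ∃ e ∈ L', e.snk = n + 1) (hsnk : ∀ e ∈ L', e.snk = n + 1 ∨ ∃ d ∈ L, d.snk = e.snk)
    (hopened : ∀ e ∈ L, ∀ U P, c e.snk = .opened U P → ∃ e' ∈ L', e'.snk = e.snk) :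
    Shape r (n + 1) L' fut c' := by
  refine ⟨hadd.faithful, hblock, horder, fun x hx U P hxU => ?_, fun t ht => ?_⟩
  · rcases Nat.le_add_one_iff.1 hx with hx | rfl
    · obtain ⟨e, he, hxe⟩ := h.opened_mem x hx U P (hadd.old x hx ▸ hxU)
      obtain ⟨e', he', heq⟩ := hopened e he U P (by rw [← hxe, ← hadd.old x hx, hxU])
      exact ⟨e', he', by rw [heq, hadd.old x hx, hadd.old _ (h.block e he).snk_le, hxe]⟩
    · obtain ⟨e, he, heq⟩ := hnew
      exact ⟨e, he, by rw [heq]⟩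
  · obtain ⟨htn, ⟨A, hA⟩, hlast, hne⟩ := h.fut t ht
    refine ⟨by omega, ⟨A, by rw [hadd.old t htn, hA]⟩,
      hlast.of_keepsSet n.le_succ (hadd.keepsSet htn), fun e he heq => ?_⟩
    obtain hsnk | ⟨d, hd, hsnk⟩ := hsnk e he
    · omega
    · exact hne d hd (heq.trans hsnk.symm)

end Shape

end

section

variable {r : ℕ → ℕ → Prop} {n : ℕ} {c c' : ℕ → Cell} {L : List Block} {fut : Set ℕ}

theorem Block.Below.of_rel (hr : StrandOrder r) {d e e' : Block} (h : d.Below r e)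
    (hrel : r e.src e'.src) : d.Below r e' :=
  ⟨h.1.trans_le (hr.le hrel), fun hne => hr.trans (h.2 hne) hrel⟩

theorem AddsStrand.block_inv_of_preds (hadd : AddsStrand r n c c') (hr : StrandOrder r)
    {ps : List ℕ} (hps : ImmediatePreds r (n + 1) ps) {d : Block} (hd : d.Inv r n c)
    (hne : ∀ p ∈ ps, p ≤ n ∧ (c p).pred.isSome ∧ c p ≠ c d.snk) : d.Inv r (n + 1) c' :=
  hadd.block_inv hr hd (List.Subset.refl _) hd.exits fun _ hx hcx hxn =>
    hd.not_rel_of_preds hr hps hne hx hcx hxn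

namespace Shape

theorem call (hr : StrandOrder r) {F s N : ℕ} (h : Shape r n (⟨F, s, n, []⟩ :: L) fut c)
    (hadd : AddsStrand r n c c') (hps : ImmediatePreds r (n + 1) [n]) :
    Shape r (n + 1) (⟨N, n + 1, n + 1, []⟩ :: ⟨F, s, n, [n + 1]⟩ :: L) fut c' := by
  obtain ⟨hhead, htail⟩ := List.forall_mem_cons.1 h.block
  obtain ⟨hbelow, hpw⟩ := List.pairwise_cons.1 h.order
  have hn := hps.rel hr (List.mem_singleton_self n)
  refine h.addStrand hadd ?_ ?_ ⟨_, List.mem_cons_self, rfl⟩ ?_ ?_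
  · refine List.forall_mem_cons.2 ⟨hadd.block_inv_singleton hr N, List.forall_mem_cons.2
      ⟨?_, fun d hd => ?_⟩⟩
    · exact hadd.block_inv hr hhead (exits := [n + 1]) (by simp) (by simpa using hps)
        fun _ _ _ _ => ⟨n + 1, by simp, hr.refl _⟩
    · exact hadd.block_inv_of_preds hr hps (htail d hd) (by
        simpa using ⟨hhead.live, ((hbelow d hd).cell_ne hr (htail d hd) hhead).symm⟩)
  · refine List.pairwise_cons.2 ⟨List.forall_mem_cons.2 ⟨⟨n.lt_succ_self, fun _ => hn⟩,
      fun d hd => (hbelow d hd).of_rel hr (hr.trans hhead.rel hn)⟩, List.pairwise_cons.2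
      ⟨fun d hd => (hbelow d hd).of_rel hr (hr.refl _), hpw⟩⟩
  · simp only [List.forall_mem_cons, List.exists_mem_cons_iff, true_or, or_true, true_and]
    exact fun d hd => .inr (.inr ⟨d, hd, rfl⟩)
  · simp only [List.forall_mem_cons, List.exists_mem_cons_iff, true_or, or_true, implies_true,
      true_and]
    exact fun d hd _ _ _ => .inr (.inr ⟨d, hd, rfl⟩)

theorem retSpawn (hr : StrandOrder r) {F G src caller first : ℕ}
    (h : Shape r n (⟨G, first, n, []⟩ :: ⟨F, src, caller, [first]⟩ :: L) fut c)
    (hadd : AddsStrand r n c c') (hps : ImmediatePreds r (n + 1) [caller]) :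
    Shape r (n + 1) (⟨F, n + 1, n + 1, []⟩ :: ⟨G, first, n, []⟩ ::
      ⟨F, src, caller, [first, n + 1]⟩ :: L) fut c' := by
  obtain ⟨hchild, hparent, htail⟩ : Block.Inv r n c _ ∧ Block.Inv r n c _ ∧ _ := by
    simpa only [List.forall_mem_cons] using h.block
  obtain ⟨⟨hchild_parent, hchild_tail⟩, hparent_tail, hpw⟩ : (_ ∧ _) ∧ _ ∧ _ := by
    simpa only [List.pairwise_cons, List.forall_mem_cons] using h.order
  have hcaller := hps.rel hr (List.mem_singleton_self caller)
  have preds_ok : ∀ d : Block, c caller ≠ c d.snk →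
      ∀ p ∈ [caller], p ≤ n ∧ (c p).pred.isSome ∧ c p ≠ c d.snk := fun d hd => by
    simpa using ⟨hparent.snk_le, hparent.live, hd⟩
  refine h.addStrand hadd ?_ ?_ ⟨_, List.mem_cons_self, rfl⟩ ?_ ?_
  · simp only [List.forall_mem_cons]
    refine ⟨hadd.block_inv_singleton hr F, hadd.block_inv_of_preds hr hps hchild
      (preds_ok _ (hchild_parent.cell_ne hr hparent hchild)), ?_, fun d hd =>
      hadd.block_inv_of_preds hr hps (htail d hd)
        (preds_ok d ((hparent_tail d hd).cell_ne hr (htail d hd) hparent).symm)⟩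
    refine hadd.block_inv hr hparent (exits := [first, n + 1]) (by simp) ?_
      fun _ _ _ _ => ⟨n + 1, by simp, hr.refl _⟩
    simpa using ⟨hparent.exits first (by simp), hps⟩
  · simp only [List.pairwise_cons, List.forall_mem_cons]
    exact ⟨⟨⟨n.lt_succ_self, by simp⟩, ⟨Nat.lt_succ_of_le hparent.snk_le, fun _ => hcaller⟩,
      fun d hd => (hparent_tail d hd).of_rel hr (hr.trans hparent.rel hcaller)⟩,
      ⟨⟨hchild_parent.1, fun _ => hchild_parent.2 (by simp)⟩, hchild_tail⟩,
      fun d hd => (hparent_tail d hd).of_rel hr (hr.refl _), hpw⟩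
  · simp only [List.forall_mem_cons, List.exists_mem_cons_iff, true_or, or_true, true_and]
    exact fun d hd => .inr (.inr (.inr ⟨d, hd, rfl⟩))
  · simp only [List.forall_mem_cons, List.exists_mem_cons_iff, true_or, or_true, implies_true,
      true_and]
    exact fun d hd _ _ _ => .inr (.inr (.inr ⟨d, hd, rfl⟩))

theorem extend (hr : StrandOrder r) {F s t : ℕ} {exits : List ℕ} {M : List Block} {ps : List ℕ}
    (h : Shape r n (M ++ ⟨F, s, t, exits⟩ :: L) fut c) (hadd : AddsStrand r n c c')
    (hps : ImmediatePreds r (n + 1) ps)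
    (hlive : ∀ p ∈ ps, p ≤ n ∧ (c p).pred.isSome ∧ ∀ d ∈ L, c p ≠ c d.snk) (ht : r t (n + 1))
    (hattached : ∃ A, c t = .attached A) (hM : ∀ e ∈ M, ∃ A, c e.snk = .attached A)
    (hnew : c' (n + 1) = .attached (n + 1)) :
    Shape r (n + 1) (⟨F, s, n + 1, []⟩ :: L) fut c' := by
  have hblock := h.block
  simp only [List.forall_mem_append, List.forall_mem_cons] at hblock
  obtain ⟨-, hblock, htail⟩ := hblock
  obtain ⟨hbelow, hpw⟩ := List.pairwise_cons.1 (List.pairwise_append.1 h.order).2.1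
  refine h.addStrand hadd (List.forall_mem_cons.2 ⟨?_, fun d hd => ?_⟩) (List.pairwise_cons.2
    ⟨fun d hd => (hbelow d hd).of_rel hr (hr.refl _), hpw⟩) ⟨_, List.mem_cons_self, rfl⟩
    (List.forall_mem_cons.2 ⟨.inl rfl, fun d hd => .inr ⟨d, by simp [hd], rfl⟩⟩)
    fun e he U P hU => ?_
  · have hsn := hblock.src_le_n hr
    obtain ⟨B, hB⟩ := hattached
    obtain ⟨A, hA⟩ := hblock.src_cell_of_snk_attached hB
    exact hadd.block_inv_new hr F (hr.trans hblock.rel ht) (hadd.isFirst hsn hblock.src_first)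
      (.inl ⟨A, _, (hadd.old s hsn).trans hA, hnew⟩)
  · exact hadd.block_inv_of_preds hr hps (htail d hd) fun p hp =>
      ⟨(hlive p hp).1, (hlive p hp).2.1, (hlive p hp).2.2 d hd⟩
  · rcases List.mem_append.1 he with he | he
    · obtain ⟨A, hA⟩ := hM e he
      simp [hA] at hU
    · rcases List.mem_cons.1 he with rfl | he
      · obtain ⟨A, hA⟩ := hattached
        simp [hA] at hU
      · exact ⟨e, by simp [he], rfl⟩

end Shape

end

section

variable {r : ℕ → ℕ → Prop} {n U P : ℕ} {c c' : ℕ → Cell}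

namespace AttachesSet

theorem of_attached (ha : AttachesSet n c c' U P) {x A : ℕ} (hx : x ≤ n) (h : c x = .attached A) :
    c' x = .attached A := by
  rw [ha.other x hx (by simp [h]), h]

theorem feedsInto (ha : AttachesSet n c c' U P) (hc : Faithful r n c) (hU : c U = .opened U P)
    {x t : ℕ} (hx : x ≤ n) (ht : t ≤ n) (h : (c' x).FeedsInto (c' t)) :
    (c x).FeedsInto (c t) := by
  have label_ne : ∀ y ≤ n, U ∉ (c y).succ := fun y hy hUy => by
    have := (hc.succ_label hy hUy).2
    simp [hU] at this
  by_cases htU : c t = .opened U P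
  · rw [ha.attached t ht htU, Cell.feedsInto_attached_iff] at h
    by_cases hxU : c x = .opened U P
    · exact .inl (hxU.trans htU.symm)
    · exact absurd (ha.other x hx hxU ▸ h) (label_ne x hx)
  · rw [ha.other t ht htU] at h
    by_cases hxU : c x = .opened U P
    · have hlive : (c' x).pred.isSome := by simp [ha.attached x hx hxU, Cell.pred]
      have hct : c t = .attached U :=
        (Cell.eq_of_feedsInto hlive h).symm.trans (ha.attached x hx hxU)
      exact absurd (Cell.mem_succ_of_eq hct) (label_ne t ht)
    · rwa [ha.other x hx hxU] at h

theorem eq_iff (ha : AttachesSet n c c' U P) (hc : Faithful r n c) (hU : c U = .opened U P)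
    {x y : ℕ} (hx : x ≤ n) (hy : y ≤ n) : c' x = c' y ↔ c x = c y := by
  refine ⟨fun h => ?_, fun h => ?_⟩
  · obtain hxy | ⟨A, hxA, hyA⟩ := ha.feedsInto hc hU hx hy (.inl h)
    · exact hxy
    · rw [ha.of_attached hy hyA, ha.other x hx (by simp [hxA]), hxA] at h
      simp at h
  · by_cases hxU : c x = .opened U P
    · rw [ha.attached x hx hxU, ha.attached y hy (h ▸ hxU)]
    · rw [ha.other x hx hxU, ha.other y hy (h ▸ hxU), h]

theorem live_iff (ha : AttachesSet n c c' U P) {y : ℕ} (hy : y ≤ n) :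
    (c' y).pred.isSome ↔ (c y).pred.isSome := by
  by_cases hyU : c y = .opened U P
  · simp [ha.attached y hy hyU, hyU, Cell.pred]
  · rw [ha.other y hy hyU]

theorem isLast (ha : AttachesSet n c c' U P) (hc : Faithful r n c) (hU : c U = .opened U P)
    {t : ℕ} (ht : t ≤ n) (hlast : IsLast r n c t) : IsLast r n c' t := fun x hx h =>
  hlast x hx (ha.feedsInto hc hU hx ht h)

theorem block_inv (ha : AttachesSet n c c' U P) (hr : StrandOrder r) (hc : Faithful r n c)
    (hU : c U = .opened U P) {e : Block} (he : e.Inv r n c) : e.Inv r n c' where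
  rel := he.rel
  snk_le := he.snk_le
  src_first x hx h := he.src_first x hx ((ha.eq_iff hc hU hx (he.src_le_n hr)).1 h)
  src_le x hx h := he.src_le x hx ((ha.eq_iff hc hU hx he.snk_le).1 h)
  snk_last := ha.isLast hc hU he.snk_le he.snk_last
  cells := by
    have hsrc := he.src_le_n hr
    obtain ⟨A, B, hA, hB⟩ | ⟨V, Q, hV, hV'⟩ := he.cells
    · exact .inl ⟨A, B, ha.of_attached hsrc hA, ha.of_attached he.snk_le hB⟩
    · by_cases hVU : c e.src = .opened U P
      · exact .inl ⟨U, U, ha.attached _ hsrc hVU,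
          ha.attached _ he.snk_le (hV'.trans (hV.symm.trans hVU))⟩
      · exact .inr ⟨V, Q, (ha.other _ hsrc hVU).trans hV,
          (ha.other _ he.snk_le (by rwa [hV', ← hV])).trans hV'⟩
  out x hx y hy hlive hxe hxy := by
    rw [ha.eq_iff hc hU hy he.snk_le]
    exact he.out x hx y hy ((ha.live_iff hy).1 hlive) ((ha.eq_iff hc hU hx he.snk_le).1 hxe) hxy
  exits := he.exits

end AttachesSet

theorem Shape.attach (hr : StrandOrder r) {L : List Block} {fut : Set ℕ} (h : Shape r n L fut c)
    {e : Block} (he : e ∈ L) (hcell : c e.snk = .opened U P)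
    (hexits : ∀ s ∈ e.exits, s ≤ n ∧ IsFirst r n c s ∧ ∃ S, c s = .attached S)
    (ha : AttachesSet n c c' U P) : Shape r n L fut c' := by
  have hinv := h.block e he
  have hU := (h.faithful.opened_label hinv.snk_le hcell).2
  have hsnk : ∀ s ∈ e.exits, r e.snk s := fun s hs =>
    (hinv.exits s hs).rel hr (List.mem_singleton_self _)
  refine ⟨h.faithful.attach hr hinv.snk_le hcell hinv.snk_last
    (fun s hs => ⟨hsnk s hs, hexits s hs⟩) hinv.out ha,
    fun d hd => ha.block_inv hr h.faithful hU (h.block d hd), h.order, fun x hx V Q hxV => ?_,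
    fun t ht => ?_⟩
  · have hxU : c x ≠ .opened U P := fun hxU => by simp [ha.attached x hx hxU] at hxV
    obtain ⟨d, hd, hxd⟩ := h.opened_mem x hx V Q (ha.other x hx hxU ▸ hxV)
    exact ⟨d, hd, (ha.eq_iff h.faithful hU hx (h.block d hd).snk_le).2 hxd⟩
  · obtain ⟨htn, ⟨A, hA⟩, hlast, hne⟩ := h.fut t ht
    exact ⟨htn, ⟨A, ha.of_attached htn hA⟩, ha.isLast h.faithful hU htn hlast, hne⟩

end

/-! ## Joins -/

/-- The strand `n + 1` joins the blocks `a` and `b`, which have been forked at the sink of the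
block `f`. The roles of `a` and `b` are symmetric. -/
structure Join (r : ℕ → ℕ → Prop) (n : ℕ) (c : ℕ → Cell) (a b f : Block) : Prop where
  inv_a : a.Inv r n c
  inv_b : b.Inv r n c
  inv_f : f.Inv r n c
  exits_a : a.exits = []
  exits_b : b.exits = []
  exits_f : ∀ s, s ∈ f.exits ↔ s = a.src ∨ s = b.src
  lt_a : f.snk < a.src
  lt_b : f.snk < b.src
  snk_ne : a.snk ≠ b.snk
  preds : ImmediatePreds r (n + 1) [a.snk, b.snk]

section

variable {r : ℕ → ℕ → Prop} {n : ℕ} {c c' : ℕ → Cell} {a b f : Block}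

namespace Join

theorem symm (j : Join r n c a b f) : Join r n c b a f where
  inv_a := j.inv_b
  inv_b := j.inv_a
  inv_f := j.inv_f
  exits_a := j.exits_b
  exits_b := j.exits_a
  exits_f s := by rw [j.exits_f, or_comm]
  lt_a := j.lt_b
  lt_b := j.lt_a
  snk_ne := j.snk_ne.symm
  preds x := by simpa [or_comm] using j.preds x

theorem fork_a (j : Join r n c a b f) : ImmediatePreds r a.src [f.snk] :=
  j.inv_f.exits _ ((j.exits_f _).2 (.inl rfl))

theorem f_rel_a (j : Join r n c a b f) (hr : StrandOrder r) : r f.snk a.src :=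
  j.fork_a.rel hr (List.mem_singleton_self _)

theorem a_rel_new (j : Join r n c a b f) (hr : StrandOrder r) : r a.snk (n + 1) :=
  j.preds.rel hr List.mem_cons_self

theorem f_rel_new (j : Join r n c a b f) (hr : StrandOrder r) : r f.snk (n + 1) :=
  hr.trans (j.f_rel_a hr) (hr.trans j.inv_a.rel (j.a_rel_new hr))

theorem cell_a_ne_b (j : Join r n c a b f) (hr : StrandOrder r) : c a.snk ≠ c b.snk := fun h =>
  j.snk_ne (j.inv_a.snk_last.eq_of_cell_eq hr j.inv_a.snk_le j.inv_b.snk_le j.inv_b.snk_last h)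

theorem cell_a_ne_f (j : Join r n c a b f) (hr : StrandOrder r) : c a.snk ≠ c f.snk := fun h =>
  (j.lt_a.trans_le (hr.le j.inv_a.rel)).ne'
    (j.inv_a.snk_last.eq_of_cell_eq hr j.inv_a.snk_le j.inv_f.snk_le j.inv_f.snk_last h)

theorem cell_eq_of_rel (j : Join r n c a b f) {x y : ℕ} (hx : x ≤ n) (hy : y ≤ n)
    (hlive : (c y).pred.isSome) (hxa : c x = c a.snk) (hxy : r x y) : c y = c a.snk := by
  simpa [j.exits_a] using j.inv_a.out x hx y hy hlive hxa hxy

theorem not_rel_of_new (j : Join r n c a b f) (hr : StrandOrder r) {u v : ℕ}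
    (hu : u = n + 1 ∨ u ≤ n ∧ c u = c a.snk) (hv : v ≤ n) (hlive : (c v).pred.isSome)
    (hva : c v ≠ c a.snk) : ¬ r u v := fun h => by
  obtain rfl | ⟨hun, hua⟩ := hu
  · have := hr.le h
    omega
  · exact hva (j.cell_eq_of_rel hun hv hlive hua h)

theorem cases_of_f_rel (j : Join r n c a b f) {x y : ℕ} (hx : x ≤ n) (hy : y ≤ n)
    (hlive : (c y).pred.isSome) (hxf : c x = c f.snk) (hxy : r x y) :
    c y = c f.snk ∨ r a.src y ∨ r b.src y := by
  simpa [j.exits_f, or_and_right, exists_or] using j.inv_f.out x hx y hy hlive hxf hxy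

theorem rel_f_of_rel_a_src (j : Join r n c a b f) {A : ℕ} (hA : A ≠ a.src) :
    r A a.src ↔ r A f.snk := by
  simp [j.fork_a A, hA]

/-- If `a` is unattached then its attached predecessor precedes the fork, so that an attached set
precedes it exactly when it precedes the fork. -/
theorem rel_pred_iff (j : Join r n c a b f) (hr : StrandOrder r) (hc : Faithful r n c) {A U P : ℕ}
    (ha : c a.snk = .opened U P) (hAn : A ≤ n) (hA : c A = .attached A) :
    r A P ↔ r A f.snk := by
  have hsrc := j.inv_a.src_cell_of_snk_opened ha
  have hne : A ≠ a.src := fun h => by simp [h, hsrc] at hA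
  rw [← hc.rel_iff hAn (j.inv_a.src_le_n hr) (Cell.mem_succ_of_eq hA)
    (Cell.mem_pred_of_eq_opened hsrc) (by simp [hsrc]), j.rel_f_of_rel_a_src hne]

theorem rel_a_iff (j : Join r n c a b f) (hr : StrandOrder r) (hc : Faithful r n c)
    {u A U P : ℕ} (ha : c a.snk = .opened U P) (hu : u ≤ n) (hA : A ∈ (c u).succ) :
    r u a.snk ↔ r A f.snk := by
  obtain ⟨hAn, hcA⟩ := hc.succ_label hu hA
  rw [hc.rel_iff hu j.inv_a.snk_le hA (Cell.mem_pred_of_eq_opened ha) (by simp [ha]),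
    j.rel_pred_iff hr hc ha hAn hcA]

end Join

/-- At the join of two unattached subdags, their sets and the join strand are merged into the set
of the fork. -/
structure MergesBoth (n : ℕ) (c c' : ℕ → Cell) (a b f : Block) : Prop where
  merged : ∀ x ≤ n, c x = c a.snk ∨ c x = c b.snk → c' x = c f.snk
  other : ∀ x ≤ n, c x ≠ c a.snk → c x ≠ c b.snk → c' x = c x
  new : c' (n + 1) = c f.snk

namespace MergesBoth

theorem old_of_ne (m : MergesBoth n c c' a b f) {x : ℕ} (hx : x ≤ n + 1) (h : c' x ≠ c f.snk) :
    x ≤ n ∧ c' x = c x ∧ c x ≠ c a.snk ∧ c x ≠ c b.snk := by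
  have hxn : x ≤ n := by
    by_contra hxn
    obtain rfl : x = n + 1 := by omega
    exact h m.new
  by_cases hab : c x = c a.snk ∨ c x = c b.snk
  · exact absurd (m.merged x hxn hab) h
  · rw [not_or] at hab
    exact ⟨hxn, m.other x hxn hab.1 hab.2, hab⟩

theorem cases_of_eq (m : MergesBoth n c c' a b f) {x : ℕ} (hx : x ≤ n + 1) (h : c' x = c f.snk) :
    x = n + 1 ∨ x ≤ n ∧ (c x = c a.snk ∨ c x = c b.snk ∨ c x = c f.snk) := by
  rcases Nat.le_add_one_iff.1 hx with hxn | rfl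
  · by_cases ha : c x = c a.snk
    · exact .inr ⟨hxn, .inl ha⟩
    · by_cases hb : c x = c b.snk
      · exact .inr ⟨hxn, .inr (.inl hb)⟩
      · exact .inr ⟨hxn, .inr (.inr (m.other x hxn ha hb ▸ h))⟩
  · exact .inl rfl

theorem eq_of_old (m : MergesBoth n c c' a b f) {x : ℕ} (hx : x ≤ n) (h : c x = c f.snk) :
    c' x = c f.snk := by
  by_contra hne
  exact hne ((m.old_of_ne (Nat.le_succ_of_le hx) hne).2.1.trans h)

variable (m : MergesBoth n c c' a b f) (j : Join r n c a b f) (hr : StrandOrder r)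
include m j hr

theorem rel_of_rel_fork {s x : ℕ} (hs : r s f.snk) (hsf : ∀ y ≤ n, c y = c f.snk → r s y)
    (hx : x ≤ n + 1) (h : c' x = c f.snk) : r s x := by
  rcases m.cases_of_eq hx h with rfl | ⟨hxn, ha | hb | hf⟩
  · exact hr.trans hs (j.f_rel_new hr)
  · exact hr.trans hs (hr.trans (j.f_rel_a hr) (j.inv_a.src_le x hxn ha))
  · exact hr.trans hs (hr.trans (j.symm.f_rel_a hr) (j.inv_b.src_le x hxn hb))
  · exact hsf x hxn hf

theorem rel_new {x : ℕ} (hx : x ≤ n + 1) (h : (c' x).FeedsInto (c f.snk)) : r x (n + 1) := by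
  by_cases heq : c' x = c f.snk
  · rcases m.cases_of_eq hx heq with rfl | ⟨hxn, ha | hb | hf⟩
    · exact hr.refl _
    · exact hr.trans (j.inv_a.snk_last x hxn (.inl ha)) (j.a_rel_new hr)
    · exact hr.trans (j.inv_b.snk_last x hxn (.inl hb)) (j.symm.a_rel_new hr)
    · exact hr.trans (j.inv_f.snk_last x hxn (.inl hf)) (j.f_rel_new hr)
  · obtain ⟨hxn, hcx, -⟩ := m.old_of_ne hx heq
    exact hr.trans (j.inv_f.snk_last x hxn (hcx ▸ h)) (j.f_rel_new hr)

/-- The first strands of the joined blocks are in the merged set, so there is no way out of it. -/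
theorem not_rel_of_ne {U P V Q : ℕ} (ha : c a.snk = .opened U P) (hb : c b.snk = .opened V Q)
    {x y : ℕ} (hx : x ≤ n + 1) (hy : y ≤ n + 1) (hlive : (c' y).pred.isSome)
    (hxf : c' x = c f.snk) (hyf : c' y ≠ c f.snk) : ¬ r x y := fun hxy => by
  obtain ⟨hyn, hcy, hya, hyb⟩ := m.old_of_ne hy hyf
  rw [hcy] at hlive hyf
  have hasrc := (j.inv_a.src_cell_of_snk_opened ha).trans ha.symm
  have hbsrc := (j.inv_b.src_cell_of_snk_opened hb).trans hb.symm
  rcases m.cases_of_eq hx hxf with rfl | ⟨hxn, hxa | hxb | hxf⟩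
  · have := hr.le hxy
    omega
  · exact hya (j.cell_eq_of_rel hxn hyn hlive hxa hxy)
  · exact hyb (j.symm.cell_eq_of_rel hxn hyn hlive hxb hxy)
  · rcases j.cases_of_f_rel hxn hyn hlive hxf hxy with h | h | h
    · exact hyf h
    · exact hya (j.cell_eq_of_rel (j.inv_a.src_le_n hr) hyn hlive hasrc h)
    · exact hyb (j.symm.cell_eq_of_rel (j.inv_b.src_le_n hr) hyn hlive hbsrc h)

omit hr in
theorem exists_old {x : ℕ} (hx : x ≤ n + 1) :
    ∃ y ≤ n, c' x = c y ∧ ∀ z ≤ n, c z = c y → c' z = c y := by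
  by_cases hxf : c' x = c f.snk
  · exact ⟨f.snk, j.inv_f.snk_le, hxf, fun z hz => m.eq_of_old hz⟩
  · obtain ⟨hxn, hcx, hxa, hxb⟩ := m.old_of_ne hx hxf
    exact ⟨x, hxn, hcx, fun z hz h => by rw [m.other z hz (h ▸ hxa) (h ▸ hxb), h]⟩

omit j hr in
theorem of_attached {U P V Q : ℕ} (ha : c a.snk = .opened U P) (hb : c b.snk = .opened V Q)
    {x A : ℕ} (hx : x ≤ n) (h : c x = .attached A) : c' x = .attached A := by
  rw [m.other x hx (by simp [h, ha]) (by simp [h, hb]), h]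

theorem rel_iff_of_merged (hc : Faithful r n c) {U P V Q : ℕ} (ha : c a.snk = .opened U P)
    (hb : c b.snk = .opened V Q) {u v A B : ℕ} (hu : u ≤ n) (hv : v ≤ n + 1)
    (hA : A ∈ (c u).succ) (hvf : c' v = c f.snk) (hB : B ∈ (c f.snk).pred)
    (hne : c f.snk ≠ .attached A) : r u v ↔ r A B := by
  obtain ⟨hAn, hcA⟩ := hc.succ_label hu hA
  have hA_B : r A f.snk ↔ r A B := hc.rel_iff hAn j.inv_f.snk_le (Cell.mem_succ_of_eq hcA) hB hne
  rcases m.cases_of_eq hv hvf with rfl | ⟨hvn, hva | hvb | hvf⟩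
  · have hu_ne : u ≠ n + 1 := by omega
    simp [j.preds u, hu_ne, j.rel_a_iff hr hc ha hu hA, j.symm.rel_a_iff hr hc hb hu hA, hA_B]
  · rw [hc.rel_iff hu hvn hA (Cell.mem_pred_of_eq_opened (hva.trans ha)) (by simp [hva, ha]),
      j.rel_pred_iff hr hc ha hAn hcA, hA_B]
  · rw [hc.rel_iff hu hvn hA (Cell.mem_pred_of_eq_opened (hvb.trans hb)) (by simp [hvb, hb]),
      j.symm.rel_pred_iff hr hc hb hAn hcA, hA_B]
  · exact hc.rel_iff hu hvn hA (hvf ▸ hB) (hvf ▸ hne)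

theorem faithful (hc : Faithful r n c) {U P V Q : ℕ} (ha : c a.snk = .opened U P)
    (hb : c b.snk = .opened V Q) : Faithful r (n + 1) c' := by
  refine ⟨fun {x A} hx hA => ?_, fun {x W R} hx hW => ?_, fun {u v A B} hu hv hA hB hne => ?_⟩
  · obtain ⟨y, hy, hxy, -⟩ := m.exists_old j hx
    obtain ⟨hAn, hcA⟩ := hc.label hy (hxy ▸ hA)
    exact ⟨by omega, m.of_attached ha hb hAn hcA⟩
  · obtain ⟨y, hy, hxy, hset⟩ := m.exists_old j hx
    obtain ⟨hWn, hcW⟩ := hc.opened_label hy (hxy ▸ hW)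
    exact ⟨by omega, (hset W hWn (by rw [hcW, ← hW, hxy])).trans (hxy ▸ hW)⟩
  by_cases huf : c' u = c f.snk
  · have hfA := Cell.eq_attached_of_mem_succ j.inv_f.live (huf ▸ hA)
    have hvf : c' v ≠ c f.snk := hfA ▸ hne
    have hlive := Option.isSome_iff_exists.2 ⟨B, hB⟩
    obtain ⟨hvn, hcv, -⟩ := m.old_of_ne hv hvf
    obtain ⟨hAn, hcA⟩ := hc.succ_label j.inv_f.snk_le (Cell.mem_succ_of_eq hfA)
    have hcA' : c' A = c f.snk := m.eq_of_old hAn (hcA.trans hfA.symm)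
    rw [← hc.rel_iff hAn hvn (Cell.mem_succ_of_eq hcA) (hcv ▸ hB) (hcv ▸ hne)]
    exact iff_of_false (m.not_rel_of_ne j hr ha hb hu hv hlive huf hvf)
      (m.not_rel_of_ne j hr ha hb (by omega) hv hlive hcA' hvf)
  · obtain ⟨hun, hcu, -⟩ := m.old_of_ne hu huf
    by_cases hvf : c' v = c f.snk
    · exact m.rel_iff_of_merged j hr hc ha hb hun hv (hcu ▸ hA) hvf (hvf ▸ hB) (hvf ▸ hne)
    · obtain ⟨hvn, hcv, -⟩ := m.old_of_ne hv hvf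
      exact hc.rel_iff hun hvn (hcu ▸ hA) (hcv ▸ hB) (hcv ▸ hne)

end MergesBoth

end

section

variable {r : ℕ → ℕ → Prop} {n : ℕ} {c c' : ℕ → Cell} {a b f : Block}

theorem Block.Inv.src_cell_ne {d : Block} (hd : d.Inv r n c) {U P : ℕ}
    (hne : c d.snk ≠ .opened U P) : c d.src ≠ .opened U P := by
  obtain ⟨A, -, hA, -⟩ | ⟨V, Q, hV, hV'⟩ := hd.cells
  · simp [hA]
  · rwa [hV, ← hV']

/-- What a join step has to establish besides the representation of the order and the invariants of
the blocks. -/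
theorem Shape.ofJoin {L M : List Block} {fut : Set ℕ} (hr : StrandOrder r)
    (h : Shape r n (M ++ f :: L) fut c) (hc' : Faithful r (n + 1) c')
    (hnew : Block.Inv r (n + 1) c' ⟨f.fn, f.src, n + 1, []⟩) (hL : ∀ d ∈ L, d.Inv r (n + 1) c')
    (hsnk : ∀ d ∈ L, c' d.snk = c d.snk)
    (hfut : ∀ t ∈ fut, c' t = c t ∧ IsLast r (n + 1) c' t)
    (hopened : ∀ x ≤ n + 1, ∀ U P, c' x = .opened U P → c' x = c' (n + 1) ∨
      x ≤ n ∧ c' x = c x ∧ ∀ e ∈ M ++ [f], c x ≠ c e.snk) :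
    Shape r (n + 1) (⟨f.fn, f.src, n + 1, []⟩ :: L) fut c' := by
  obtain ⟨hbelow, hpw⟩ := List.pairwise_cons.1 (List.pairwise_append.1 h.order).2.1
  refine ⟨hc', List.forall_mem_cons.2 ⟨hnew, hL⟩, List.pairwise_cons.2
    ⟨fun d hd => (hbelow d hd).of_rel hr (hr.refl _), hpw⟩, fun x hx U P hxU => ?_, fun t ht => ?_⟩
  · obtain hx | ⟨hxn, hcx, hne⟩ := hopened x hx U P hxU
    · exact ⟨_, List.mem_cons_self, hx⟩
    · obtain ⟨e, he, hxe⟩ := h.opened_mem x hxn U P (hcx ▸ hxU)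
      have heL : e ∈ L := by
        have := hne e
        simp only [List.mem_append, List.mem_cons] at he this
        tauto
      exact ⟨e, List.mem_cons_of_mem _ heL, by rw [hcx, hxe, hsnk e heL]⟩
  · obtain ⟨htn, ⟨A, hA⟩, -, hne⟩ := h.fut t ht
    obtain ⟨hct, hlast⟩ := hfut t ht
    exact ⟨by omega, ⟨A, hct.trans hA⟩, hlast, List.forall_mem_cons.2
      ⟨(Nat.lt_succ_of_le htn).ne, fun d hd => hne d (by simp [hd])⟩⟩

namespace MergesBoth

section

variable (m : MergesBoth n c c' a b f)
include m

theorem keepsSet (j : Join r n c a b f) {t : ℕ} (ht : t ≤ n) (ha : c t ≠ c a.snk)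
    (hb : c t ≠ c b.snk) (hf : c t ≠ c f.snk) : KeepsSet n c (n + 1) c' t := by
  refine ⟨ht, fun x hx hxt => ?_⟩
  obtain hxt | ⟨hxn, hxt⟩ := hxt
  · rw [m.other t ht ha hb] at hxt
    have hxf : c' x ≠ c f.snk := fun hxf =>
      hf (Cell.eq_of_feedsInto j.inv_f.live (hxf ▸ hxt)).symm
    exact ⟨(m.old_of_ne hx hxf).1, (m.old_of_ne hx hxf).2.1⟩
  · exact ⟨hxn, m.other x hxn (hxt ▸ ha) (hxt ▸ hb)⟩

theorem isFirst (j : Join r n c a b f) (hr : StrandOrder r) {s : ℕ} (hs : s ≤ n)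
    (hfirst : IsFirst r n c s) (ha : c s ≠ c a.snk) (hb : c s ≠ c b.snk) :
    IsFirst r (n + 1) c' s := by
  intro x hx hxs
  rw [m.other s hs ha hb] at hxs
  by_cases hsf : c s = c f.snk
  · exact m.rel_of_rel_fork j hr (hfirst _ j.inv_f.snk_le hsf.symm)
      (fun y hy hyf => hfirst y hy (hyf.trans hsf.symm)) hx (hxs.trans hsf)
  · obtain ⟨hxn, hcx, -⟩ := m.old_of_ne hx (hxs ▸ hsf)
    exact hfirst x hxn (hcx ▸ hxs)

end

variable (m : MergesBoth n c c' a b f) (j : Join r n c a b f) (hr : StrandOrder r)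
  {U P V Q : ℕ} (ha : c a.snk = .opened U P) (hb : c b.snk = .opened V Q)
include m j hr ha hb

theorem block_inv_new : Block.Inv r (n + 1) c' ⟨f.fn, f.src, n + 1, []⟩ := by
  have hsrc := j.inv_f.src_le_n hr
  refine ⟨hr.trans j.inv_f.rel (j.f_rel_new hr), le_rfl, m.isFirst j hr hsrc j.inv_f.src_first
      (ha ▸ j.inv_f.src_cell_ne (ha ▸ (j.cell_a_ne_f hr).symm))
      (hb ▸ j.inv_f.src_cell_ne (hb ▸ (j.symm.cell_a_ne_f hr).symm)),
    fun x hx h => m.rel_of_rel_fork j hr j.inv_f.rel j.inv_f.src_le hx (h.trans m.new),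
    fun x hx h => m.rel_new j hr hx (m.new ▸ h), ?_, fun x hx y hy hlive hxc hxy => ?_, by simp⟩
  · obtain ⟨A, B, hA, hB⟩ | ⟨W, R, hW, hW'⟩ := j.inv_f.cells
    · exact .inl ⟨A, B, m.of_attached ha hb hsrc hA, m.new.trans hB⟩
    · exact .inr ⟨W, R, (m.eq_of_old hsrc (hW.trans hW'.symm)).trans hW', m.new.trans hW'⟩
  · by_contra hne
    exact m.not_rel_of_ne j hr ha hb hx hy hlive (hxc.trans m.new)
      (fun h => hne (.inl (h.trans m.new.symm))) hxy

theorem block_inv {d : Block} (hd : d.Inv r n c) (hda : c d.snk ≠ c a.snk)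
    (hdb : c d.snk ≠ c b.snk) (hdf : c d.snk ≠ c f.snk) : d.Inv r (n + 1) c' := by
  refine hd.mono hr n.le_succ (m.keepsSet j hd.snk_le hda hdb hdf)
    (m.isFirst j hr (hd.src_le_n hr) hd.src_first (ha ▸ hd.src_cell_ne (ha ▸ hda))
      (hb ▸ hd.src_cell_ne (hb ▸ hdb)))
    (fun A hA => m.of_attached ha hb (hd.src_le_n hr) hA) (fun y hy hlive => ?_)
    (List.Subset.refl _) hd.exits fun x hx hxd y hy hyn hxy => ?_
  · by_cases hab : c y = c a.snk ∨ c y = c b.snk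
    · obtain h | h := hab
      exacts [h ▸ j.inv_a.live, h ▸ j.inv_b.live]
    · rw [not_or] at hab
      rwa [← m.other y hy hab.1 hab.2]
  · obtain rfl : y = n + 1 := by omega
    refine hd.not_rel_of_preds hr j.preds ?_ hx hxd hxy
    simpa using ⟨⟨j.inv_a.snk_le, j.inv_a.live, hda.symm⟩, j.inv_b.snk_le, j.inv_b.live, hdb.symm⟩

end MergesBoth

theorem Shape.joinBoth {L M : List Block} {fut : Set ℕ} (hr : StrandOrder r)
    (h : Shape r n (M ++ f :: L) fut c) (hM : ∀ e, e ∈ M ↔ e = a ∨ e = b)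
    (j : Join r n c a b f) (m : MergesBoth n c c' a b f) {U P V Q : ℕ}
    (ha : c a.snk = .opened U P) (hb : c b.snk = .opened V Q) :
    Shape r (n + 1) (⟨f.fn, f.src, n + 1, []⟩ :: L) fut c' := by
  have memM := fun {e} he => List.mem_append_left (f :: L) ((hM e).2 he)
  have hL_ne : ∀ d ∈ L, c d.snk ≠ c a.snk ∧ c d.snk ≠ c b.snk ∧ c d.snk ≠ c f.snk := by
    obtain ⟨-, hpw, hcross⟩ := List.pairwise_append.1 h.order
    intro d hd
    have hdinv := h.block d (by simp [hd])
    exact ⟨(hcross a ((hM a).2 (.inl rfl)) d (by simp [hd])).cell_ne hr hdinv j.inv_a,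
      (hcross b ((hM b).2 (.inr rfl)) d (by simp [hd])).cell_ne hr hdinv j.inv_b,
      ((List.pairwise_cons.1 hpw).1 d hd).cell_ne hr hdinv j.inv_f⟩
  refine h.ofJoin hr (m.faithful j hr h.faithful ha hb) (m.block_inv_new j hr ha hb)
    (fun d hd => m.block_inv j hr ha hb (h.block d (by simp [hd])) (hL_ne d hd).1
      (hL_ne d hd).2.1 (hL_ne d hd).2.2)
    (fun d hd => m.other _ (h.block d (by simp [hd])).snk_le (hL_ne d hd).1 (hL_ne d hd).2.1)
    (fun t ht => ?_) (fun x hx W R _ => ?_)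
  · obtain ⟨htn, -, hlast, -⟩ := h.fut t ht
    have hta := h.cell_ne_of_mem_fut hr ht (memM (.inl rfl))
    have htb := h.cell_ne_of_mem_fut hr ht (memM (.inr rfl))
    have htf := h.cell_ne_of_mem_fut hr ht (e := f) (by simp)
    exact ⟨m.other t htn hta htb, hlast.of_keepsSet n.le_succ (m.keepsSet j htn hta htb htf)⟩
  · rw [m.new]
    refine or_iff_not_imp_left.2 fun hne => ?_
    obtain ⟨hxn, hcx, hxa, hxb⟩ := m.old_of_ne hx hne
    exact ⟨hxn, hcx, by simpa [hM, or_imp, forall_and] using ⟨⟨hxa, hxb⟩, hcx ▸ hne⟩⟩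

end

/-- At the join of the block `a`, whose source is in the attached set `S` and whose sink is in the
attached set `T`, with the unattached block `b`, the set of the fork is merged into `S` if it is
unattached, the join strand is added to `T`, and the set of `b` gets `T` as its attached
successor. -/
structure JoinsOne (n : ℕ) (c c' : ℕ → Cell) (a b f : Block) (S T : ℕ) : Prop where
  src : c a.src = .attached S
  snk : c a.snk = .attached T
  opened : ∃ V Q, c b.snk = .opened V Q
  closed : ∀ x ≤ n, c x = c b.snk → c' x = .closed T
  fork : ∀ x ≤ n, ∀ U P, c f.snk = .opened U P → c x = .opened U P → c' x = .attached S
  other : ∀ x ≤ n, c x ≠ c b.snk → (∀ U P, c f.snk = .opened U P → c x ≠ .opened U P) → c' x = c x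
  new : c' (n + 1) = .attached T

section

variable {r : ℕ → ℕ → Prop} {n : ℕ} {c c' : ℕ → Cell} {a b f : Block} {S T : ℕ}

namespace JoinsOne

variable (m : JoinsOne n c c' a b f S T)

section

include m

theorem cases {x : ℕ} (hx : x ≤ n) : (c x = c b.snk ∧ c' x = .closed T) ∨
    (∃ U P, c x = .opened U P ∧ c f.snk = .opened U P ∧ c' x = .attached S) ∨
    c x ≠ c b.snk ∧ (∀ U P, c f.snk = .opened U P → c x ≠ .opened U P) ∧ c' x = c x := by
  by_cases hb : c x = c b.snk
  · exact .inl ⟨hb, m.closed x hx hb⟩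
  by_cases hf : ∃ U P, c f.snk = .opened U P ∧ c x = .opened U P
  · obtain ⟨U, P, hf, hxU⟩ := hf
    exact .inr (.inl ⟨U, P, hxU, hf, m.fork x hx U P hf hxU⟩)
  · push Not at hf
    exact .inr (.inr ⟨hb, hf, m.other x hx hb hf⟩)

theorem succ_cases {x A : ℕ} (hx : x ≤ n + 1) (hA : A ∈ (c' x).succ) :
    (T = A ∧ (x = n + 1 ∨ x ≤ n ∧ c x = c b.snk)) ∨
    (S = A ∧ x ≤ n ∧ ∃ U P, c x = .opened U P ∧ c f.snk = .opened U P) ∨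
    x ≤ n ∧ A ∈ (c x).succ := by
  rcases Nat.le_add_one_iff.1 hx with hxn | rfl
  · rcases m.cases hxn with ⟨hxb, hcx⟩ | ⟨U, P, hxU, hf, hcx⟩ | ⟨-, -, hcx⟩
    · exact .inl ⟨by simpa [hcx, Cell.succ] using hA, .inr ⟨hxn, hxb⟩⟩
    · exact .inr (.inl ⟨by simpa [hcx, Cell.succ] using hA, hxn, U, P, hxU, hf⟩)
    · exact .inr (.inr ⟨hxn, hcx ▸ hA⟩)
  · exact .inl ⟨by simpa [m.new, Cell.succ] using hA, .inl rfl⟩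

theorem of_attached {x A : ℕ} (hx : x ≤ n) (h : c x = .attached A) : c' x = .attached A := by
  obtain ⟨V, Q, hb⟩ := m.opened
  rw [m.other x hx (by simp [h, hb]) (by simp [h]), h]

variable (hr : StrandOrder r) (hc : Faithful r n c) (j : Join r n c a b f)
include hr hc j

theorem rel_labels : r S T :=
  (hc.rel_iff_of_isLast hr (j.inv_a.src_le_n hr) j.inv_a.snk_le j.inv_a.snk_last
    (Cell.mem_succ_of_eq m.src) (Cell.mem_pred_of_eq m.snk)).1 j.inv_a.rel

omit hr in
/-- The block `a` can be left only through the join strand, which is added to `T`. -/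
theorem not_rel {v B : ℕ} (hv : v ≤ n) (hB : B ∈ (c v).pred) (hne : c v ≠ .attached T) :
    ¬ r T B := fun h => by
  have hTv := (hc.rel_iff j.inv_a.snk_le hv (Cell.mem_succ_of_eq m.snk) hB hne).2 h
  exact hne ((j.cell_eq_of_rel j.inv_a.snk_le hv (Option.isSome_iff_exists.2 ⟨B, hB⟩) rfl
    hTv).trans m.snk)

theorem rel_new_iff {u A : ℕ} (hu : u ≤ n) (hA : A ∈ (c u).succ) : r u (n + 1) ↔ r A T := by
  obtain ⟨V, Q, hb⟩ := m.opened
  obtain ⟨hAn, hcA⟩ := hc.succ_label hu hA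
  have hT := Cell.mem_pred_of_eq m.snk
  have hu_ne : u ≠ n + 1 := by omega
  have of_rel_fork : r A f.snk → r A T := fun h =>
    (hc.rel_iff_of_isLast hr hAn j.inv_a.snk_le j.inv_a.snk_last (Cell.mem_succ_of_eq hcA) hT).1
      (hr.trans h (hr.trans (j.f_rel_a hr) j.inv_a.rel))
  simpa [j.preds u, hu_ne, j.symm.rel_a_iff hr hc hb hu hA,
    hc.rel_iff_of_isLast hr hu j.inv_a.snk_le j.inv_a.snk_last hA hT] using of_rel_fork

theorem rel_fork_src_iff {u v A U P : ℕ} (hu : u ≤ n) (hv : v ≤ n) (hA : A ∈ (c u).succ)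
    (hf : c f.snk = .opened U P) (hvU : c v = .opened U P) (hne : S ≠ A) : r u v ↔ r A S := by
  obtain ⟨hAn, hcA⟩ := hc.succ_label hu hA
  have hA_src : A ≠ a.src := fun h => hne (by simpa [← h, hcA, eq_comm] using m.src)
  have hA' := Cell.mem_succ_of_eq hcA
  rw [hc.rel_iff hu hv hA (Cell.mem_pred_of_eq_opened hvU) (by simp [hvU]),
    ← hc.rel_iff hAn j.inv_f.snk_le hA' (Cell.mem_pred_of_eq_opened hf) (by simp [hf]),
    ← j.rel_f_of_rel_a_src hA_src, hc.rel_iff hAn (j.inv_a.src_le_n hr) hA'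
      (Cell.mem_pred_of_eq m.src) (by simpa [m.src] using hne)]

theorem rel_of_fork_iff {u v B U P : ℕ} (hu : u ≤ n) (hv : v ≤ n) (hf : c f.snk = .opened U P)
    (huU : c u = .opened U P) (hvb : c v ≠ c b.snk) (hvU : c v ≠ .opened U P)
    (hB : B ∈ (c v).pred) (hne : c v ≠ .attached S) : r u v ↔ r S B := by
  obtain ⟨V, Q, hb⟩ := m.opened
  have hlive := Option.isSome_iff_exists.2 ⟨B, hB⟩
  have hbsrc := (j.inv_b.src_cell_of_snk_opened hb).trans hb.symm
  rw [← hc.rel_iff (j.inv_a.src_le_n hr) hv (Cell.mem_succ_of_eq m.src) hB hne]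
  refine ⟨fun h => ?_, fun h => hr.trans (j.inv_f.snk_last u hu (.inl (huU.trans hf.symm)))
    (hr.trans (j.f_rel_a hr) h)⟩
  rcases j.cases_of_f_rel hu hv hlive (huU.trans hf.symm) h with h | h | h
  · exact absurd (h.trans hf) hvU
  · exact h
  · exact absurd (j.symm.cell_eq_of_rel (j.inv_b.src_le_n hr) hv hlive hbsrc h) hvb

theorem rel_iff_of_le {u v A B : ℕ} (hu : u ≤ n + 1) (hv : v ≤ n) (hA : A ∈ (c' u).succ)
    (hB : B ∈ (c' v).pred) (hne : c' v ≠ .attached A) : r u v ↔ r A B := by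
  have hsrc := j.inv_a.src_le_n hr
  rcases m.cases hv with ⟨-, hcv⟩ | ⟨U, P, hvU, hf, hcv⟩ | ⟨hvb, hvU, hcv⟩
  · simp [hcv, Cell.pred] at hB
  · obtain rfl : S = B := by simpa [hcv, Cell.pred] using hB
    have hSA : S ≠ A := by simpa [hcv] using hne
    rcases m.succ_cases hu hA with ⟨rfl, hu⟩ | ⟨rfl, -⟩ | ⟨hun, hA⟩
    · exact iff_of_false (j.symm.not_rel_of_new hr hu hv (by simp [hvU, Cell.pred])
        (by rw [hvU, ← hf]; exact (j.symm.cell_a_ne_f hr).symm))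
        (m.not_rel hc j hsrc (Cell.mem_pred_of_eq m.src) (by simpa [m.src] using hSA))
    · exact absurd rfl hSA
    · exact m.rel_fork_src_iff hr hc j hun hv hA hf hvU hSA
  · rw [hcv] at hB hne
    rcases m.succ_cases hu hA with ⟨rfl, hu⟩ | ⟨rfl, hun, U, P, huU, hf⟩ | ⟨hun, hA⟩
    · exact iff_of_false (j.symm.not_rel_of_new hr hu hv (Option.isSome_iff_exists.2 ⟨B, hB⟩) hvb)
        (m.not_rel hc j hv hB hne)
    · exact m.rel_of_fork_iff hr hc j hun hv hf huU hvb (hvU U P hf) hB hne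
    · exact hc.rel_iff hun hv hA hB hne

theorem faithful : Faithful r (n + 1) c' := by
  obtain ⟨hTn, hT⟩ := hc.succ_label j.inv_a.snk_le (Cell.mem_succ_of_eq m.snk)
  obtain ⟨hSn, hS⟩ := hc.succ_label (j.inv_a.src_le_n hr) (Cell.mem_succ_of_eq m.src)
  refine ⟨fun {x A} hx hA => ?_, fun {x W R} hx hW => ?_, fun {u v A B} hu hv hA hB hne => ?_⟩
  · suffices A ≤ n ∧ c A = .attached A from
      ⟨Nat.le_succ_of_le this.1, m.of_attached this.1 this.2⟩
    rcases Nat.le_add_one_iff.1 hx with hxn | rfl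
    · rcases m.cases hxn with ⟨-, hcx⟩ | ⟨U, P, -, -, hcx⟩ | ⟨-, -, hcx⟩
      · obtain rfl : T = A := by simpa [hcx, Cell.succ, Cell.pred] using hA
        exact ⟨hTn, hT⟩
      · obtain rfl : S = A := by simpa [hcx, Cell.succ, Cell.pred] using hA
        exact ⟨hSn, hS⟩
      · exact hc.label hxn (hcx ▸ hA)
    · obtain rfl : T = A := by simpa [m.new, Cell.succ, Cell.pred] using hA
      exact ⟨hTn, hT⟩
  · rcases Nat.le_add_one_iff.1 hx with hxn | rfl
    · rcases m.cases hxn with ⟨-, hcx⟩ | ⟨U, P, -, -, hcx⟩ | ⟨hxb, hxf, hcx⟩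
      · simp [hcx] at hW
      · simp [hcx] at hW
      · rw [hcx] at hW
        obtain ⟨hWn, hcW⟩ := hc.opened_label hxn hW
        have hWx : c W = c x := hcW.trans hW.symm
        exact ⟨by omega, (m.other W hWn (hWx ▸ hxb) (hWx ▸ hxf)).trans hcW⟩
    · simp [m.new] at hW
  · rcases Nat.le_add_one_iff.1 hv with hvn | rfl
    · exact m.rel_iff_of_le hr hc j hu hvn hA hB hne
    · obtain rfl : T = B := by simpa [m.new, Cell.pred] using hB
      rcases m.succ_cases hu hA with ⟨rfl, -⟩ | ⟨rfl, hun, U, P, huU, hf⟩ | ⟨hun, hA⟩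
      · exact absurd m.new hne
      · exact iff_of_true (hr.trans (j.inv_f.snk_last u hun (.inl (huU.trans hf.symm)))
          (j.f_rel_new hr)) (m.rel_labels hr hc j)
      · exact m.rel_new_iff hr hc j hun hA

end

end JoinsOne

end

section

variable {r : ℕ → ℕ → Prop} {n : ℕ} {c c' : ℕ → Cell} {a b f : Block} {S T : ℕ}

namespace JoinsOne

section

variable (m : JoinsOne n c c' a b f S T)
include m

theorem other_of_ne {t : ℕ} (ht : t ≤ n) (hb : c t ≠ c b.snk) (hf : c t ≠ c f.snk) :
    c' t = c t :=
  m.other t ht hb fun _ _ hU h => hf (h.trans hU.symm)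

theorem keepsSet {t : ℕ} (ht : t ≤ n) (hlive : (c t).pred.isSome) (ha : c t ≠ c a.snk)
    (hb : c t ≠ c b.snk) (hf : c t ≠ c f.snk) (hS : c t ≠ .attached S) :
    KeepsSet n c (n + 1) c' t := by
  refine ⟨ht, fun x hx hxt => ?_⟩
  obtain hxt | ⟨hxn, hxt⟩ := hxt
  · have hne_T : c t ≠ .attached T := m.snk ▸ ha
    rw [m.other_of_ne ht hb hf] at hxt
    rcases Nat.le_add_one_iff.1 hx with hxn | rfl
    · rcases m.cases hxn with ⟨-, hcx⟩ | ⟨U, P, -, -, hcx⟩ | ⟨-, -, hcx⟩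
      · obtain h | ⟨A, hA, hAt⟩ := hcx ▸ hxt
        · simp [← h, Cell.pred] at hlive
        · obtain rfl : T = A := by simpa using hA
          exact absurd hAt hne_T
      · exact absurd (Cell.eq_of_feedsInto (by simp [Cell.pred]) (hcx ▸ hxt)).symm hS
      · exact ⟨hxn, hcx⟩
    · exact absurd (Cell.eq_of_feedsInto (by simp [Cell.pred]) (m.new ▸ hxt)).symm hne_T
  · exact ⟨hxn, m.other_of_ne hxn (hxt ▸ hb) (hxt ▸ hf)⟩

theorem isFirst (hr : StrandOrder r) (j : Join r n c a b f) {s : ℕ} (hs : s ≤ n)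
    (hfirst : IsFirst r n c s) (hlive : (c s).pred.isSome) (hb : c s ≠ c b.snk)
    (hf : ∀ U P, c f.snk = .opened U P → c s ≠ .opened U P)
    (hS : (∃ U P, c f.snk = .opened U P) → c s ≠ .attached S) : IsFirst r (n + 1) c' s := by
  intro x hx hxs
  rw [m.other s hs hb hf] at hxs
  rcases Nat.le_add_one_iff.1 hx with hxn | rfl
  · rcases m.cases hxn with ⟨-, hcx⟩ | ⟨U, P, -, hU, hcx⟩ | ⟨-, -, hcx⟩
    · simp [← hxs, hcx, Cell.pred] at hlive
    · exact absurd (hxs.symm.trans hcx) (hS ⟨U, P, hU⟩)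
    · exact hfirst x hxn (hcx.symm.trans hxs)
  · exact hr.trans (hfirst _ j.inv_a.snk_le (by rw [m.snk, ← hxs, m.new])) (j.a_rel_new hr)

variable (hr : StrandOrder r) (j : Join r n c a b f)
include hr j

theorem rel_f_src {x : ℕ} (hx : x ≤ n + 1)
    (h : c' x = .attached T ∨ c' x = .attached S ∧ ∃ U P, c f.snk = .opened U P) :
    r f.src x := by
  have hf_a := hr.trans j.inv_f.rel (j.f_rel_a hr)
  rcases Nat.le_add_one_iff.1 hx with hxn | rfl
  · rcases m.cases hxn with ⟨-, hcx⟩ | ⟨U, P, hxU, hf, -⟩ | ⟨-, -, hcx⟩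
    · simp [hcx] at h
    · exact j.inv_f.src_le x hxn (hxU.trans hf.symm)
    · rw [hcx] at h
      obtain h | ⟨h, -⟩ := h
      · exact hr.trans hf_a (j.inv_a.src_le x hxn (h.trans m.snk.symm))
      · exact hr.trans hf_a (j.inv_a.src_first x hxn (h.trans m.src.symm))
  · exact hr.trans j.inv_f.rel (j.f_rel_new hr)

theorem rel_new {x : ℕ} (hx : x ≤ n + 1) (h : T ∈ (c' x).succ) : r x (n + 1) := by
  rcases m.succ_cases hx h with ⟨-, rfl | ⟨hxn, hxb⟩⟩ | ⟨-, hxn, U, P, hxU, hf⟩ | ⟨hxn, hxT⟩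
  · exact hr.refl _
  · exact hr.trans (j.inv_b.snk_last x hxn (.inl hxb)) (j.symm.a_rel_new hr)
  · exact hr.trans (j.inv_f.snk_last x hxn (.inl (hxU.trans hf.symm))) (j.f_rel_new hr)
  · exact hr.trans (j.inv_a.snk_last x hxn (m.snk ▸ Cell.feedsInto_attached_iff.2 hxT))
      (j.a_rel_new hr)

theorem f_src : (∃ A, c' f.src = .attached A) ∧ IsFirst r (n + 1) c' f.src := by
  obtain ⟨V, Q, hb⟩ := m.opened
  have hsrc := j.inv_f.src_le_n hr
  obtain ⟨A, B, hA, hB⟩ | ⟨U, P, hU, hU'⟩ := j.inv_f.cells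
  · exact ⟨⟨A, m.of_attached hsrc hA⟩, m.isFirst hr j hsrc j.inv_f.src_first
      (by simp [hA, Cell.pred]) (by simp [hA, hb]) (by simp [hB]) (by simp [hB])⟩
  · have hS := m.fork _ hsrc U P hU' hU
    exact ⟨⟨S, hS⟩, fun x hx hxs => m.rel_f_src hr j hx (.inr ⟨hxs.trans hS, U, P, hU'⟩)⟩

theorem block_inv_new (hc : Faithful r n c) :
    Block.Inv r (n + 1) c' ⟨f.fn, f.src, n + 1, []⟩ := by
  obtain ⟨⟨A, hA⟩, hfirst⟩ := m.f_src hr j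
  refine ⟨hr.trans j.inv_f.rel (j.f_rel_new hr), le_rfl, hfirst,
    fun x hx h => m.rel_f_src hr j hx (.inl (h.trans m.new)),
    fun x hx h => m.rel_new hr j hx (Cell.feedsInto_attached_iff.1 (m.new ▸ h)),
    .inl ⟨A, T, hA, m.new⟩, fun x hx y hy hlive hxc hxy => .inl ?_, by simp⟩
  change c' x = c' (n + 1) at hxc
  change c' y = c' (n + 1)
  rw [m.new] at hxc ⊢
  by_contra hne
  obtain ⟨B, hB⟩ := Option.isSome_iff_exists.1 hlive
  have hc' := m.faithful hr hc j
  have hy' : y ≠ n + 1 := fun h => hne (h ▸ m.new)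
  have := hr.le ((hc'.rel_iff le_rfl hy (Cell.mem_succ_of_eq m.new) hB hne).2
    ((hc'.rel_iff hx hy (Cell.mem_succ_of_eq hxc) hB hne).1 hxy))
  omega

omit m in
theorem cell_ne_of_lt {x A : ℕ} (hx : x ≤ n) (hlt : x < a.src) (hA : c a.src = .attached A) :
    c x ≠ .attached A := fun h =>
  hlt.not_ge (hr.le (j.inv_a.src_first x hx (h.trans hA.symm)))

theorem block_inv {d : Block} (hd : d.Inv r n c) (hda : c d.snk ≠ c a.snk)
    (hdb : c d.snk ≠ c b.snk) (hdf : c d.snk ≠ c f.snk) (hlt : d.snk < a.src) :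
    d.Inv r (n + 1) c' := by
  obtain ⟨V, Q, hb⟩ := m.opened
  have hsrc := hd.src_le_n hr
  have hsrc_S := cell_ne_of_lt hr j hsrc ((hr.le hd.rel).trans_lt hlt) m.src
  have hsrc_live : (c d.src).pred.isSome := by
    obtain ⟨A, -, hA, -⟩ | ⟨U, P, hU, -⟩ := hd.cells
    exacts [by simp [hA, Cell.pred], by simp [hU, Cell.pred]]
  refine hd.mono hr n.le_succ
    (m.keepsSet hd.snk_le hd.live hda hdb hdf (cell_ne_of_lt hr j hd.snk_le hlt m.src))
    (m.isFirst hr j hsrc hd.src_first hsrc_live (hb ▸ hd.src_cell_ne (hb ▸ hdb))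
      (fun U P hU => hd.src_cell_ne (hU ▸ hdf)) fun _ => hsrc_S)
    (fun A hA => m.of_attached hsrc hA) (fun y hy hlive => ?_)
    (List.Subset.refl _) hd.exits fun x hx hxd y hy hyn hxy => ?_
  · rcases m.cases hy with ⟨-, hcy⟩ | ⟨U, P, hyU, -, -⟩ | ⟨-, -, hcy⟩
    · simp [hcy, Cell.pred] at hlive
    · simp [hyU, Cell.pred]
    · rwa [← hcy]
  · obtain rfl : y = n + 1 := by omega
    refine hd.not_rel_of_preds hr j.preds ?_ hx hxd hxy
    simpa using ⟨⟨j.inv_a.snk_le, j.inv_a.live, hda.symm⟩, j.inv_b.snk_le, j.inv_b.live, hdb.symm⟩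

theorem isLast {t A : ℕ} (ht : t ≤ n) (hA : c t = .attached A) (hlast : IsLast r n c t)
    (hta : c t ≠ c a.snk) (hct : c' t = c t) : IsLast r (n + 1) c' t := by
  intro x hx h
  rw [hct, hA, Cell.feedsInto_attached_iff] at h
  rcases m.succ_cases hx h with ⟨rfl, -⟩ | ⟨rfl, hxn, U, P, hxU, hf⟩ | ⟨hxn, hxA⟩
  · exact absurd (hA.trans m.snk.symm) hta
  · exact hr.trans (j.inv_f.snk_last x hxn (.inl (hxU.trans hf.symm)))
      (hr.trans (j.f_rel_a hr) (j.inv_a.src_first t ht (hA.trans m.src.symm)))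
  · exact hlast x hxn (hA ▸ Cell.feedsInto_attached_iff.2 hxA)

end

end JoinsOne

theorem Shape.joinOne {L M : List Block} {fut : Set ℕ} (hr : StrandOrder r)
    (h : Shape r n (M ++ f :: L) fut c) (hM : ∀ e, e ∈ M ↔ e = a ∨ e = b)
    (j : Join r n c a b f) (m : JoinsOne n c c' a b f S T) :
    Shape r (n + 1) (⟨f.fn, f.src, n + 1, []⟩ :: L) fut c' := by
  obtain ⟨-, hpw, hcross⟩ := List.pairwise_append.1 h.order
  have hbelow := (List.pairwise_cons.1 hpw).1
  have memM := fun {e} he => List.mem_append_left (f :: L) ((hM e).2 he)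
  have hL : ∀ d ∈ L, d.Inv r n c := fun d hd => h.block d (by simp [hd])
  have hLb : ∀ d ∈ L, c d.snk ≠ c b.snk := fun d hd =>
    (hcross b ((hM b).2 (.inr rfl)) d (by simp [hd])).cell_ne hr (hL d hd) j.inv_b
  have hLf : ∀ d ∈ L, c d.snk ≠ c f.snk := fun d hd =>
    (hbelow d hd).cell_ne hr (hL d hd) j.inv_f
  refine h.ofJoin hr (m.faithful hr h.faithful j) (m.block_inv_new hr j h.faithful)
    (fun d hd => m.block_inv hr j (hL d hd)
      ((hcross a ((hM a).2 (.inl rfl)) d (by simp [hd])).cell_ne hr (hL d hd) j.inv_a)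
      (hLb d hd) (hLf d hd) (((hbelow d hd).snk_lt_snk hr j.inv_f).trans j.lt_a))
    (fun d hd => m.other_of_ne (hL d hd).snk_le (hLb d hd) (hLf d hd))
    (fun t ht => ?_) (fun x hx W R hxW => ?_)
  · obtain ⟨htn, ⟨A, hA⟩, hlast, -⟩ := h.fut t ht
    have hct := m.other_of_ne htn (h.cell_ne_of_mem_fut hr ht (memM (.inr rfl)))
      (h.cell_ne_of_mem_fut hr ht (e := f) (by simp))
    exact ⟨hct, m.isLast hr j htn hA hlast (h.cell_ne_of_mem_fut hr ht (memM (.inl rfl))) hct⟩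
  · rcases Nat.le_add_one_iff.1 hx with hxn | rfl
    · rcases m.cases hxn with ⟨-, hcx⟩ | ⟨U, P, -, -, hcx⟩ | ⟨hxb, hxf, hcx⟩
      · simp [hcx] at hxW
      · simp [hcx] at hxW
      · rw [hcx] at hxW
        refine .inr ⟨hxn, hcx, ?_⟩
        simpa [hM, or_imp, forall_and] using ⟨⟨by simp [hxW, m.snk], hxb⟩,
          fun h => hxf W R (h.symm.trans hxW) hxW⟩
    · simp [m.new] at hxW

end

/-! ## The sets of `D_NSP` and the dag `R` -/

namespace DNSP

section

variable (D : DNSP)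

/-- The cell that encodes the set with label `A`. -/
def setCell (A : ℕ) : Cell :=
  if D.attached A then .attached A
  else match D.attSucc A with
    | some B => .closed B
    | none => .opened A (D.attPred A)

/-- The cell of the set that holds the strand `x`. -/
def cell (x : ℕ) : Cell :=
  D.setCell (D.find x)

/-- Add to `R` the arcs between the sets of the given pairs of strands. -/
def arcs (l : List (ℕ × ℕ)) : DNSP :=
  l.foldl (fun D e => D.arc e.1 e.2) D

end

variable {D : DNSP} {u v x A U P : ℕ}

theorem succOf_eq : D.succOf u = (D.cell u).succ := by
  unfold succOf isAttached cell setCell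
  cases D.attached (D.find u) <;> cases D.attSucc (D.find u) <;> rfl

theorem predOf_eq (h : A ∈ (D.cell v).pred) : D.predOf v = A := by
  unfold cell setCell at h
  unfold predOf isAttached
  cases hv : D.attached (D.find v) <;> cases hs : D.attSucc (D.find v) <;>
    simp_all [Cell.pred]

theorem cell_eq_attached_iff :
    D.cell x = .attached A ↔ D.attached (D.find x) = true ∧ D.find x = A := by
  unfold cell setCell
  cases D.attached (D.find x) <;> cases D.attSucc (D.find x) <;> simp

theorem isAttached_iff : D.isAttached u = true ↔ ∃ A, D.cell u = .attached A := by
  simp [isAttached, cell_eq_attached_iff]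

theorem isAttached_of_attached (h : D.cell u = .attached A) : D.isAttached u = true :=
  isAttached_iff.2 ⟨A, h⟩

theorem isAttached_of_opened (h : D.cell u = .opened U P) : D.isAttached u = false :=
  Bool.eq_false_iff.2 fun hu => by simp [isAttached_iff, h] at hu

theorem cell_eq_opened_iff : D.cell x = .opened U P ↔ D.attached (D.find x) = false ∧
    D.attSucc (D.find x) = none ∧ D.find x = U ∧ D.attPred (D.find x) = P := by
  unfold cell setCell
  cases D.attached (D.find x) <;> cases D.attSucc (D.find x) <;> simp

theorem find_eq_iff (h : (D.cell v).pred.isSome) : D.find x = D.find v ↔ D.cell x = D.cell v := by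
  refine ⟨fun hx => congrArg D.setCell hx, fun hx => ?_⟩
  rcases hv : D.cell v with A | ⟨U, P⟩ | A
  · rw [(cell_eq_attached_iff.1 (hx.trans hv)).2, (cell_eq_attached_iff.1 hv).2]
  · rw [(cell_eq_opened_iff.1 (hx.trans hv)).2.2.1, (cell_eq_opened_iff.1 hv).2.2.1]
  · simp [hv, Cell.pred] at h

theorem find_eq_iff_of_opened (h : D.cell v = .opened U P) :
    D.find x = D.find v ↔ D.cell x = .opened U P :=
  h ▸ find_eq_iff (by simp [h, Cell.pred])

section arcs

variable {X Y a b : ℕ} {l : List (ℕ × ℕ)}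

theorem mem_arcSets {B : ℕ} : (X, Y) ∈ (D.arcSets A B).R ↔
    (X, Y) ∈ D.R ∨ (X = A ∨ (X, A) ∈ D.R) ∧ (Y = B ∨ (B, Y) ∈ D.R) := by
  simp [arcSets]

theorem R_subset_arcs : D.R ⊆ (D.arcs l).R := by
  induction l generalizing D with
  | nil => exact subset_rfl
  | cons e l ih => exact Finset.subset_union_left.trans (ih (D := D.arc e.1 e.2))

theorem find_arcs : (D.arcs l).find = D.find := by
  induction l generalizing D with
  | nil => rfl
  | cons _ _ ih => exact ih

theorem cell_arcs : (D.arcs l).cell = D.cell := by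
  induction l generalizing D with
  | nil => rfl
  | cons _ _ ih => exact ih

theorem mem_arcs (h : (a, b) ∈ l) (hX : X = D.find a ∨ (X, D.find a) ∈ D.R)
    (hY : Y = D.find b ∨ (D.find b, Y) ∈ D.R) : (X, Y) ∈ (D.arcs l).R := by
  induction l generalizing D with
  | nil => simp at h
  | cons e l ih =>
    have hsub : D.R ⊆ (D.arc e.1 e.2).R := Finset.subset_union_left
    obtain rfl | h := List.mem_cons.1 h
    · exact R_subset_arcs (D := D.arc a b) (mem_arcSets.2 (.inr ⟨hX, hY⟩))
    · exact ih h (hX.imp_right (@hsub _)) (hY.imp_right (@hsub _))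

end arcs

/-- The arcs of `R` go along the order `r`, between labels up to `n`. -/
def ArcsSound (r : ℕ → ℕ → Prop) (n : ℕ) (D : DNSP) : Prop :=
  ∀ A B, (A, B) ∈ D.R → r A B ∧ B ≤ n

theorem ArcsSound.arcSets {r : ℕ → ℕ → Prop} {n B : ℕ} (hr : StrandOrder r) (h : ArcsSound r n D)
    (hAB : r A B) (hB : B ≤ n) : ArcsSound r n (D.arcSets A B) := fun X Y hXY => by
  obtain hXY | ⟨hX, hY⟩ := mem_arcSets.1 hXY
  · exact h X Y hXY
  · have hXA : r X A := hX.elim (fun e => e ▸ hr.refl A) fun e => (h X A e).1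
    have hBY : r B Y ∧ Y ≤ n := hY.elim (fun e => ⟨e ▸ hr.refl B, e ▸ hB⟩) (h B Y)
    exact ⟨hr.trans hXA (hr.trans hAB hBY.1), hBY.2⟩

theorem ArcsSound.arcs {r : ℕ → ℕ → Prop} {n : ℕ} (hr : StrandOrder r) (h : ArcsSound r n D)
    {l : List (ℕ × ℕ)} (hl : ∀ e ∈ l, r (D.find e.1) (D.find e.2) ∧ D.find e.2 ≤ n) :
    ArcsSound r n (D.arcs l) := by
  induction l generalizing D with
  | nil => exact h
  | cons e l ih =>
    obtain ⟨he, hn⟩ := hl e List.mem_cons_self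
    exact ih (h.arcSets hr he hn) fun e' he' => hl e' (List.mem_cons_of_mem e he')

/-- The labels of the sets and the dag `R` for the strands up to `n`: between attached sets, `R` is
the order `r` of their labels. -/
structure Represents (r : ℕ → ℕ → Prop) (n : ℕ) (D : DNSP) : Prop where
  find_le : ∀ x ≤ n, D.find x ≤ n
  sound : ArcsSound r n D
  complete : ∀ {A B}, A ≤ n → B ≤ n → D.cell A = .attached A → D.cell B = .attached B → r A B →
    A = B ∨ (A, B) ∈ D.R

theorem Represents.rel_iff {r : ℕ → ℕ → Prop} {n B : ℕ} (hr : StrandOrder r)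
    (h : D.Represents r n) (hA : A ≤ n ∧ D.cell A = .attached A)
    (hB : B ≤ n ∧ D.cell B = .attached B) : r A B ↔ A = B ∨ (A, B) ∈ D.R := by
  refine ⟨h.complete hA.1 hB.1 hA.2 hB.2, ?_⟩
  rintro (rfl | hAB)
  exacts [hr.refl A, (h.sound A B hAB).1]

end DNSP

namespace DNSP

variable {r : ℕ → ℕ → Prop} {n x U P : ℕ} {D D' : DNSP}

theorem cell_makeAttached_of_le (hle : ∀ x ≤ n, D.find x ≤ n) (hx : x ≤ n) :
    (D.makeAttached (n + 1)).cell x = D.cell x := by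
  have := hle x hx
  simp [makeAttached, cell, setCell, show x ≠ n + 1 by omega, show D.find x ≠ n + 1 by omega]

theorem cell_makeAttached_self : (D.makeAttached x).cell x = .attached x := by
  simp [makeAttached, cell, setCell]

theorem cell_makeUnattached_of_le (hle : ∀ x ≤ n, D.find x ≤ n) (hx : x ≤ n) :
    (D.makeUnattached (n + 1) P).cell x = D.cell x := by
  have := hle x hx
  simp [makeUnattached, cell, setCell, show x ≠ n + 1 by omega, show D.find x ≠ n + 1 by omega]

theorem cell_makeUnattached_self : (D.makeUnattached x P).cell x = .opened x P := by
  simp [makeUnattached, cell, setCell]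

theorem find_label (hc : Faithful r n D.cell) (hx : x ≤ n) (h : ∃ A, D.cell x = .attached A) :
    D.find x ≤ n ∧ D.cell (D.find x) = .attached (D.find x) := by
  obtain ⟨A, hA⟩ := h
  obtain rfl := (cell_eq_attached_iff.1 hA).2
  exact hc.succ_label hx (Cell.mem_succ_of_eq hA)

theorem rel_find_iff (hr : StrandOrder r) (hc : Faithful r n D.cell) {p A : ℕ} (hp : p ≤ n)
    (hlast : IsLast r n D.cell p) (h : ∃ B, D.cell p = .attached B) (hA : A ≤ n)
    (hcA : D.cell A = .attached A) : r A p ↔ r A (D.find p) := by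
  obtain ⟨B, hB⟩ := h
  obtain rfl := (cell_eq_attached_iff.1 hB).2
  exact hc.rel_iff_of_isLast hr hA hp hlast (Cell.mem_succ_of_eq hcA) (Cell.mem_pred_of_eq hB)

namespace Represents

theorem find_le_update (h : D.Represents r n) (D' : DNSP) {A : ℕ} (hA : A ≤ n + 1)
    (hD' : ∀ x, D'.find x = Function.update D.find (n + 1) A x) :
    ∀ x ≤ n + 1, D'.find x ≤ n + 1 := by
  intro x hx
  rw [hD']
  obtain hxn | rfl := Nat.le_add_one_iff.1 hx
  · rw [Function.update_of_ne (by omega)]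
    exact (h.find_le x hxn).trans (Nat.le_succ n)
  · rwa [Function.update_self]

theorem of_R_eq (hc : Faithful r n D.cell) (h : D.Represents r n)
    (hle : ∀ x ≤ n + 1, D'.find x ≤ n + 1) (hR : D'.R = D.R)
    (hlabel : ∀ x ≤ n + 1, ∀ A, D'.cell x = .attached A → ∃ y ≤ n, A ∈ (D.cell y).succ) :
    D'.Represents r (n + 1) where
  find_le := hle
  sound A B hAB := (h.sound A B (hR ▸ hAB)).imp_right fun hB => hB.trans (Nat.le_succ n)
  complete {A B} hA hB hcA hcB hAB := by
    obtain ⟨x, hx, hxA⟩ := hlabel A hA A hcA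
    obtain ⟨y, hy, hyB⟩ := hlabel B hB B hcB
    obtain ⟨hAn, hA'⟩ := hc.succ_label hx hxA
    obtain ⟨hBn, hB'⟩ := hc.succ_label hy hyB
    rw [hR]
    exact h.complete hAn hBn hA' hB' hAB

theorem makeUnattached (hc : Faithful r n D.cell) (h : D.Represents r n) :
    (D.makeUnattached (n + 1) P).Represents r (n + 1) := by
  refine h.of_R_eq hc (h.find_le_update _ le_rfl fun _ => rfl) rfl fun x hx A hA => ?_
  obtain hxn | rfl := Nat.le_add_one_iff.1 hx
  · rw [cell_makeUnattached_of_le h.find_le hxn] at hA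
    exact ⟨x, hxn, Cell.mem_succ_of_eq hA⟩
  · simp [cell_makeUnattached_self] at hA

theorem makeAttached (hr : StrandOrder r) (hc : Faithful r n D.cell) (h : D.Represents r n)
    {ps : List ℕ} (hps : ImmediatePreds r (n + 1) ps)
    (hlast : ∀ p ∈ ps, p ≤ n ∧ IsLast r n D.cell p ∧ ∃ A, D.cell p = .attached A) :
    ((D.makeAttached (n + 1)).arcs (ps.map fun p => (p, n + 1))).Represents r (n + 1) := by
  have hfind : ∀ p ≤ n, (D.makeAttached (n + 1)).find p = D.find p := fun p hp => by
    simp [DNSP.makeAttached, show p ≠ n + 1 by omega]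
  have hself : (D.makeAttached (n + 1)).find (n + 1) = n + 1 := by simp [DNSP.makeAttached]
  have hsound : (D.makeAttached (n + 1)).ArcsSound r (n + 1) := fun A B hAB =>
    (h.sound A B hAB).imp_right fun hB => hB.trans (Nat.le_succ n)
  refine ⟨?_, hsound.arcs hr fun e he => ?_, fun {A B} hA hB hcA hcB hAB => ?_⟩
  · rw [find_arcs]
    exact h.find_le_update _ le_rfl fun _ => rfl
  · obtain ⟨p, hp, rfl⟩ := List.mem_map.1 he
    obtain ⟨hpn, hlastp, hcp⟩ := hlast p hp
    obtain ⟨hle, hcell⟩ := find_label hc hpn hcp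
    have hrel : r (D.find p) p := (rel_find_iff hr hc hpn hlastp hcp hle hcell).2 (hr.refl _)
    rw [hfind p hpn, hself]
    exact ⟨hr.trans hrel (hps.rel hr hp), le_rfl⟩
  · rw [cell_arcs] at hcA hcB
    obtain hBn | rfl := Nat.le_add_one_iff.1 hB
    · have hAn : A ≤ n := (hr.le hAB).trans hBn
      rw [cell_makeAttached_of_le h.find_le hAn] at hcA
      rw [cell_makeAttached_of_le h.find_le hBn] at hcB
      exact (h.complete hAn hBn hcA hcB hAB).imp_right (@R_subset_arcs _ _ _)
    · obtain rfl | ⟨p, hp, hAp⟩ := (hps A).1 hAB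
      · exact .inl rfl
      obtain ⟨hpn, hlastp, hcp⟩ := hlast p hp
      have hAn : A ≤ n := (hr.le hAp).trans hpn
      rw [cell_makeAttached_of_le h.find_le hAn] at hcA
      obtain ⟨hle, hcell⟩ := find_label hc hpn hcp
      have hAR := h.complete hAn hle hcA hcell ((rel_find_iff hr hc hpn hlastp hcp hAn hcA).1 hAp)
      rw [← hfind p hpn] at hAR
      exact .inr (mem_arcs (List.mem_map_of_mem hp) hAR (.inl hself.symm))

end Represents

theorem addsStrand_makeUnattached (hr : StrandOrder r) (hc : Faithful r n D.cell)
    (h : D.Represents r n) {p : ℕ} (hps : ImmediatePreds r (n + 1) [p]) (hp : p ≤ n)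
    (hlast : IsLast r n D.cell p) (hlive : (D.cell p).pred.isSome) :
    AddsStrand r n D.cell (D.makeUnattached (n + 1) (D.predOf p)).cell := by
  obtain ⟨P, hP⟩ := Option.isSome_iff_exists.1 hlive
  rw [predOf_eq hP]
  exact .of_opened hr hc hps hp hlast hP (fun x => cell_makeUnattached_of_le h.find_le)
    cell_makeUnattached_self

theorem addsStrand_makeAttached (hr : StrandOrder r) (hc : Faithful r n D.cell)
    (h : D.Represents r n) {ps : List ℕ} (hps : ImmediatePreds r (n + 1) ps)
    (hlast : ∀ p ∈ ps, p ≤ n ∧ IsLast r n D.cell p ∧ ∃ A, D.cell p = .attached A)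
    (l : List (ℕ × ℕ)) : AddsStrand r n D.cell ((D.makeAttached (n + 1)).arcs l).cell := by
  rw [cell_arcs]
  refine .of_attached hr hc hps (fun p hp => ?_) (fun x => cell_makeAttached_of_le h.find_le)
    cell_makeAttached_self
  obtain ⟨hpn, hlast, A, hA⟩ := hlast p hp
  exact ⟨hpn, hlast, by simp [hA, Cell.pred]⟩

end DNSP

theorem Faithful.rel_labels {r : ℕ → ℕ → Prop} {n a b A B : ℕ} {c : ℕ → Cell}
    (hr : StrandOrder r) (hc : Faithful r n c) (ha : a ≤ n) (hb : b ≤ n) (hA : c a = .attached A)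
    (hB : c b = .attached B) (hab : r a b) : r A B := by
  by_cases h : c b = .attached A
  · rw [h] at hB
    cases hB
    exact hr.refl A
  · exact (hc.rel_iff ha hb (Cell.mem_succ_of_eq hA) (Cell.mem_pred_of_eq hB) h).1 hab

section

variable {r : ℕ → ℕ → Prop} {n : ℕ} {e : Block} {D : DNSP}

namespace DNSP

variable {u x U P : ℕ}

theorem find_attachify : (D.attachify u).find = D.find := by
  unfold attachify
  split_ifs <;> rfl

theorem R_subset_attachify : D.R ⊆ (D.attachify u).R := by
  unfold attachify
  split_ifs
  · exact subset_rfl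
  · exact Finset.subset_union_left

theorem attachify_of_attached (h : ∃ A, D.cell u = .attached A) : D.attachify u = D :=
  if_pos (isAttached_iff.2 h)

theorem attachify_of_opened (h : D.cell u = .opened U P) : D.attachify u =
    { D with attached := Function.update D.attached U true }.arcSets P U := by
  obtain ⟨hatt, -, rfl, rfl⟩ := cell_eq_opened_iff.1 h
  simp [attachify, isAttached, hatt]

theorem attachesSet_attachify (h : D.cell u = .opened U P) :
    AttachesSet n D.cell (D.attachify u).cell U P := by
  have hfind : ∀ x, D.find x = U ↔ D.cell x = .opened U P := fun x => by
    rw [← find_eq_iff_of_opened h, (cell_eq_opened_iff.1 h).2.2.1]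
  constructor <;> intro x _ hx
  · rw [cell_eq_attached_iff, find_attachify, attachify_of_opened h]
    simp [arcSets, (hfind x).2 hx]
  · rw [cell, find_attachify, attachify_of_opened h]
    simp [cell, setCell, arcSets, mt (hfind x).1 hx]

namespace Represents

theorem arcsSound_attachify (hr : StrandOrder r) (hc : Faithful r n D.cell)
    (h : D.Represents r n) (he : e.Inv r n D.cell) (hcell : D.cell e.snk = .opened U P)
    (hexits : ∀ s ∈ e.exits, s ≤ n ∧ ∃ S, D.cell s = .attached S)
    (hc' : Faithful r n (D.attachify e.snk).cell) :
    ((D.attachify e.snk).arcs (e.exits.map fun s => (e.snk, s))).ArcsSound r n := by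
  have ha := attachesSet_attachify (n := n) hcell
  obtain ⟨hU, hcU⟩ := hc.opened_label he.snk_le hcell
  obtain ⟨hP, hcP⟩ := hc.pred_label he.snk_le (Cell.mem_pred_of_eq_opened hcell)
  have hPU : r P U := (hc.rel_iff hP hU (Cell.mem_succ_of_eq hcP) (Cell.mem_pred_of_eq_opened hcU)
    (by simp [hcU])).2 (hr.refl P)
  have hsound : (D.attachify e.snk).ArcsSound r n := by
    rw [attachify_of_opened hcell]
    exact ArcsSound.arcSets hr h.sound hPU hU
  refine hsound.arcs hr fun p hp => ?_
  obtain ⟨s, hs, rfl⟩ := List.mem_map.1 hp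
  obtain ⟨hsn, S, hS⟩ := hexits s hs
  obtain rfl := (cell_eq_attached_iff.1 hS).2
  rw [find_attachify, (cell_eq_opened_iff.1 hcell).2.2.1]
  exact ⟨hc'.rel_labels hr he.snk_le hsn (ha.attached _ he.snk_le hcell) (ha.of_attached hsn hS)
    ((he.exits s hs).rel hr (by simp)), h.find_le s hsn⟩

theorem mem_R_of_rel_opened (hc : Faithful r n D.cell) (h : D.Represents r n) {A : ℕ}
    (hu : u ≤ n) (hcell : D.cell u = .opened U P) (hA : A ≤ n) (hcA : D.cell A = .attached A)
    (hAU : r A U) : (A, U) ∈ (D.attachify u).R := by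
  obtain ⟨hU, hcU⟩ := hc.opened_label hu hcell
  obtain ⟨hP, hcP⟩ := hc.pred_label hu (Cell.mem_pred_of_eq_opened hcell)
  have hAP : r A P := (hc.rel_iff hA hU (Cell.mem_succ_of_eq hcA)
    (Cell.mem_pred_of_eq_opened hcU) (by simp [hcU])).1 hAU
  rw [attachify_of_opened hcell]
  exact mem_arcSets.2 (.inr ⟨h.complete hA hP hcA hcP hAP, .inl rfl⟩)

theorem mem_R_of_opened_rel (hr : StrandOrder r) (hc : Faithful r n D.cell)
    (h : D.Represents r n) (he : e.Inv r n D.cell) (hcell : D.cell e.snk = .opened U P)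
    (hexits : ∀ s ∈ e.exits, s ≤ n ∧ IsFirst r n D.cell s ∧ ∃ S, D.cell s = .attached S) {B : ℕ}
    (hB : B ≤ n) (hcB : D.cell B = .attached B) (hUB : r U B) :
    (U, B) ∈ ((D.attachify e.snk).arcs (e.exits.map fun s => (e.snk, s))).R := by
  obtain ⟨hU, hcU⟩ := hc.opened_label he.snk_le hcell
  have hBlive : (D.cell B).pred.isSome := by simp [hcB, Cell.pred]
  obtain hBe | ⟨s, hs, hsB⟩ := he.out U hU B hB hBlive (hcU.trans hcell.symm) hUB
  · simp [hcB, hcell] at hBe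
  obtain ⟨hsn, hfirst, S, hS⟩ := hexits s hs
  obtain ⟨hSn, hcS⟩ := hc.succ_label hsn (Cell.mem_succ_of_eq hS)
  have hSB : r S B := (hc.rel_iff_of_isFirst hr hsn hB hS hfirst (Cell.mem_pred_of_eq hcB)).1 hsB
  refine mem_arcs (List.mem_map_of_mem hs) (.inl ?_) ?_ <;> rw [find_attachify]
  · exact (cell_eq_opened_iff.1 hcell).2.2.1.symm
  · rw [(cell_eq_attached_iff.1 hS).2]
    exact (h.complete hSn hB hcS hcB hSB).imp Eq.symm (@R_subset_attachify _ _ _)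

theorem attachify (hr : StrandOrder r) (hc : Faithful r n D.cell) (h : D.Represents r n)
    (he : e.Inv r n D.cell) (hcell : D.cell e.snk = .opened U P)
    (hexits : ∀ s ∈ e.exits, s ≤ n ∧ IsFirst r n D.cell s ∧ ∃ S, D.cell s = .attached S)
    (hc' : Faithful r n (D.attachify e.snk).cell) :
    ((D.attachify e.snk).arcs (e.exits.map fun s => (e.snk, s))).Represents r n where
  find_le := by
    rw [find_arcs, find_attachify]
    exact h.find_le
  sound := h.arcsSound_attachify hr hc he hcell (fun s hs => (hexits s hs).imp_right And.right) hc'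
  complete {A B} hA hB hcA hcB hAB := by
    rw [cell_arcs] at hcA hcB
    have ha := attachesSet_attachify (n := n) hcell
    have hold : ∀ {C}, C ≤ n → (D.attachify e.snk).cell C = .attached C → C ≠ U →
        D.cell C = .attached C := fun {C} hC hcC hne => by
      rwa [← ha.other C hC fun hCU => hne ?_]
      simpa [hcC] using ha.attached C hC hCU
    obtain hAU | hAU := eq_or_ne A U <;> obtain hBU | hBU := eq_or_ne B U
    · exact .inl (hAU.trans hBU.symm)
    · subst hAU
      exact .inr (h.mem_R_of_opened_rel hr hc he hcell hexits hB (hold hB hcB hBU) hAB)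
    · subst hBU
      exact .inr (R_subset_arcs
        (h.mem_R_of_rel_opened hc he.snk_le hcell hA (hold hA hcA hAU) hAB))
    · exact (h.complete hA hB (hold hA hcA hAU) (hold hB hcB hBU) hAB).imp_right fun hAB =>
        R_subset_arcs (R_subset_attachify hAB)

theorem arcs (hr : StrandOrder r) (hc : Faithful r n D.cell) (h : D.Represents r n)
    {l : List (ℕ × ℕ)} (hl : ∀ p ∈ l, p.1 ≤ n ∧ p.2 ≤ n ∧ (∃ A, D.cell p.1 = .attached A) ∧
      (∃ B, D.cell p.2 = .attached B) ∧ r p.1 p.2) : (D.arcs l).Represents r n where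
  find_le := by
    rw [find_arcs]
    exact h.find_le
  sound := h.sound.arcs hr fun p hp => by
    obtain ⟨h₁, h₂, ⟨A, hA⟩, ⟨B, hB⟩, hrel⟩ := hl p hp
    rw [(cell_eq_attached_iff.1 hA).2, (cell_eq_attached_iff.1 hB).2]
    exact ⟨hc.rel_labels hr h₁ h₂ hA hB hrel,
      (hc.succ_label h₂ (Cell.mem_succ_of_eq hB)).1⟩
  complete hA hB hcA hcB hAB := by
    rw [cell_arcs] at hcA hcB
    exact (h.complete hA hB hcA hcB hAB).imp_right (@R_subset_arcs _ _ _)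

end Represents

end DNSP

open DNSP in
theorem Shape.attachify {L : List Block} {fut : Set ℕ} (hr : StrandOrder r)
    (h : Shape r n L fut D.cell) (hD : D.Represents r n) (he : e ∈ L)
    (hexits : ∀ s ∈ e.exits, s ≤ n ∧ IsFirst r n D.cell s ∧ ∃ S, D.cell s = .attached S)
    {D' : DNSP} (hD' : D' = (D.attachify e.snk).arcs (e.exits.map fun s => (e.snk, s))) :
    D'.Represents r n ∧ Shape r n L fut D'.cell ∧ (∃ A, D'.cell e.snk = .attached A) ∧
      ∀ x ≤ n, D'.cell x = D.cell x ∨ ∃ A, D'.cell x = .attached A := by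
  have hinv := h.block e he
  rw [hD', cell_arcs]
  obtain ⟨-, B, -, hB⟩ | ⟨U, P, -, hU⟩ := hinv.cells
  · rw [attachify_of_attached ⟨B, hB⟩]
    refine ⟨hD.arcs hr h.faithful fun p hp => ?_, h, ⟨B, hB⟩, fun x _ => .inl rfl⟩
    obtain ⟨s, hs, rfl⟩ := List.mem_map.1 hp
    obtain ⟨hsn, -, hS⟩ := hexits s hs
    exact ⟨hinv.snk_le, hsn, ⟨B, hB⟩, hS, (hinv.exits s hs).rel hr (by simp)⟩
  · have ha := attachesSet_attachify (n := n) hU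
    have h' := h.attach hr he hU hexits ha
    refine ⟨hD.attachify hr h.faithful hinv hU hexits h'.faithful, h',
      ⟨U, ha.attached _ hinv.snk_le hU⟩, fun x hx => ?_⟩
    by_cases hxU : D.cell x = .opened U P
    · exact .inr ⟨U, ha.attached x hx hxU⟩
    · exact .inl (ha.other x hx hxU)

end

section

variable {n : ℕ} {a b f : Block} {D : DNSP}

namespace DNSP

variable {x u v t A : ℕ}

theorem cell_union_of_eq (hv : (D.cell v).pred.isSome) (hx : D.cell x = D.cell v) :
    (D.union u v).cell x = D.cell u :=
  congrArg D.setCell (if_pos ((find_eq_iff hv).2 hx))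

theorem cell_union_of_ne (hx : D.cell x ≠ D.cell v) : (D.union u v).cell x = D.cell x :=
  congrArg D.setCell (if_neg (mt (congrArg D.setCell) hx))

theorem cell_union_self : (D.union u v).cell u = D.cell u := by
  refine congrArg D.setCell ?_
  simp only [union, relabel]
  split_ifs <;> rfl

theorem cell_add_of_ne (hx : x ≠ v) : (D.add u v).cell x = D.cell x :=
  congrArg D.setCell (Function.update_of_ne hx _ _)

theorem cell_add_self : (D.add u v).cell v = D.cell u :=
  congrArg D.setCell (Function.update_self _ _ _)

theorem mergesBoth_union (ha : (D.cell a.snk).pred.isSome) (hb : (D.cell b.snk).pred.isSome)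
    (hne : D.cell b.snk ≠ D.cell a.snk) : MergesBoth n D.cell
      (((D.union f.snk a.snk).union f.snk b.snk).add f.snk (n + 1)).cell a b f := by
  have hb' : (D.union f.snk a.snk).cell b.snk = D.cell b.snk := cell_union_of_ne hne
  have hlive : ((D.union f.snk a.snk).cell b.snk).pred.isSome := hb' ▸ hb
  constructor
  · rintro x hx hxab
    rw [cell_add_of_ne (by omega), ← cell_union_self (D := D) (u := f.snk) (v := a.snk)]
    by_cases hxb : D.cell x = D.cell b.snk
    · refine cell_union_of_eq hlive ?_
      rw [hb', cell_union_of_ne (hxb ▸ hne), hxb]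
    · have hxf : (D.union f.snk a.snk).cell x = D.cell f.snk :=
        cell_union_of_eq ha (hxab.resolve_right hxb)
      by_cases hfb : D.cell f.snk = D.cell b.snk
      · exact cell_union_of_eq hlive (by rw [hxf, hb', hfb])
      · rw [cell_union_of_ne (by rwa [hxf, hb']), hxf, cell_union_self]
  · intro x hx hxa hxb
    have hx' : (D.union f.snk a.snk).cell x = D.cell x := cell_union_of_ne hxa
    rw [cell_add_of_ne (by omega), cell_union_of_ne (by rwa [hx', hb']), hx']
  · rw [cell_add_self, cell_union_self, cell_union_self]

theorem cell_update_attSucc_of_find_eq (ht : D.isAttached t = false) (hx : D.find x = D.find t) :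
    { D with attSucc := Function.update D.attSucc (D.find t) (some A) }.cell x = .closed A := by
  simp_all [cell, setCell, isAttached]

theorem cell_update_attSucc_of_find_ne (hx : D.find x ≠ D.find t) {S : Option ℕ} :
    { D with attSucc := Function.update D.attSucc (D.find t) S }.cell x = D.cell x := by
  simp [cell, setCell, hx]

theorem cell_ite_union_of_opened {U P : ℕ} (hu : D.cell u = .opened U P)
    (hx : D.cell x = .opened U P) :
    (if D.isAttached u then D else D.union v u).cell x = D.cell v := by
  rw [if_neg (by simp [isAttached_iff, hu])]
  exact cell_union_of_eq (by simp [hu, Cell.pred]) (hx.trans hu.symm)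

theorem cell_ite_union_of_ne (hu : (D.cell u).pred.isSome)
    (hx : ∀ U P, D.cell u = .opened U P → D.cell x ≠ .opened U P) :
    (if D.isAttached u then D else D.union v u).cell x = D.cell x := by
  split_ifs with h
  · rfl
  rw [isAttached_iff] at h
  refine cell_union_of_ne fun hxu => ?_
  rcases hcu : D.cell u with A | ⟨U, P⟩ | A
  · exact h ⟨A, hcu⟩
  · exact hx U P hcu (hxu.trans hcu)
  · simp [hcu, Cell.pred] at hu

theorem joinsOne {S T V Q : ℕ} (hS : D.cell a.src = .attached S) (hT : D.cell a.snk = .attached T)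
    (hb : D.cell b.snk = .opened V Q) (hbf : D.cell b.snk ≠ D.cell f.snk)
    (hf : (D.cell f.snk).pred.isSome) (hbn : b.snk ≤ n) :
    JoinsOne n D.cell (D.joinOne f.snk a.src a.snk b.snk (n + 1)).cell a b f S T := by
  set D₁ := if D.isAttached f.snk then D else D.union a.src f.snk
  set D₂ := D₁.add a.snk (n + 1)
  have hD₂ : ∀ x ≤ n, D₂.cell x = D₁.cell x := fun x hx => cell_add_of_ne (by omega)
  have hother : ∀ x ≤ n, (∀ U P, D.cell f.snk = .opened U P → D.cell x ≠ .opened U P) →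
      D₂.cell x = D.cell x := fun x hx hxU => (hD₂ x hx).trans (cell_ite_union_of_ne hf hxU)
  have hbU : ∀ U P, D.cell f.snk = .opened U P → D.cell b.snk ≠ .opened U P :=
    fun U P hfU hbU => hbf (hbU.trans hfU.symm)
  have hb₂ : D₂.cell b.snk = .opened V Q := (hother _ hbn hbU).trans hb
  have hbU₂ : D₂.isAttached b.snk = false := by simp [← Bool.not_eq_true, isAttached_iff, hb₂]
  have hnew : D₂.cell (n + 1) = .attached T :=
    cell_add_self.trans ((cell_ite_union_of_ne hf (by simp [hT])).trans hT)
  have hunchanged : ∀ x, D₂.cell x ≠ .opened V Q →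
      (D.joinOne f.snk a.src a.snk b.snk (n + 1)).cell x = D₂.cell x := fun x hx =>
    cell_update_attSucc_of_find_ne (mt (find_eq_iff_of_opened hb₂).1 hx)
  refine ⟨hS, hT, ⟨V, Q, hb⟩, fun x hx hxb => ?_, fun x hx U P hfU hxU => ?_,
    fun x hx hxb hxU => ?_, ?_⟩
  · have hx₂ : D₂.cell x = .opened V Q := by rw [hother x hx (hxb ▸ hbU), hxb, hb]
    rw [← (cell_eq_attached_iff.1 hnew).2]
    exact cell_update_attSucc_of_find_eq hbU₂ ((find_eq_iff_of_opened hb₂).2 hx₂)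
  · have hx₂ : D₂.cell x = .attached S :=
      (hD₂ x hx).trans ((cell_ite_union_of_opened hfU hxU).trans hS)
    rw [hunchanged x (by simp [hx₂]), hx₂]
  · have hx₂ := hother x hx hxU
    rw [hunchanged x (by rwa [hx₂, ← hb]), hx₂]
  · rw [hunchanged _ (by simp [hnew]), hnew]

end DNSP

end

section

variable {r : ℕ → ℕ → Prop} {n : ℕ} {a b f : Block} {D : DNSP}

namespace DNSP

variable {u v S T : ℕ}

theorem find_union_le (h : ∀ x ≤ n, D.find x ≤ n) (hu : u ≤ n) :
    ∀ x ≤ n, (D.union u v).find x ≤ n := fun x hx => by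
  simp only [union, relabel]
  split_ifs
  exacts [h u hu, h x hx]

theorem find_add_le (h : ∀ x ≤ n, D.find x ≤ n) (hu : u ≤ n) :
    ∀ x ≤ n + 1, (D.add u (n + 1)).find x ≤ n + 1 := fun x hx => by
  simp only [add]
  obtain hxn | rfl := Nat.le_add_one_iff.1 hx
  · rw [Function.update_of_ne (by omega)]
    exact (h x hxn).trans n.le_succ
  · rw [Function.update_self]
    exact (h u hu).trans n.le_succ

namespace Represents

theorem mergesBoth (hc : Faithful r n D.cell) (h : D.Represents r n) (hf : f.snk ≤ n)
    (m : MergesBoth n D.cell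
      (((D.union f.snk a.snk).union f.snk b.snk).add f.snk (n + 1)).cell a b f) :
    (((D.union f.snk a.snk).union f.snk b.snk).add f.snk (n + 1)).Represents r (n + 1) := by
  refine h.of_R_eq hc (find_add_le (find_union_le (find_union_le h.find_le hf) hf) hf) rfl
    fun x hx A hA => ?_
  by_cases hxf : (((D.union f.snk a.snk).union f.snk b.snk).add f.snk (n + 1)).cell x
      = D.cell f.snk
  · exact ⟨f.snk, hf, Cell.mem_succ_of_eq (hxf.symm.trans hA)⟩
  · obtain ⟨hxn, hcx, -⟩ := m.old_of_ne hx hxf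
    exact ⟨x, hxn, Cell.mem_succ_of_eq (hcx.symm.trans hA)⟩

theorem joinOne (hc : Faithful r n D.cell) (h : D.Represents r n) (hsrc : a.src ≤ n)
    (hsnk : a.snk ≤ n)
    (m : JoinsOne n D.cell (D.joinOne f.snk a.src a.snk b.snk (n + 1)).cell a b f S T) :
    (D.joinOne f.snk a.src a.snk b.snk (n + 1)).Represents r (n + 1) := by
  have hle : ∀ x ≤ n, (if D.isAttached f.snk then D else D.union a.src f.snk).find x ≤ n := by
    split_ifs
    exacts [h.find_le, find_union_le h.find_le hsrc]
  refine h.of_R_eq hc (find_add_le hle hsnk) ?_ fun x hx A hA => ?_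
  · simp only [DNSP.joinOne, add]
    split_ifs <;> rfl
  · obtain ⟨rfl, -⟩ | ⟨rfl, -⟩ | ⟨hxn, hA⟩ := m.succ_cases hx (Cell.mem_succ_of_eq hA)
    exacts [⟨a.snk, hsnk, Cell.mem_succ_of_eq m.snk⟩, ⟨a.src, hsrc, Cell.mem_succ_of_eq m.src⟩,
      ⟨x, hxn, hA⟩]

end Represents

end DNSP

end

/-- The unattached sets of `D_NSP` that are still open lie within the bags of `D_SP`: the set that
ends with the sink of a block is contained in the bag of the function of this block. Here `bag x` is
the label of the bag that holds `x`. -/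
def SetsInBags (n : ℕ) (L : List Block) (c : ℕ → Cell) (bag : ℕ → ℕ) : Prop :=
  ∀ e ∈ L, ∀ x ≤ n, ∀ U P, c x = .opened U P → c e.snk = .opened U P → bag x = e.fn

section

variable {r : ℕ → ℕ → Prop} {n : ℕ} {c c₁ c' : ℕ → Cell} {L L' M : List Block} {fut : Set ℕ}
  {bag bag' : ℕ → ℕ} {a b f : Block}

theorem SetsInBags.addStrand (h : SetsInBags n L c bag) (hadd : AddsStrand r n c₁ c')
    (hc : ∀ x ≤ n, c₁ x = c x ∨ ∃ A, c₁ x = .attached A)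
    (hL : ∀ e ∈ L', e.snk = n + 1 ∧ bag' (n + 1) = e.fn ∨ ∃ d ∈ L, d.snk ≤ n ∧ e.snk = d.snk ∧
      e.fn = d.fn ∧ ∀ x ≤ n, bag x = d.fn → bag' x = d.fn) :
    SetsInBags (n + 1) L' c' bag' := by
  have hold : ∀ x ≤ n, ∀ U P, c' x = .opened U P → c x = .opened U P := fun x hx U P hU => by
    rw [hadd.old x hx] at hU
    obtain hcx | ⟨A, hA⟩ := hc x hx
    · rwa [← hcx]
    · simp [hA] at hU
  intro e he x hx U P hxU heU
  obtain ⟨hsnk, hnew⟩ | ⟨d, hd, hdn, hsnk, hfn, hkeep⟩ := hL e he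
  · rw [hadd.eq_new hx (.inl (by rw [hxU, ← heU, hsnk])), hnew]
  · rw [hsnk] at heU
    obtain ⟨hxn, -⟩ := (hadd.keepsSet hdn).2 x hx (.inl (.inl (hxU.trans heU.symm)))
    rw [hfn]
    exact hkeep x hxn (h d hd x hxn U P (hold x hxn U P hxU) (hold _ hdn U P heU))

theorem MergesBoth.setsInBags (m : MergesBoth n c c' a b f) (hr : StrandOrder r)
    (hL : SetsInBags n L c bag) (h : Shape r (n + 1) (⟨f.fn, f.src, n + 1, []⟩ :: L') fut c')
    {U P V Q : ℕ} (ha : c a.snk = .opened U P) (hb : c b.snk = .opened V Q)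
    (haL : a ∈ L) (hbL : b ∈ L) (hfL : f ∈ L) (hsub : L' ⊆ L) (hnew : bag' (n + 1) = f.fn)
    (hmerge : ∀ x ≤ n, bag x = a.fn ∨ bag x = b.fn ∨ bag x = f.fn → bag' x = f.fn)
    (hkeep : ∀ d ∈ L', ∀ x ≤ n, bag x = d.fn → bag' x = d.fn) :
    SetsInBags (n + 1) (⟨f.fn, f.src, n + 1, []⟩ :: L') c' bag' := by
  refine List.forall_mem_cons.2 ⟨fun x hx W R hxW hW => ?_, fun d hd x hx W R hxW hW => ?_⟩
  · have hf : c f.snk = .opened W R := m.new.symm.trans hW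
    obtain rfl | ⟨hxn, hcx⟩ := m.cases_of_eq hx (hxW.trans hf.symm)
    · exact hnew
    · exact hmerge x hxn <| hcx.imp (fun h => hL a haL x hxn U P (h.trans ha) ha) <|
        .imp (fun h => hL b hbL x hxn V Q (h.trans hb) hb)
          fun h => hL f hfL x hxn W R (h.trans hf) hf
  · have hne : c' d.snk ≠ c f.snk := by
      rw [← m.new]
      exact ((List.pairwise_cons.1 h.order).1 d hd).cell_ne hr (h.block d (by simp [hd]))
        (h.block _ List.mem_cons_self)
    obtain ⟨-, hcd, -⟩ := m.old_of_ne (h.block d (by simp [hd])).snk_le hne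
    obtain ⟨hxn, hcx, -⟩ := m.old_of_ne hx (by rwa [hxW, ← hW])
    exact hkeep d hd x hxn (hL d (hsub hd) x hxn W R (hcx.symm.trans hxW) (hcd.symm.trans hW))

theorem JoinsOne.setsInBags {S T : ℕ} (m : JoinsOne n c c' a b f S T)
    (hL : SetsInBags n L c bag) (hsub : L' ⊆ L) (hle : ∀ d ∈ L', d.snk ≤ n)
    (hkeep : ∀ d ∈ L', ∀ x ≤ n, bag x = d.fn → bag' x = d.fn) :
    SetsInBags (n + 1) (⟨f.fn, f.src, n + 1, []⟩ :: L') c' bag' := by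
  have hold : ∀ x ≤ n + 1, ∀ U P, c' x = .opened U P → x ≤ n ∧ c x = .opened U P :=
    fun x hx U P hU => by
      obtain hxn | rfl := Nat.le_add_one_iff.1 hx
      · rcases m.cases hxn with ⟨-, hcx⟩ | ⟨-, -, -, -, hcx⟩ | ⟨-, -, hcx⟩
        · simp [hcx] at hU
        · simp [hcx] at hU
        · exact ⟨hxn, hcx ▸ hU⟩
      · simp [m.new] at hU
  refine List.forall_mem_cons.2 ⟨fun x _ U P _ hU => by simp [m.new] at hU,
    fun d hd x hx U P hxU hU => ?_⟩
  obtain ⟨hxn, hcx⟩ := hold x hx U P hxU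
  exact hkeep d hd x hxn
    (hL d (hsub hd) x hxn U P hcx (hold d.snk ((hle d hd).trans n.le_succ) U P hU).2)

end

namespace DNSP

/-- The invariant of `D_NSP` after the strands up to `n` have begun: `L` lists the blocks that have
not been completed, the most recent one first, `fut` holds the last strands of the completed
futures, `att` holds strands in attached sets, and `bag` assigns to each strand the label of its bag
in `D_SP`. -/
structure Inv (r : ℕ → ℕ → Prop) (n : ℕ) (L : List Block) (fut att : Set ℕ) (bag : ℕ → ℕ)
    (D : DNSP) : Prop where
  shape : Shape r n L fut D.cell
  represents : D.Represents r n
  setsInBags : SetsInBags n L D.cell bag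
  attached : ∀ x ∈ att, x ≤ n ∧ ∃ A, D.cell x = .attached A

/-- The join of the blocks `a` and `b`, forked at the sink of `f`, merges their bags into the bag of
the function of `f`, which also receives the join strand. -/
structure JoinsBags (n : ℕ) (L : List Block) (bag bag' : ℕ → ℕ) (a b f : Block) : Prop where
  new : bag' (n + 1) = f.fn
  merge : ∀ x ≤ n, bag x = a.fn ∨ bag x = b.fn ∨ bag x = f.fn → bag' x = f.fn
  keep : ∀ d ∈ L, ∀ x ≤ n, bag x = d.fn → bag' x = d.fn

theorem JoinsBags.symm {n : ℕ} {L : List Block} {bag bag' : ℕ → ℕ} {a b f : Block}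
    (h : JoinsBags n L bag bag' a b f) : JoinsBags n L bag bag' b a f :=
  ⟨h.new, fun x hx hbag => h.merge x hx (by tauto), h.keep⟩

namespace Inv

section

variable {r : ℕ → ℕ → Prop} {n : ℕ} {L M : List Block} {fut fut' att att' : Set ℕ}
  {bag bag' : ℕ → ℕ} {a b f : Block} {D : DNSP}

theorem mono (h : Inv r n L fut att bag D) (hfut : fut' ⊆ fut) (hatt : att' ⊆ att) :
    Inv r n L fut' att' bag D where
  shape := { h.shape with fut := fun t ht => h.shape.fut t (hfut ht) }
  represents := h.represents
  setsInBags := h.setsInBags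
  attached x hx := h.attached x (hatt hx)

theorem attached_of_keeps (h : Inv r n L fut att bag D) {D' : DNSP}
    (hkeep : ∀ x ≤ n, ∀ A, D.cell x = .attached A → ∃ A, D'.cell x = .attached A) :
    ∀ x ∈ att, x ≤ n + 1 ∧ ∃ A, D'.cell x = .attached A := fun x hx => by
  obtain ⟨hxn, A, hA⟩ := h.attached x hx
  exact ⟨hxn.trans n.le_succ, hkeep x hxn A hA⟩

theorem attachify (hr : StrandOrder r) (h : Inv r n L fut att bag D) {e : Block} (he : e ∈ L)
    (hexits : ∀ s ∈ e.exits, s ≤ n ∧ IsFirst r n D.cell s ∧ ∃ S, D.cell s = .attached S) {D' : DNSP}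
    (hD' : D' = (D.attachify e.snk).arcs (e.exits.map fun s => (e.snk, s))) :
    Inv r n L fut att bag D' ∧ (∃ A, D'.cell e.snk = .attached A) ∧
      ∀ x ≤ n, ∀ A, D.cell x = .attached A → ∃ A, D'.cell x = .attached A := by
  obtain ⟨hrep, hshape, hA, hcell⟩ := h.shape.attachify hr h.represents he hexits hD'
  have hold : ∀ x ≤ n, ∀ U P, D'.cell x = .opened U P → D.cell x = .opened U P :=
    fun x hx U P hU => by
      obtain hcx | ⟨A, hA⟩ := hcell x hx
      · rwa [← hcx]
      · simp [hA] at hU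
  have hatt : ∀ x ≤ n, ∀ A, D.cell x = .attached A → ∃ A, D'.cell x = .attached A :=
    fun x hx A hA => (hcell x hx).elim (fun hcx => ⟨A, hcx.trans hA⟩) id
  refine ⟨⟨hshape, hrep, fun d hd x hx U P hxU hU => ?_, fun x hx => ?_⟩, hA, hatt⟩
  · exact h.setsInBags d hd x hx U P (hold x hx U P hxU)
      (hold _ (h.shape.block d hd).snk_le U P hU)
  · obtain ⟨hxn, A, hA⟩ := h.attached x hx
    exact ⟨hxn, hatt x hxn A hA⟩

theorem extend (hr : StrandOrder r) {F s t : ℕ} {exits ps : List ℕ}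
    (h : Inv r n (M ++ ⟨F, s, t, exits⟩ :: L) fut att bag D) (hps : ImmediatePreds r (n + 1) ps)
    (hlast : ∀ p ∈ ps, p ≤ n ∧ IsLast r n D.cell p ∧ (∃ A, D.cell p = .attached A) ∧
      ∀ d ∈ L, D.cell p ≠ D.cell d.snk)
    (ht : r t (n + 1)) (hattached : ∃ A, D.cell t = .attached A)
    (hM : ∀ e ∈ M, ∃ A, D.cell e.snk = .attached A) (hnew : bag' (n + 1) = F)
    (hkeep : ∀ d ∈ L, ∀ x ≤ n, bag x = d.fn → bag' x = d.fn) :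
    Inv r (n + 1) (⟨F, s, n + 1, []⟩ :: L) fut att bag'
      ((D.makeAttached (n + 1)).arcs (ps.map fun p => (p, n + 1))) := by
  have hlast' : ∀ p ∈ ps, p ≤ n ∧ IsLast r n D.cell p ∧ ∃ A, D.cell p = .attached A :=
    fun p hp => ⟨(hlast p hp).1, (hlast p hp).2.1, (hlast p hp).2.2.1⟩
  have hadd := addsStrand_makeAttached hr h.shape.faithful h.represents hps hlast'
    (ps.map fun p => (p, n + 1))
  have hcell : ((D.makeAttached (n + 1)).arcs (ps.map fun p => (p, n + 1))).cell (n + 1)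
      = .attached (n + 1) := by
    rw [cell_arcs, cell_makeAttached_self]
  refine ⟨h.shape.extend hr hadd hps (fun p hp => ?_) ht hattached hM hcell,
    h.represents.makeAttached hr h.shape.faithful hps hlast',
    h.setsInBags.addStrand hadd (fun _ _ => .inl rfl) (List.forall_mem_cons.2
      ⟨.inl ⟨rfl, hnew⟩, fun d hd => .inr ⟨d, by simp [hd], ?_, rfl, rfl, hkeep d hd⟩⟩),
    h.attached_of_keeps fun x hx _ hA => ⟨_, (hadd.old x hx).trans hA⟩⟩
  · obtain ⟨hpn, -, ⟨A, hA⟩, hne⟩ := hlast p hp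
    exact ⟨hpn, by simp [hA, Cell.pred], hne⟩
  · exact (h.shape.block d (by simp [hd])).snk_le

theorem joinBoth (hr : StrandOrder r) (h : Inv r n (M ++ f :: L) fut att bag D)
    (hM : ∀ e, e ∈ M ↔ e = a ∨ e = b) (j : Join r n D.cell a b f)
    (hbag : JoinsBags n L bag bag' a b f) {U P V Q : ℕ} (ha : D.cell a.snk = .opened U P)
    (hb : D.cell b.snk = .opened V Q) :
    Inv r (n + 1) (⟨f.fn, f.src, n + 1, []⟩ :: L) fut att bag'
      (((D.union f.snk a.snk).union f.snk b.snk).add f.snk (n + 1)) := by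
  have m := mergesBoth_union (n := n) (f := f) j.inv_a.live j.inv_b.live (j.cell_a_ne_b hr).symm
  have hshape := h.shape.joinBoth hr hM j m ha hb
  have hmem : ∀ e, e = a ∨ e = b → e ∈ M ++ f :: L := fun e he =>
    List.mem_append_left _ ((hM e).2 he)
  exact ⟨hshape, h.represents.mergesBoth h.shape.faithful j.inv_f.snk_le m,
    m.setsInBags hr h.setsInBags hshape ha hb (hmem a (.inl rfl)) (hmem b (.inr rfl)) (by simp)
      (fun d hd => by simp [hd]) hbag.new hbag.merge hbag.keep, h.attached_of_keeps fun x hx A hA =>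
        ⟨A, (m.other x hx (by simp [hA, ha]) (by simp [hA, hb])).trans hA⟩⟩

theorem joinOne (hr : StrandOrder r) (h : Inv r n (M ++ f :: L) fut att bag D)
    (hM : ∀ e, e ∈ M ↔ e = a ∨ e = b) (j : Join r n D.cell a b f)
    (hbag : JoinsBags n L bag bag' a b f) {T V Q : ℕ} (ha : D.cell a.snk = .attached T)
    (hb : D.cell b.snk = .opened V Q) :
    Inv r (n + 1) (⟨f.fn, f.src, n + 1, []⟩ :: L) fut att bag'
      (D.joinOne f.snk a.src a.snk b.snk (n + 1)) := by
  obtain ⟨S, hS⟩ := j.inv_a.src_cell_of_snk_attached ha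
  have m := joinsOne hS ha hb (j.symm.cell_a_ne_f hr) j.inv_f.live j.inv_b.snk_le
  exact ⟨h.shape.joinOne hr hM j m,
    h.represents.joinOne h.shape.faithful (j.inv_a.src_le_n hr) j.inv_a.snk_le m,
    m.setsInBags h.setsInBags (fun d hd => by simp [hd])
      (fun d hd => (h.shape.block d (by simp [hd])).snk_le) hbag.keep,
    h.attached_of_keeps fun _ hx A hA => ⟨A, m.of_attached hx hA⟩⟩

theorem joinAttached (hr : StrandOrder r) (h : Inv r n (M ++ f :: L) fut att bag D)
    (hM : ∀ e, e ∈ M ↔ e = a ∨ e = b) (j : Join r n D.cell a b f)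
    (hexits : f.exits = [a.src, b.src]) (hbag : JoinsBags n L bag bag' a b f) {A B : ℕ}
    (ha : D.cell a.snk = .attached A) (hb : D.cell b.snk = .attached B) :
    Inv r (n + 1) (⟨f.fn, f.src, n + 1, []⟩ :: L) fut att bag'
      ((((D.attachify f.snk).arcs (f.exits.map fun s => (f.snk, s))).makeAttached (n + 1)).arcs
        ([a.snk, b.snk].map fun p => (p, n + 1))) := by
  obtain ⟨S, hS⟩ := j.inv_a.src_cell_of_snk_attached ha
  obtain ⟨T, hT⟩ := j.inv_b.src_cell_of_snk_attached hb
  obtain ⟨h', hf', hold⟩ := h.attachify hr (e := f) (by simp) (by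
    rw [hexits]
    simpa using ⟨⟨j.inv_a.src_le_n hr, j.inv_a.src_first, S, hS⟩,
      j.inv_b.src_le_n hr, j.inv_b.src_first, T, hT⟩) rfl
  have ha' := hold _ j.inv_a.snk_le A ha
  have hb' := hold _ j.inv_b.snk_le B hb
  have hcross := (List.pairwise_append.1 h'.shape.order).2.2
  have hlast : ∀ e ∈ M, e.snk ≤ n ∧ IsLast r n _ e.snk ∧ ∀ d ∈ L, _ := fun e he =>
    have hinv := h'.shape.block e (List.mem_append_left _ he)
    ⟨hinv.snk_le, hinv.snk_last, fun d hd => ((hcross e he d (by simp [hd])).cell_ne hr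
      (h'.shape.block d (by simp [hd])) hinv).symm⟩
  obtain ⟨hlea, hlasta, hnea⟩ := hlast a ((hM a).2 (.inl rfl))
  obtain ⟨hleb, hlastb, hneb⟩ := hlast b ((hM b).2 (.inr rfl))
  refine h'.extend hr j.preds (by simp only [List.forall_mem_cons]; exact
    ⟨⟨hlea, hlasta, ha', hnea⟩, ⟨hleb, hlastb, hb', hneb⟩, by simp⟩) (j.f_rel_new hr) hf'
    (fun e he => ?_) hbag.new hbag.keep
  obtain rfl | rfl := (hM e).1 he
  exacts [ha', hb']

theorem onSync (hr : StrandOrder r) (h : Inv r n (M ++ f :: L) fut att bag D)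
    (hM : ∀ e, e ∈ M ↔ e = a ∨ e = b) (j : Join r n D.cell a b f)
    (hexits : f.exits = [a.src, b.src]) (hbag : JoinsBags n L bag bag' a b f) :
    Inv r (n + 1) (⟨f.fn, f.src, n + 1, []⟩ :: L) fut att bag'
      (D.onSync f.snk a.src a.snk b.src b.snk (n + 1)) := by
  have hM' : ∀ e, e ∈ M ↔ e = b ∨ e = a := fun e => (hM e).trans or_comm
  obtain ⟨-, A, -, hA⟩ | ⟨U, P, -, hU⟩ := j.inv_a.cells <;>
    obtain ⟨-, B, -, hB⟩ | ⟨V, Q, -, hV⟩ := j.inv_b.cells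
  · have hsync : D.onSync f.snk a.src a.snk b.src b.snk (n + 1)
        = (((D.attachify f.snk).arcs (f.exits.map fun s => (f.snk, s))).makeAttached (n + 1)).arcs
          ([a.snk, b.snk].map fun p => (p, n + 1)) := by
      simp only [DNSP.onSync, isAttached_of_attached hA, isAttached_of_attached hB, hexits]
      rfl
    exact hsync ▸ h.joinAttached hr hM j hexits hbag hA hB
  · simpa only [DNSP.onSync, isAttached_of_attached hA, isAttached_of_opened hV]
      using h.joinOne hr hM j hbag hA hV
  · simpa only [DNSP.onSync, isAttached_of_opened hU, isAttached_of_attached hB]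
      using h.joinOne hr hM' j.symm hbag.symm hB hU
  · simpa only [DNSP.onSync, isAttached_of_opened hU, isAttached_of_opened hV]
      using h.joinBoth hr hM j hbag hU hV

end

end Inv

end DNSP

namespace DNSP.Inv

variable {r : ℕ → ℕ → Prop} {n : ℕ} {L : List Block} {fut att : Set ℕ} {bag bag' : ℕ → ℕ}
  {D : DNSP} {F G N s first caller : ℕ}

theorem call (hr : StrandOrder r) (h : Inv r n (⟨F, s, n, []⟩ :: L) fut att bag D) {D' : DNSP}
    (hadd : AddsStrand r n D.cell D'.cell) (hrep : D'.Represents r (n + 1))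
    (hps : ImmediatePreds r (n + 1) [n]) (hnew : bag' (n + 1) = N)
    (hkeep : ∀ d ∈ (⟨F, s, n, []⟩ :: L : List Block), ∀ x ≤ n, bag x = d.fn → bag' x = d.fn) :
    Inv r (n + 1) (⟨N, n + 1, n + 1, []⟩ :: ⟨F, s, n, [n + 1]⟩ :: L) fut att bag' D' := by
  rw [List.forall_mem_cons] at hkeep
  refine ⟨h.shape.call hr hadd hps, hrep, h.setsInBags.addStrand hadd (fun _ _ => .inl rfl) ?_,
    h.attached_of_keeps fun x hx _ hA => ⟨_, (hadd.old x hx).trans hA⟩⟩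
  simp only [List.forall_mem_cons, List.exists_mem_cons_iff, true_and]
  exact ⟨.inl hnew, .inr (.inl ⟨le_rfl, hkeep.1⟩), fun d hd => .inr
    (.inr ⟨d, hd, (h.shape.block d (by simp [hd])).snk_le, rfl, rfl, hkeep.2 d hd⟩)⟩

theorem callSpawn (hr : StrandOrder r) (h : Inv r n (⟨F, s, n, []⟩ :: L) fut att bag D)
    (hps : ImmediatePreds r (n + 1) [n]) (hnew : bag' (n + 1) = N)
    (hkeep : ∀ d ∈ (⟨F, s, n, []⟩ :: L : List Block), ∀ x ≤ n, bag x = d.fn → bag' x = d.fn) :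
    Inv r (n + 1) (⟨N, n + 1, n + 1, []⟩ :: ⟨F, s, n, [n + 1]⟩ :: L) fut att bag'
      (D.onSpawnEdge n (n + 1)) := by
  have hinv := h.shape.block _ List.mem_cons_self
  exact h.call hr (addsStrand_makeUnattached hr h.shape.faithful h.represents hps le_rfl
    hinv.snk_last hinv.live) (h.represents.makeUnattached h.shape.faithful) hps hnew hkeep

theorem attachify_head (hr : StrandOrder r) (h : Inv r n (⟨F, s, n, []⟩ :: L) fut att bag D) :
    Inv r n (⟨F, s, n, []⟩ :: L) fut att bag (D.attachify n) ∧
      ∃ A, (D.attachify n).cell n = .attached A := by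
  obtain ⟨h', hA, -⟩ := h.attachify hr (e := ⟨F, s, n, []⟩) (by simp) (by simp) rfl
  exact ⟨h', hA⟩

theorem callCreate (hr : StrandOrder r) (h : Inv r n (⟨F, s, n, []⟩ :: L) fut att bag D)
    (hps : ImmediatePreds r (n + 1) [n]) (hnew : bag' (n + 1) = N)
    (hkeep : ∀ d ∈ (⟨F, s, n, []⟩ :: L : List Block), ∀ x ≤ n, bag x = d.fn → bag' x = d.fn) :
    Inv r (n + 1) (⟨N, n + 1, n + 1, []⟩ :: ⟨F, s, n, [n + 1]⟩ :: L) fut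
      (insert n (insert (n + 1) att)) bag' (D.onCreate n (n + 1)) := by
  obtain ⟨h', hA⟩ := h.attachify_head hr
  have hlast : ∀ p ∈ [n], p ≤ n ∧ IsLast r n (D.attachify n).cell p ∧
      ∃ A, (D.attachify n).cell p = .attached A := by
    simpa using ⟨(h'.shape.block _ List.mem_cons_self).snk_last, hA⟩
  have hadd := addsStrand_makeAttached hr h'.shape.faithful h'.represents hps hlast [(n, n + 1)]
  obtain ⟨hshape, hrep, hbags, hatt⟩ := h'.call hr hadd
    (h'.represents.makeAttached hr h'.shape.faithful hps hlast) hps hnew hkeep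
  refine ⟨hshape, hrep, hbags, Set.forall_mem_insert.2 ⟨⟨n.le_succ, hA.imp fun A hA => ?_⟩,
    Set.forall_mem_insert.2 ⟨⟨le_rfl, n + 1, ?_⟩, hatt⟩⟩⟩
  · exact (hadd.old n le_rfl).trans hA
  · exact (congrFun (cell_arcs (l := [(n, n + 1)])) _).trans cell_makeAttached_self

theorem retSpawn (hr : StrandOrder r)
    (h : Inv r n (⟨G, first, n, []⟩ :: ⟨F, s, caller, [first]⟩ :: L) fut att bag D)
    (hps : ImmediatePreds r (n + 1) [caller]) (hnew : bag' (n + 1) = F)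
    (hkeep : ∀ d ∈ (⟨G, first, n, []⟩ :: ⟨F, s, caller, [first]⟩ :: L : List Block),
      ∀ x ≤ n, bag x = d.fn → bag' x = d.fn) :
    Inv r (n + 1) (⟨F, n + 1, n + 1, []⟩ :: ⟨G, first, n, []⟩ ::
      ⟨F, s, caller, [first, n + 1]⟩ :: L) fut att bag' (D.onSpawnEdge caller (n + 1)) := by
  have hinv := h.shape.block ⟨F, s, caller, [first]⟩ (by simp)
  have hadd := addsStrand_makeUnattached hr h.shape.faithful h.represents hps hinv.snk_le
    hinv.snk_last hinv.live
  simp only [List.forall_mem_cons] at hkeep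
  refine ⟨h.shape.retSpawn hr hadd hps, h.represents.makeUnattached h.shape.faithful,
    h.setsInBags.addStrand hadd (fun _ _ => .inl rfl) ?_,
    h.attached_of_keeps fun x hx _ hA => ⟨_, (hadd.old x hx).trans hA⟩⟩
  simp only [List.forall_mem_cons, List.exists_mem_cons_iff, true_and]
  exact ⟨.inl hnew, .inr (.inl ⟨le_rfl, hkeep.1⟩), .inr (.inr (.inl ⟨hinv.snk_le, hkeep.2.1⟩)),
    fun d hd => .inr (.inr (.inr ⟨d, hd, (h.shape.block d (by simp [hd])).snk_le, rfl, rfl,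
      hkeep.2.2 d hd⟩))⟩

theorem retCreate (hr : StrandOrder r)
    (h : Inv r n (⟨G, first, n, []⟩ :: ⟨F, s, caller, [first]⟩ :: L) fut att bag D)
    (hps : ImmediatePreds r (n + 1) [caller]) (hcaller : caller ∈ att)
    (hfirst : first ∈ att) (hnew : bag' (n + 1) = F)
    (hkeep : ∀ d ∈ L, ∀ x ≤ n, bag x = d.fn → bag' x = d.fn) :
    Inv r (n + 1) (⟨F, s, n + 1, []⟩ :: L) (insert n fut) att bag'
      (D.onCreateCont caller (n + 1)) := by
  obtain ⟨hbelow, hpw⟩ := List.pairwise_cons.1 h.shape.order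
  have hchild := h.shape.block _ List.mem_cons_self
  have hparent := h.shape.block ⟨F, s, caller, [first]⟩ (by simp)
  obtain ⟨-, A, hA⟩ := h.attached caller hcaller
  obtain ⟨-, B, hB⟩ := h.attached first hfirst
  obtain ⟨C, hC⟩ := hchild.snk_cell_of_src_attached hB
  have hadd : AddsStrand r n D.cell (D.onCreateCont caller (n + 1)).cell :=
    addsStrand_makeAttached hr h.shape.faithful h.represents hps
      (by simpa using ⟨hparent.snk_le, hparent.snk_last, A, hA⟩) [(caller, n + 1)]
  obtain ⟨hshape, hrep, hbags, hatt⟩ := Inv.extend (M := [⟨G, first, n, []⟩]) hr h hps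
    (by simpa using ⟨hparent.snk_le, hparent.snk_last, ⟨A, hA⟩, fun d hd =>
      (((List.pairwise_cons.1 hpw).1 d hd).cell_ne hr (h.shape.block d (by simp [hd]))
        hparent).symm⟩) (hps.rel hr (by simp)) ⟨A, hA⟩ (by simpa using ⟨C, hC⟩) hnew hkeep
  refine ⟨{ hshape with fut := fun t ht => ?_ }, hrep, hbags, hatt⟩
  obtain rfl | ht := ht
  · refine ⟨t.le_succ, ⟨C, (hadd.old t le_rfl).trans hC⟩,
      hchild.snk_last.of_keepsSet t.le_succ (hadd.keepsSet le_rfl),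
      List.forall_mem_cons.2 ⟨t.lt_succ_self.ne, fun d hd => ?_⟩⟩
    exact ((hbelow d (by simp [hd])).snk_lt_snk hr hchild).ne'
  · exact hshape.fut t ht

theorem onGet (hr : StrandOrder r) (h : Inv r n (⟨F, s, n, []⟩ :: L) fut att bag D) {t : ℕ}
    (ht : t ∈ fut) (hps : ImmediatePreds r (n + 1) [n, t]) (hnew : bag' (n + 1) = F)
    (hkeep : ∀ d ∈ L, ∀ x ≤ n, bag x = d.fn → bag' x = d.fn) :
    Inv r (n + 1) (⟨F, s, n + 1, []⟩ :: L) fut att bag' (D.onGet n t (n + 1)) := by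
  obtain ⟨h', hn⟩ := h.attachify_head hr
  have hhead := h'.shape.block _ List.mem_cons_self
  obtain ⟨htn, hA, hlast, -⟩ := h'.shape.fut t ht
  have hhead_ne : ∀ d ∈ L, _ := fun d hd =>
    (((List.pairwise_cons.1 h'.shape.order).1 d hd).cell_ne hr (h'.shape.block d (by simp [hd]))
      hhead).symm
  have ht_ne : ∀ d ∈ L, _ := fun d hd =>
    h'.shape.cell_ne_of_mem_fut hr ht (List.mem_cons_of_mem _ hd)
  exact h'.extend (M := []) hr hps (by simp only [List.forall_mem_cons]; exact
    ⟨⟨le_rfl, hhead.snk_last, hn, hhead_ne⟩, ⟨htn, hlast, hA, ht_ne⟩, by simp⟩)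
    (hps.rel hr (by simp)) hn (by simp) hnew hkeep

end DNSP.Inv

/-! ## The bags of `D_SP` -/

/-- The invariant of `D_SP` after the strands up to `n` and the function instances below `N` have
begun, where `L` lists the blocks that have not been completed. The bags of the running functions
are those of kind `S`, and the strands of a bag precede the sink of a block of its function. -/
structure Bags (r : ℕ → ℕ → Prop) (n N : ℕ) (L : List Block) (sp : DSP) : Prop where
  find_lt : ∀ x ≤ n, sp.find x < N
  fn_lt : ∀ e ∈ L, e.fn < N
  kind_iff : ∀ e ∈ L, sp.kind e.fn = .S ↔ e.exits ≠ [] ∨ e.snk = n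
  exists_block : ∀ x ≤ n, (sp.kind (sp.find x) = .S ∨ ∃ e ∈ L, e.fn = sp.find x) →
    ∃ e ∈ L, e.fn = sp.find x ∧ r x e.snk
  eq_of_fn_eq : ∀ e ∈ L, ∀ d ∈ L, e.fn = d.fn → sp.kind e.fn ≠ .S → e = d

namespace Bags

variable {r : ℕ → ℕ → Prop} {n N : ℕ} {L : List Block} {sp : DSP} {F G s s₁ s₂ t first caller : ℕ}

theorem call (hr : StrandOrder r) (h : Bags r n N (⟨F, s, n, []⟩ :: L) sp)
    (hlt : ∀ d ∈ L, d.snk < n) :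
    Bags r (n + 1) (N + 1) (⟨N, n + 1, n + 1, []⟩ :: ⟨F, s, n, [n + 1]⟩ :: L)
      (sp.makeS N (n + 1)) := by
  obtain ⟨find_lt, fn_lt, kind_iff, exists_block, eq_of_fn_eq⟩ := h
  have hrefl := hr.refl
  constructor <;>
    simp only [DSP.makeS, List.forall_mem_cons, List.exists_mem_cons_iff,
      Function.update_apply] at * <;>
    grind

theorem retSpawn (hr : StrandOrder r)
    (h : Bags r n N (⟨G, first, n, []⟩ :: ⟨F, s, caller, [first]⟩ :: L) sp)
    (hlt : ∀ d ∈ L, d.snk < n) (hFG : F ≠ G) (hG : ∀ d ∈ L, d.fn ≠ G) :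
    Bags r (n + 1) N (⟨F, n + 1, n + 1, []⟩ :: ⟨G, first, n, []⟩ ::
      ⟨F, s, caller, [first, n + 1]⟩ :: L) ((sp.toP G).add F (n + 1)) := by
  obtain ⟨find_lt, fn_lt, kind_iff, exists_block, eq_of_fn_eq⟩ := h
  have hrefl := hr.refl
  constructor <;>
    simp only [DSP.toP, DSP.add, List.forall_mem_cons, List.exists_mem_cons_iff,
      Function.update_apply] at * <;>
    grind

theorem retCreate (hr : StrandOrder r)
    (h : Bags r n N (⟨G, first, n, []⟩ :: ⟨F, s, caller, [first]⟩ :: L) sp)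
    (hlt : ∀ d ∈ L, d.snk < n) (hFG : F ≠ G) (hG : ∀ d ∈ L, d.fn ≠ G)
    (hcaller : r caller (n + 1)) :
    Bags r (n + 1) N (⟨F, s, n + 1, []⟩ :: L) ((sp.toP G).add F (n + 1)) := by
  have hfwd : ∀ x, r x caller → r x (n + 1) := fun x hx => hr.trans hx hcaller
  have hrefl := hr.refl (n + 1)
  obtain ⟨find_lt, fn_lt, kind_iff, exists_block, eq_of_fn_eq⟩ := h
  constructor <;>
    simp only [DSP.toP, DSP.add, List.forall_mem_cons, List.exists_mem_cons_iff,
      Function.update_apply] at *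
  case exists_block =>
    intro x hx
    have := exists_block x
    rcases Nat.le_add_one_iff.1 hx with hx | rfl
    · specialize this hx
      specialize hfwd x
      grind
    · grind
  all_goals grind

theorem get (hr : StrandOrder r) (h : Bags r n N (⟨F, s, n, []⟩ :: L) sp)
    (hlt : ∀ d ∈ L, d.snk < n) (hn : r n (n + 1)) :
    Bags r (n + 1) N (⟨F, s, n + 1, []⟩ :: L) (sp.add F (n + 1)) := by
  have hfwd : ∀ x, r x n → r x (n + 1) := fun x hx => hr.trans hx hn
  have hrefl := hr.refl (n + 1)
  obtain ⟨find_lt, fn_lt, kind_iff, exists_block, eq_of_fn_eq⟩ := h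
  constructor <;>
    simp only [DSP.add, List.forall_mem_cons, List.exists_mem_cons_iff,
      Function.update_apply] at * <;>
    grind

theorem sync (hr : StrandOrder r)
    (h : Bags r n N (⟨F, s₂, n, []⟩ :: ⟨G, s₁, t, []⟩ :: ⟨F, s, caller, [s₁, s₂]⟩ :: L) sp)
    (hlt : ∀ d ∈ L, d.snk < t) (ht : t < n) (hn : r n (n + 1)) (ht' : r t (n + 1))
    (hcaller : r caller (n + 1)) :
    Bags r (n + 1) N (⟨F, s, n + 1, []⟩ :: L) ((sp.union F G).add F (n + 1)) := by
  have hfwd : ∀ x, (r x n ∨ r x t ∨ r x caller) → r x (n + 1) := by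
    rintro x (hx | hx | hx)
    exacts [hr.trans hx hn, hr.trans hx ht', hr.trans hx hcaller]
  have hrefl := hr.refl (n + 1)
  obtain ⟨find_lt, fn_lt, kind_iff, exists_block, eq_of_fn_eq⟩ := h
  constructor <;>
    simp only [DSP.add, DSP.union, relabel, List.forall_mem_cons, List.exists_mem_cons_iff,
      Function.update_apply] at *
  case exists_block =>
    intro x hx
    have := exists_block x
    rcases Nat.le_add_one_iff.1 hx with hx | rfl
    · specialize this hx
      specialize hfwd x
      grind
    · grind
  all_goals grind

end Bags

section

variable {Loc : Type*} {r : ℕ → ℕ → Prop} {n N F s u A : ℕ} {L : List Block} {fut att : Set ℕ}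
  {bag : ℕ → ℕ} {sp : DSP}

theorem Shape.pairwise_snk (hr : StrandOrder r) {c : ℕ → Cell} (h : Shape r n L fut c) :
    L.Pairwise fun e d => d.snk < e.snk :=
  h.order.imp_of_mem fun he _ hbelow => hbelow.snk_lt_snk hr (h.block _ he)

theorem DNSP.Inv.rel_cur_iff (hr : StrandOrder r) {D : DNSP}
    (h : D.Inv r n (⟨F, s, n, []⟩ :: L) fut att bag) (hu : u ≤ n) (hA : A ∈ D.succOf u) :
    r u n ↔ A = D.predOf n ∨ (A, D.predOf n) ∈ D.R := by
  have hcur := h.shape.block _ List.mem_cons_self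
  obtain ⟨B, hB⟩ := Option.isSome_iff_exists.1 hcur.live
  rw [succOf_eq] at hA
  rw [predOf_eq hB, h.shape.faithful.rel_iff_of_isLast hr hu le_rfl hcur.snk_last hA hB,
    h.represents.rel_iff hr (h.shape.faithful.succ_label hu hA)
      (h.shape.faithful.pred_label le_rfl hB)]

theorem Bags.rel_cur (hr : StrandOrder r) {c : ℕ → Cell} (h : Bags r n N (⟨F, s, n, []⟩ :: L) sp)
    (hshape : Shape r n (⟨F, s, n, []⟩ :: L) fut c) (hu : u ≤ n)
    (hS : sp.kind (sp.find u) = .S) : r u n := by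
  obtain ⟨e, he, hfn, hue⟩ := h.exists_block u hu (.inl hS)
  have hactive := (h.kind_iff e he).1 (hfn ▸ hS)
  obtain rfl | he := List.mem_cons.1 he
  · exact hue
  · have hexits := hactive.resolve_right ((List.pairwise_cons.1 (hshape.pairwise_snk hr)).1 e he).ne
    have hcur := (hshape.block _ List.mem_cons_self).rel
    exact hr.trans hue (hr.trans (((List.pairwise_cons.1 hshape.order).1 e he).2 hexits) hcur)

/-- An open unattached set lies in the bag of the block that it ends. If this bag is a `P`-bag, then
the block has no exits, so that no path leaves the set. -/
theorem Bags.not_rel_cur (hr : StrandOrder r) {D : DNSP}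
    (h : Bags r n N (⟨F, s, n, []⟩ :: L) sp)
    (hD : D.Inv r n (⟨F, s, n, []⟩ :: L) fut att sp.find) (hu : u ≤ n)
    (hP : sp.kind (sp.find u) ≠ .S) (hsucc : D.succOf u = none) : ¬ r u n := by
  rw [DNSP.succOf_eq] at hsucc
  obtain ⟨U, P, hU⟩ : ∃ U P, D.cell u = .opened U P := by
    rcases hcu : D.cell u <;> simp_all [Cell.succ]
  obtain ⟨e, he, hue⟩ := hD.shape.opened_mem u hu U P hU
  have hbag := hD.setsInBags e he u hu U P hU (hue.symm.trans hU)
  obtain ⟨hexits, hsnk⟩ : e.exits = [] ∧ e.snk ≠ n := by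
    simpa [hbag, h.kind_iff e he] using hP
  obtain rfl | he' := List.mem_cons.1 he
  · exact absurd rfl hsnk
  have hcur := hD.shape.block _ List.mem_cons_self
  intro hun
  obtain hn | ⟨x, hx, -⟩ := (hD.shape.block e he).out u hu n le_rfl hcur.live hue hun
  · exact ((List.pairwise_cons.1 hD.shape.order).1 e he').cell_ne hr (hD.shape.block e he) hcur
      hn.symm
  · simp [hexits] at hx

theorem Detector.query_iff (hr : StrandOrder r) {D : Detector Loc}
    (hD : D.nsp.Inv r n (⟨F, s, n, []⟩ :: L) fut att D.sp.find)
    (hbags : Bags r n N (⟨F, s, n, []⟩ :: L) D.sp) (hu : u ≤ n) :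
    D.query u n = true ↔ r u n := by
  unfold query
  split_ifs with hS
  · exact iff_of_true rfl (hbags.rel_cur hr hD.shape hu hS)
  cases hA : D.nsp.succOf u with
  | none => exact iff_of_false Bool.false_ne_true (hbags.not_rel_cur hr hD hu hS hA)
  | some A => rw [hD.rel_cur_iff hr hu hA, decide_eq_true_iff]

end

/-! ## Reachability in the computation dag -/

/-- The first strand of the current block of a function instance with first strand `first`, where
`pending` are its unjoined children, the most recent one first. -/
def blockSrc (first : ℕ) (pending : List Fork) : ℕ :=
  pending.head?.elim first Fork.s₂

/-- The blocks that belong to the unjoined children `pending` of the function instance `F` with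
first strand `first`: for each child, its own block and the block of `F` that ends with the spawn of
the child. -/
def pendingBlocks (first F : ℕ) : List Fork → List Block
  | [] => []
  | k :: ks => ⟨k.child, k.s₁, k.t₁, []⟩ :: ⟨F, blockSrc first ks, k.f, [k.s₁, k.s₂]⟩ ::
      pendingBlocks first F ks

/-- The first strand of the function instance whose suspended ancestors are those on the stack. -/
def firstOf (stack : List Frame) : ℕ :=
  stack.head?.elim 0 Frame.first

/-- The blocks of the suspended function instances. -/
def stackBlocks : List Frame → List Block
  | [] => []
  | fr :: stack => ⟨fr.fn, blockSrc (firstOf stack) fr.pending, fr.caller, [fr.first]⟩ ::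
      (pendingBlocks (firstOf stack) fr.fn fr.pending ++ stackBlocks stack)

section

variable {Loc : Type*} {r : ℕ → ℕ → Prop}

namespace Exec

variable {E E' E'' Efull : Exec Loc} {i : Instr Loc} {u v : ℕ}

/-- The blocks other than the current one, the most recent one first. -/
def outerBlocks (E : Exec Loc) : List Block :=
  pendingBlocks (firstOf E.stack) E.fn E.pending ++ stackBlocks E.stack

/-- The blocks that have not been completed, the most recent one first. -/
def blocks (E : Exec Loc) : List Block :=
  ⟨E.fn, blockSrc (firstOf E.stack) E.pending, E.cur, []⟩ :: E.outerBlocks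

/-- The last strands of the completed futures. -/
def futures (E : Exec Loc) : Set ℕ :=
  {t | ∃ h, E.futureLast h = some t}

/-- The strands that issued the `create` of a running future, and the first strands of the running
futures. -/
def creates (E : Exec Loc) : Set ℕ :=
  {x | ∃ fr ∈ E.stack, fr.kind = .create ∧ (x = fr.caller ∨ x = fr.first)}

/-- The sources of the edges into the current strand. -/
def preds (E : Exec Loc) : List ℕ :=
  (E.edges.filter fun e => e.dst = E.cur).map Edge.src

/-- Reachability in the computation dag: the reflexive closure of `≺`. -/
def Reach (E : Exec Loc) : ℕ → ℕ → Prop :=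
  Relation.ReflTransGen fun a b => ∃ e ∈ E.edges, e.src = a ∧ e.dst = b

/-- The edges of the computation dag go forward to strands that have begun, and the strands that new
edges can leave have begun. -/
structure Forward (E : Exec Loc) : Prop where
  snk_le : ∀ e ∈ E.blocks, e.snk ≤ E.cur
  future_le : ∀ t ∈ E.futures, t ≤ E.cur
  edges : ∀ e ∈ E.edges, e.src < e.dst ∧ e.dst ≤ E.cur

/-- The state `E'` is later than `E`: all additional edges lead to later strands. -/
structure Extends (E E' : Exec Loc) : Prop where
  cur_le : E.cur ≤ E'.cur
  subset : E.edges ⊆ E'.edges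
  lt_dst : ∀ e ∈ E'.edges, e ∈ E.edges ∨ E.cur < e.dst

theorem Extends.refl (E : Exec Loc) : E.Extends E :=
  ⟨le_rfl, List.Subset.refl _, fun _ => .inl⟩

theorem Extends.trans (h : E.Extends E') (h' : E'.Extends E'') : E.Extends E'' where
  cur_le := h.cur_le.trans h'.cur_le
  subset := List.Subset.trans h.subset h'.subset
  lt_dst e he := (h'.lt_dst e he).elim (h.lt_dst e) fun hlt => .inr (h.cur_le.trans_lt hlt)

theorem Extends.step (h : E.step i = some E') : E.Extends E' := by
  revert h
  fun_cases Exec.step E i <;> rintro ⟨⟩ <;> constructor <;> grind [call]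

theorem Extends.immediatePreds (h : E.Extends Efull) :
    ImmediatePreds Efull.Reach E.cur E.preds := fun x => by
  constructor
  · intro hx
    obtain hx | ⟨y, hxy, e, he, rfl, hdst⟩ := Relation.ReflTransGen.cases_tail hx
    · exact .inl hx.symm
    · have heE : e ∈ E.edges := (h.lt_dst e he).resolve_right hdst.not_gt
      exact .inr ⟨e.src, List.mem_map_of_mem (by simp [heE, hdst]), hxy⟩
  · rintro (rfl | ⟨p, hp, hxp⟩)
    · exact .refl
    · obtain ⟨e, he, rfl⟩ := List.mem_map.1 hp
      obtain ⟨heE, hdst⟩ := List.mem_filter.1 he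
      exact .tail hxp ⟨e, h.subset heE, rfl, by simpa using hdst⟩

theorem Forward.init : (init : Exec Loc).Forward := by
  constructor <;> simp [blocks, outerBlocks, futures, pendingBlocks, stackBlocks, Exec.init]

theorem Forward.step (hE : E.Forward) (h : E.step i = some E') : E'.Forward := by
  obtain ⟨snk_le, future_le, edges⟩ := hE
  revert h
  fun_cases Exec.step E i <;> rintro ⟨⟩ <;> constructor <;>
    simp_all [blocks, outerBlocks, pendingBlocks, stackBlocks, futures, call, or_imp,
      forall_and] <;> grind

theorem Forward.strandOrder (h : E.Forward) : StrandOrder E.Reach where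
  refl _ := .refl
  trans := .trans
  le hxy := by
    induction hxy with
    | refl => exact le_rfl
    | tail _ he ih =>
      obtain ⟨e, he, rfl, rfl⟩ := he
      exact ih.trans (h.edges e he).1.le

theorem Forward.immediatePreds (hE : E.Forward) (h : ImmediatePreds r E'.cur E'.preds)
    {new : List Edge} (hcur : E'.cur = E.cur + 1) (hedges : E'.edges = new ++ E.edges)
    (hnew : ∀ e ∈ new, e.dst = E.cur + 1) : ImmediatePreds r (E.cur + 1) (new.map Edge.src) := by
  have hold : E.edges.filter (fun e => e.dst = E.cur + 1) = [] := by
    simpa using fun e he => ((hE.edges e he).2.trans_lt (Nat.lt_succ_self _)).ne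
  rwa [preds, hcur, hedges, List.filter_append, hold, List.append_nil,
    List.filter_eq_self.2 (by simpa using hnew)] at h

theorem precedes_iff_reach (hne : u ≠ v) : E.Precedes u v ↔ E.Reach u v := by
  rw [Reach, Relation.reflTransGen_iff_eq_or_transGen]
  simp [Precedes, hne.symm]

theorem parallel_iff : E.Parallel u v ↔ ¬ E.Reach u v ∧ ¬ E.Reach v u := by
  obtain rfl | hne := eq_or_ne u v
  · simp [Parallel, Reach, Relation.ReflTransGen.refl]
  · simp [Parallel, precedes_iff_reach hne, precedes_iff_reach hne.symm, hne]

end Exec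

end

section

variable {r : ℕ → ℕ → Prop} {n N F G s s₁ s₂ t caller : ℕ} {L : List Block} {fut att : Set ℕ}
  {bag bag' : ℕ → ℕ} {sp : DSP}

theorem Shape.init (hr : StrandOrder r) {c : ℕ → Cell} (hc : c 0 = .attached 0) :
    Shape r 0 [⟨0, 0, 0, []⟩] ∅ c where
  faithful := by
    constructor <;> intros <;> simp_all [Cell.succ, Cell.pred]
  block := by
    rw [List.forall_mem_singleton]
    constructor <;> simp_all [hr.refl, IsFirst, IsLast]
  order := List.pairwise_singleton ..
  opened_mem := by simp [hc]
  fut := by simp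

theorem Shape.join {c : ℕ → Cell}
    (h : Shape r n (⟨F, s₂, n, []⟩ :: ⟨G, s₁, t, []⟩ :: ⟨F, s, caller, [s₁, s₂]⟩ :: L) fut c)
    (ht : t < n) (hps : ImmediatePreds r (n + 1) [n, t]) :
    Join r n c ⟨G, s₁, t, []⟩ ⟨F, s₂, n, []⟩ ⟨F, s, caller, [s₁, s₂]⟩ where
  inv_a := h.block _ (by simp)
  inv_b := h.block _ (by simp)
  inv_f := h.block _ (by simp)
  exits_a := rfl
  exits_b := rfl
  exits_f := by simp
  lt_a := ((List.pairwise_cons.1 (List.pairwise_cons.1 h.order).2).1 _ (by simp)).1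
  lt_b := ((List.pairwise_cons.1 h.order).1 _ (by simp)).1
  snk_ne := ht.ne
  preds x := by simpa [or_comm] using hps x

theorem Bags.joinsBags (h : Bags r n N
      (⟨F, s₂, n, []⟩ :: ⟨G, s₁, t, []⟩ :: ⟨F, s, caller, [s₁, s₂]⟩ :: L) sp)
    (hlt : ∀ d ∈ L, d.snk < t) (ht : t < n) :
    DNSP.JoinsBags n L sp.find ((sp.union F G).add F (n + 1)).find ⟨G, s₁, t, []⟩ ⟨F, s₂, n, []⟩
      ⟨F, s, caller, [s₁, s₂]⟩ := by
  have hG : ∀ d ∈ L, d.fn ≠ G := fun d hd hdG => by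
    have hP : sp.kind G ≠ .S := by simpa [ht.ne] using (h.kind_iff ⟨G, s₁, t, []⟩ (by simp)).not
    have heq := h.eq_of_fn_eq ⟨G, s₁, t, []⟩ (by simp) d (by simp [hd]) hdG.symm hP
    exact (hlt d hd).ne (heq ▸ rfl)
  constructor <;>
    simp only [DSP.add, DSP.union, relabel, Function.update_apply] <;>
    grind

theorem DNSP.Inv.sync (hr : StrandOrder r) {D : DNSP}
    (h : D.Inv r n (⟨F, s₂, n, []⟩ :: ⟨G, s₁, t, []⟩ :: ⟨F, s, caller, [s₁, s₂]⟩ :: L) fut att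
      sp.find)
    (hbags : Bags r n N (⟨F, s₂, n, []⟩ :: ⟨G, s₁, t, []⟩ :: ⟨F, s, caller, [s₁, s₂]⟩ :: L) sp)
    (hps : ImmediatePreds r (n + 1) [n, t]) :
    (D.onSync caller s₁ t s₂ n (n + 1)).Inv r (n + 1) (⟨F, s, n + 1, []⟩ :: L) fut att
        ((sp.union F G).add F (n + 1)).find ∧
      Bags r (n + 1) N (⟨F, s, n + 1, []⟩ :: L) ((sp.union F G).add F (n + 1)) := by
  have hsnk := h.shape.pairwise_snk hr
  simp only [List.pairwise_cons, List.forall_mem_cons] at hsnk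
  obtain ⟨⟨ht, -, -⟩, ⟨-, hlt⟩, -⟩ := hsnk
  have hbelow := (List.pairwise_cons.1 h.shape.order).1 ⟨F, s, caller, [s₁, s₂]⟩ (by simp)
  have hcur := h.shape.block _ List.mem_cons_self
  have hn : r n (n + 1) := hps.rel hr (by simp)
  have hcaller : r caller (n + 1) := hr.trans (hbelow.2 (by simp)) (hr.trans hcur.rel hn)
  exact ⟨DNSP.Inv.onSync (M := [⟨F, s₂, n, []⟩, ⟨G, s₁, t, []⟩]) hr h (by simp [or_comm])
    (h.shape.join ht hps) rfl (hbags.joinsBags hlt ht),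
    hbags.sync hr hlt ht hn (hps.rel hr (by simp)) hcaller⟩

end

section

variable {Loc : Type*} {r : ℕ → ℕ → Prop}

theorem update_succ_of_le {f : ℕ → ℕ} {n x a : ℕ} (hx : x ≤ n) :
    Function.update f (n + 1) a x = f x :=
  Function.update_of_ne (by omega) ..

theorem fn_eq_of_mem_pendingBlocks {first F : ℕ} {pending : List Fork} {e : Block}
    (he : e ∈ pendingBlocks first F pending) (hexits : e.exits ≠ []) : e.fn = F := by
  induction pending with
  | nil => simp [pendingBlocks] at he
  | cons k ks ih => grind [pendingBlocks]

theorem fn_mem_of_mem_stackBlocks {stack : List Frame} {e : Block} (he : e ∈ stackBlocks stack)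
    (hexits : e.exits ≠ []) : e.fn ∈ stack.map Frame.fn := by
  induction stack with
  | nil => simp [stackBlocks] at he
  | cons fr stack ih => grind [stackBlocks, fn_eq_of_mem_pendingBlocks]

theorem exists_mem_stackBlocks {stack : List Frame} {F : ℕ} (hF : F ∈ stack.map Frame.fn) :
    ∃ e ∈ stackBlocks stack, e.fn = F := by
  induction stack with
  | nil => simp at hF
  | cons fr stack ih =>
    simp only [List.map_cons, List.mem_cons] at hF
    simp only [stackBlocks, List.exists_mem_cons_iff, List.mem_append]
    grind

namespace Detector

/-- The invariant of the reachability structures in the state `E` of the execution. -/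
structure Inv (r : ℕ → ℕ → Prop) (E : Exec Loc) (sp : DSP) (nsp : DNSP) : Prop where
  nsp : nsp.Inv r E.cur E.blocks E.futures E.creates sp.find
  bags : Bags r E.cur E.numFns E.blocks sp
  nodup : (E.fn :: E.stack.map Frame.fn).Nodup

namespace Inv

variable {E E' : Exec Loc} {sp : DSP} {nsp : DNSP} {D : Detector Loc} {i : Instr Loc} {fr : Frame}
  {stack : List Frame} {k : Fork} {pending : List Fork} {edges : List Edge}

theorem init (hr : StrandOrder r) :
    Inv r (Exec.init : Exec Loc) (Detector.init : Detector Loc).sp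
      (Detector.init : Detector Loc).nsp where
  nsp := {
    shape := by
      have hfut : (Exec.init : Exec Loc).futures = ∅ := by simp [Exec.futures, Exec.init]
      exact hfut ▸ Shape.init hr rfl
    represents :=
      { find_le := fun _ => id
        sound := by simp [DNSP.ArcsSound, Detector.init]
        complete := fun hA hB _ _ _ => .inl (by simp_all [Exec.init]) }
    setsInBags := by
      simp [SetsInBags, Exec.blocks, Exec.outerBlocks, stackBlocks, pendingBlocks, Exec.init,
        Detector.init, DNSP.cell, DNSP.setCell]
    attached := by simp [Exec.creates, Exec.init] }
  bags := by
    constructor <;>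
      simp [Exec.blocks, Exec.outerBlocks, stackBlocks, pendingBlocks, Exec.init, Detector.init,
        hr.refl]
  nodup := by simp [Exec.init]

theorem snk_lt (hr : StrandOrder r) (h : Inv r E sp nsp) : ∀ d ∈ E.outerBlocks, d.snk < E.cur :=
  (List.pairwise_cons.1 (h.nsp.shape.pairwise_snk hr)).1

theorem numFns_notMem (h : Inv r E sp nsp) : E.numFns ∉ E.fn :: E.stack.map Frame.fn := by
  intro hmem
  obtain ⟨e, he, hfn⟩ : ∃ e ∈ E.blocks, e.fn = E.numFns := by
    obtain hfn | hfn := List.mem_cons.1 hmem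
    · exact ⟨_, List.mem_cons_self, hfn.symm⟩
    · obtain ⟨e, he, hfn⟩ := exists_mem_stackBlocks hfn
      exact ⟨e, by simp [Exec.blocks, Exec.outerBlocks, he], hfn⟩
  exact (h.bags.fn_lt e he).ne hfn

theorem fn_ne (hr : StrandOrder r) (h : Inv r E sp nsp) (hp : E.pending = []) :
    ∀ d ∈ E.outerBlocks, d.fn ≠ E.fn := fun d hd hfn => by
  have hS : sp.kind E.fn = .S := (h.bags.kind_iff _ List.mem_cons_self).2 (.inr rfl)
  have hexits : d.exits ≠ [] :=
    ((h.bags.kind_iff d (List.mem_cons_of_mem _ hd)).1 (hfn ▸ hS)).resolve_right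
      (h.snk_lt hr d hd).ne
  have hd' : d ∈ stackBlocks E.stack := by simpa [Exec.outerBlocks, hp, pendingBlocks] using hd
  exact (List.nodup_cons.1 h.nodup).1 (hfn ▸ fn_mem_of_mem_stackBlocks hd' hexits)

theorem spawn (hr : StrandOrder r) (h : Inv r E sp nsp)
    (hps : ImmediatePreds r (E.cur + 1) [E.cur]) :
    Inv r (E.call .spawn .spawn) (sp.makeS E.numFns (E.cur + 1))
      (nsp.onSpawnEdge E.cur (E.cur + 1)) where
  nsp := (h.nsp.callSpawn hr hps (Function.update_self ..)
    fun _ _ _ hx => (update_succ_of_le hx).trans).mono (fun _ => id)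
      (by simp [Exec.creates, Exec.call])
  bags := h.bags.call hr (h.snk_lt hr)
  nodup := List.nodup_cons.2 ⟨h.numFns_notMem, h.nodup⟩

theorem create (hr : StrandOrder r) (h : Inv r E sp nsp)
    (hps : ImmediatePreds r (E.cur + 1) [E.cur]) :
    Inv r (E.call .create .create) (sp.makeS E.numFns (E.cur + 1))
      (nsp.onCreate E.cur (E.cur + 1)) where
  nsp := (h.nsp.callCreate hr hps (Function.update_self ..)
    fun _ _ _ hx => (update_succ_of_le hx).trans).mono (fun _ => id) fun x hx => by
      simpa [Exec.creates, Exec.call, or_assoc] using hx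
  bags := h.bags.call hr (h.snk_lt hr)
  nodup := List.nodup_cons.2 ⟨h.numFns_notMem, h.nodup⟩

theorem retSpawn (hr : StrandOrder r) (h : Inv r E sp nsp) (hp : E.pending = [])
    (hs : E.stack = fr :: stack) (hps : ImmediatePreds r (E.cur + 1) [fr.caller]) :
    Inv r { E with
        cur := E.cur + 1
        fn := fr.fn
        pending := ⟨E.fn, fr.caller, fr.first, E.cur, E.cur + 1⟩ :: fr.pending
        stack := stack
        edges := edges }
      ((sp.toP E.fn).add fr.fn (E.cur + 1)) (nsp.onSpawnEdge fr.caller (E.cur + 1)) := by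
  have hfn := h.fn_ne hr hp
  have hlt := h.snk_lt hr
  obtain ⟨n, F, pending, stack, N, futureLast, edges, accesses⟩ := E
  obtain rfl := hp
  obtain rfl := hs
  obtain ⟨hfn, hfn'⟩ := List.forall_mem_cons.1 hfn
  obtain ⟨-, hlt⟩ := List.forall_mem_cons.1 hlt
  exact {
    nsp := (h.nsp.retSpawn hr hps (Function.update_self ..)
      fun _ _ _ hx => (update_succ_of_le hx).trans).mono (fun _ => id)
        fun x hx => hx.imp fun _ => .imp_left (List.mem_cons_of_mem _)
    bags := h.bags.retSpawn hr hlt hfn hfn'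
    nodup := (List.nodup_cons.1 h.nodup).2 }

theorem retCreate (hr : StrandOrder r) (h : Inv r E sp nsp) (hp : E.pending = [])
    (hs : E.stack = fr :: stack) (hk : fr.kind = .create)
    (hps : ImmediatePreds r (E.cur + 1) [fr.caller]) :
    Inv r { E with
        cur := E.cur + 1
        fn := fr.fn
        pending := fr.pending
        stack := stack
        futureLast := Function.update E.futureLast E.fn (some E.cur)
        edges := edges }
      ((sp.toP E.fn).add fr.fn (E.cur + 1)) (nsp.onCreateCont fr.caller (E.cur + 1)) := by
  have hfn := h.fn_ne hr hp
  have hlt := h.snk_lt hr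
  obtain ⟨n, F, pending, stack, N, futureLast, edges, accesses⟩ := E
  obtain rfl := hp
  obtain rfl := hs
  obtain ⟨hfn, hfn'⟩ := List.forall_mem_cons.1 hfn
  obtain ⟨-, hlt⟩ := List.forall_mem_cons.1 hlt
  exact {
    nsp := (h.nsp.retCreate hr hps ⟨fr, List.mem_cons_self, hk, .inl rfl⟩
      ⟨fr, List.mem_cons_self, hk, .inr rfl⟩ (Function.update_self ..)
      fun _ _ _ hx => (update_succ_of_le hx).trans).mono
        (fun t ⟨g, (hg : Function.update futureLast F (some n) g = some t)⟩ => by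
          rw [Function.update_apply] at hg
          split_ifs at hg
          · exact .inl (Option.some_injective _ hg).symm
          · exact .inr ⟨g, hg⟩)
        fun x hx => hx.imp fun _ => .imp_left (List.mem_cons_of_mem _)
    bags := h.bags.retCreate hr hlt hfn hfn' (hps.rel hr (List.mem_singleton_self _))
    nodup := (List.nodup_cons.1 h.nodup).2 }

theorem sync (hr : StrandOrder r) (h : Inv r E sp nsp) (hp : E.pending = k :: pending)
    (hps : ImmediatePreds r (E.cur + 1) [E.cur, k.t₁]) :
    Inv r { E with cur := E.cur + 1, pending := pending, edges := edges }
      ((sp.union E.fn k.child).add E.fn (E.cur + 1))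
      (nsp.onSync k.f k.s₁ k.t₁ k.s₂ E.cur (E.cur + 1)) := by
  obtain ⟨n, F, pending, stack, N, futureLast, edges, accesses⟩ := E
  obtain rfl := hp
  obtain ⟨hnsp, hbags⟩ := h.nsp.sync hr h.bags hps
  exact ⟨hnsp, hbags, h.nodup⟩

theorem get (hr : StrandOrder r) (h : Inv r E sp nsp) {t : ℕ} (ht : t ∈ E.futures)
    (hps : ImmediatePreds r (E.cur + 1) [E.cur, t]) :
    Inv r { E with cur := E.cur + 1, edges := edges } (sp.add E.fn (E.cur + 1))
      (nsp.onGet E.cur t (E.cur + 1)) where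
  nsp := h.nsp.onGet hr ht hps (Function.update_self ..)
    fun _ _ _ hx => (update_succ_of_le hx).trans
  bags := h.bags.get hr (h.snk_lt hr) (hps.rel hr List.mem_cons_self)
  nodup := h.nodup

theorem step [DecidableEq Loc] (hr : StrandOrder r) (h : Inv r E D.sp D.nsp) (hF : E.Forward)
    (hE : E.step i = some E') (hps : ImmediatePreds r E'.cur E'.preds) :
    Inv r E' (D.step E i).sp (D.step E i).nsp := by
  revert hE
  fun_cases Exec.step E i <;> rintro ⟨⟩
  · exact ⟨h.nsp, h.bags, h.nodup⟩
  · exact ⟨h.nsp, h.bags, h.nodup⟩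
  · exact h.spawn hr (hF.immediatePreds hps (new := [_]) rfl rfl (by simp))
  · exact h.create hr (hF.immediatePreds hps (new := [_]) rfl rfl (by simp))
  · simp only [Detector.step, *]
    exact h.retSpawn hr ‹_› ‹_› (hF.immediatePreds hps (new := [_]) rfl rfl (by simp))
  · simp only [Detector.step, *]
    exact h.retCreate hr ‹_› ‹_› ‹_› (hF.immediatePreds hps (new := [_]) rfl rfl (by simp))
  · simp only [Detector.step, *]
    exact h.sync hr ‹_› (hF.immediatePreds hps (new := [_, _]) rfl rfl (by simp))
  · simp only [Detector.step, *]
    exact h.get hr ⟨_, ‹_›⟩ (hF.immediatePreds hps (new := [_, _]) rfl rfl (by simp))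

end Inv

end Detector

end

/-! ## Races -/

section

variable {Loc : Type*} {r : ℕ → ℕ → Prop} {n : ℕ} {as : List (Access Loc)}

theorem Conflict.cons {l : Loc} {u v : ℕ} (h : Conflict as l u v) (a : Access Loc) :
    Conflict (a :: as) l u v :=
  let ⟨b, hb, c, hc, h⟩ := h
  ⟨b, List.mem_cons_of_mem a hb, c, List.mem_cons_of_mem a hc, h⟩

namespace Detector

variable {D D' : Detector Loc} {l : Loc} {us : List ℕ} {u : ℕ} {w : Bool}

theorem mem_check {v : ℕ} {ρ : Race Loc} :
    ρ ∈ D.check l v us ↔ ∃ u ∈ us, D.query u v = false ∧ ρ = ⟨l, u, v⟩ := by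
  simp [check, and_assoc, eq_comm (b := ρ)]

/-- The access history and the reported races after the accesses `as`, the most recent one first, by
the strands up to `n`. As long as no race on a location has been reported, the stored strands that
accessed it cover all the others (`covered`), and conflicting accesses to it are ordered
(`ordered`). -/
structure History (r : ℕ → ℕ → Prop) (n : ℕ) (as : List (Access Loc)) (D : Detector Loc) :
    Prop where
  access_le : ∀ a ∈ as, a.strand ≤ n
  writer : ∀ l, ∀ u ∈ D.lastWriter l, ⟨u, l, true⟩ ∈ as
  reader : ∀ l, ∀ u ∈ D.readers l, ⟨u, l, false⟩ ∈ as
  races : ∀ ρ ∈ D.races, Conflict as ρ.loc ρ.fst ρ.snd ∧ ¬ r ρ.fst ρ.snd ∧ ¬ r ρ.snd ρ.fst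
  covered : ∀ l, (∀ ρ ∈ D.races, ρ.loc ≠ l) → ∀ a ∈ as, a.loc = l →
    (∃ u ∈ D.lastWriter l, r a.strand u) ∨ a.isWrite = false ∧ a.strand ∈ D.readers l
  ordered : ∀ l, (∀ ρ ∈ D.races, ρ.loc ≠ l) → as.Pairwise fun b a => b.loc = l → a.loc = l →
    (a.isWrite = true ∨ b.isWrite = true) → r a.strand b.strand

namespace History

theorem init : History r 0 [] (Detector.init : Detector Loc) := by
  constructor <;> simp [Detector.init]

theorem mono {n' : ℕ} (h : History r n as D) (hn : n ≤ n') (hwriter : D'.lastWriter = D.lastWriter)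
    (hreaders : D'.readers = D.readers) (hraces : D'.races = D.races) : History r n' as D' := by
  obtain ⟨access_le, writer, reader, races, covered, ordered⟩ := h
  exact ⟨fun a ha => (access_le a ha).trans hn, by rwa [hwriter], by rwa [hreaders],
    by rwa [hraces], by rwa [hwriter, hreaders, hraces], by rwa [hraces]⟩

theorem races_access (hr : StrandOrder r) (h : History r n as D)
    (hquery : ∀ u ≤ n, D.query u n = true ↔ r u n)
    (hus : ∀ u ∈ us, ∃ b, ⟨u, l, b⟩ ∈ as ∧ (b = true ∨ w = true)) :
    ∀ ρ ∈ D.check l n us ++ D.races,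
      Conflict (⟨n, l, w⟩ :: as) ρ.loc ρ.fst ρ.snd ∧ ¬ r ρ.fst ρ.snd ∧ ¬ r ρ.snd ρ.fst := by
  intro ρ hρ
  obtain hρ | hρ := List.mem_append.1 hρ
  · obtain ⟨u, hu, hno, rfl⟩ := mem_check.1 hρ
    obtain ⟨b, hb, hwrite⟩ := hus u hu
    have hun : u ≤ n := h.access_le _ hb
    have hpar : ¬ r u n := fun hrel => by simp [(hquery u hun).2 hrel] at hno
    exact ⟨⟨⟨u, l, b⟩, List.mem_cons_of_mem _ hb, ⟨n, l, w⟩, List.mem_cons_self, rfl, rfl, rfl, rfl,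
      hwrite⟩, hpar, fun hrel => hpar ((hun.antisymm (hr.le hrel)).symm ▸ hr.refl u)⟩
  · exact ⟨(h.races ρ hρ).1.cons _, (h.races ρ hρ).2⟩

theorem rel_of_raceless (hquery : ∀ u ≤ n, D.query u n = true ↔ r u n)
    (hl : ∀ ρ ∈ D.check l n us ++ D.races, ρ.loc ≠ l) (hu : u ∈ us) (hun : u ≤ n) : r u n := by
  rw [← hquery u hun]
  by_contra hno
  exact hl ⟨l, u, n⟩ (List.mem_append_left _ (mem_check.2 ⟨u, hu, by simpa using hno, rfl⟩)) rfl

theorem rel_of_covered (hr : StrandOrder r) (h : History r n as D)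
    (hquery : ∀ u ≤ n, D.query u n = true ↔ r u n)
    (hl : ∀ ρ ∈ D.check l n us ++ D.races, ρ.loc ≠ l) (hwriter : ∀ u ∈ D.lastWriter l, u ∈ us)
    {a : Access Loc} (ha : a ∈ as) (hal : a.loc = l)
    (hreader : a.isWrite = false → ∀ u ∈ D.readers l, u ∈ us) : r a.strand n := by
  obtain ⟨u, hu, hau⟩ | ⟨hread, hmem⟩ :=
    h.covered l (fun ρ hρ => hl ρ (List.mem_append_right _ hρ)) a ha hal
  · exact hr.trans hau (rel_of_raceless hquery hl (hwriter u hu) (h.access_le _ (h.writer l u hu)))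
  · exact rel_of_raceless hquery hl (hreader hread _ hmem) (h.access_le a ha)

theorem rel_or_rel (hr : StrandOrder r) (h : History r n as D) (hl : ∀ ρ ∈ D.races, ρ.loc ≠ l)
    {v : ℕ} (huv : Conflict as l u v) : r u v ∨ r v u := by
  obtain ⟨a, ha, b, hb, hal, hbl, rfl, rfl, hwrite⟩ := huv
  let R (a b : Access Loc) : Prop := a.loc = l → b.loc = l →
    (a.isWrite = true ∨ b.isWrite = true) → r a.strand b.strand ∨ r b.strand a.strand
  have : Std.Symm R := ⟨fun _ _ h hb ha hwrite => (h ha hb hwrite.symm).symm⟩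
  have hR : as.Pairwise R :=
    (h.ordered l hl).imp fun h ha hb hwrite => .inr (h ha hb hwrite.symm)
  exact hR.forall_of_forall (fun _ _ _ _ _ => .inl (hr.refl _)) ha hb hal hbl hwrite

variable [DecidableEq Loc] {E E' : Exec Loc} {i : Instr Loc}

theorem read (hr : StrandOrder r) (h : History r E.cur as D)
    (hquery : ∀ u ≤ E.cur, D.query u E.cur = true ↔ r u E.cur) (l : Loc) :
    History r E.cur (⟨E.cur, l, false⟩ :: as) (D.step E (.read l)) := by
  have hold {l'} (hl' : ∀ ρ ∈ (D.step E (.read l)).races, ρ.loc ≠ l') : ∀ ρ ∈ D.races, ρ.loc ≠ l' :=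
    fun ρ hρ => hl' ρ (List.mem_append_right _ hρ)
  refine
    { access_le := by simpa using h.access_le
      writer := fun l' u hu => List.mem_cons_of_mem _ (h.writer l' u hu)
      reader := fun l' u hu => ?_
      races := h.races_access hr hquery fun u hu =>
        ⟨true, h.writer l u (Option.mem_toList.1 hu), .inl rfl⟩
      covered := fun l' hl' a ha hal => ?_
      ordered := fun l' hl' => List.pairwise_cons.2 ⟨?_, h.ordered l' (hold hl')⟩ }
  · have := h.reader l' u
    simp only [Detector.step, Function.update_apply] at hu
    grind
  · have := h.covered l' (hold hl') a
    simp only [Detector.step, Function.update_apply]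
    grind
  · rintro a ha rfl hal hwrite
    refine h.rel_of_covered hr hquery hl' (fun _ => Option.mem_toList.2) ha hal fun hread => ?_
    simp [hread] at hwrite

theorem write (hr : StrandOrder r) (h : History r E.cur as D)
    (hquery : ∀ u ≤ E.cur, D.query u E.cur = true ↔ r u E.cur) (l : Loc) :
    History r E.cur (⟨E.cur, l, true⟩ :: as) (D.step E (.write l)) := by
  have hold {l'} (hl' : ∀ ρ ∈ (D.step E (.write l)).races, ρ.loc ≠ l') :
      ∀ ρ ∈ D.races, ρ.loc ≠ l' := fun ρ hρ => hl' ρ (List.mem_append_right _ hρ)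
  have hnew (hl : ∀ ρ ∈ (D.step E (.write l)).races, ρ.loc ≠ l) :
      ∀ a ∈ as, a.loc = l → r a.strand E.cur := fun a ha hal =>
    h.rel_of_covered hr hquery hl (by simp +contextual) ha hal (by simp +contextual)
  refine
    { access_le := by simpa using h.access_le
      writer := fun l' u hu => ?_
      reader := fun l' u hu => ?_
      races := h.races_access hr hquery fun u hu => (List.mem_append.1 hu).elim
        (fun hu => ⟨true, h.writer l u (Option.mem_toList.1 hu), .inr rfl⟩)
        fun hu => ⟨false, h.reader l u hu, .inr rfl⟩
      covered := fun l' hl' a ha hal => ?_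
      ordered := fun l' hl' => List.pairwise_cons.2 ⟨?_, h.ordered l' (hold hl')⟩ }
  · have := h.writer l' u
    simp only [Detector.step, Function.update_apply] at hu
    grind
  · have := h.reader l' u
    simp only [Detector.step, Function.update_apply] at hu
    grind
  · have := h.covered l' (hold hl') a
    have := hr.refl E.cur
    simp only [Detector.step, Function.update_apply]
    grind
  · rintro a ha rfl hal -
    exact hnew hl' a ha hal

theorem step (hr : StrandOrder r) (h : History r E.cur E.accesses D)
    (hquery : ∀ u ≤ E.cur, D.query u E.cur = true ↔ r u E.cur) (hE : E.step i = some E') :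
    History r E'.cur E'.accesses (D.step E i) := by
  revert hE
  fun_cases Exec.step E i <;> rintro ⟨⟩
  · exact h.read hr hquery _
  · exact h.write hr hquery _
  all_goals refine h.mono (Nat.le_succ _) ?_ ?_ ?_ <;> simp only [Detector.step, *]

end History

end Detector

end

section

variable {Loc : Type*} {p q : List (Instr Loc)} {i : Instr Loc}

namespace Exec

variable {E E' : Exec Loc}

theorem run_concat : run (p ++ [i]) = some E' ↔ ∃ E, run p = some E ∧ E.step i = some E' := by
  simp [run, List.foldlM_append, Option.bind_eq_some_iff]

theorem Forward.run (h : run p = some E) : E.Forward := by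
  induction p using List.reverseRecOn generalizing E with
  | nil =>
    obtain rfl : Exec.init = E := Option.some_injective _ h
    exact .init
  | append_singleton p i ih =>
    obtain ⟨E, hE, hi⟩ := run_concat.1 h
    exact (ih hE).step hi

theorem Extends.run (hp : run p = some E) (hpq : run (p ++ q) = some E') : E.Extends E' := by
  induction q using List.reverseRecOn generalizing E' with
  | nil =>
    obtain rfl : E = E' := Option.some_injective _ (hp.symm.trans (by simpa using hpq))
    exact .refl E
  | append_singleton q i ih =>
    rw [← List.append_assoc] at hpq
    obtain ⟨E'', hE'', hi⟩ := run_concat.1 hpq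
    exact (ih hE'').trans (.step hi)

end Exec

namespace Detector

variable [DecidableEq Loc] {E E' Efull : Exec Loc} {D D' : Detector Loc}

theorem run_concat : run (p ++ [i]) = some (E', D') ↔
    ∃ E D, run p = some (E, D) ∧ E.step i = some E' ∧ D.step E i = D' := by
  simp [run, List.foldlM_append, Option.bind_eq_some_iff]

theorem exec_run (h : run p = some (E, D)) : Exec.run p = some E := by
  induction p using List.reverseRecOn generalizing E D with
  | nil =>
    obtain ⟨rfl, -⟩ := Prod.ext_iff.1 (Option.some_injective _ h)
    rfl
  | append_singleton p i ih =>
    obtain ⟨E, D, hp, hi, -⟩ := run_concat.1 h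
    exact Exec.run_concat.2 ⟨E, ih hp, hi⟩

theorem inv_history_of_run (hfull : Efull.Forward) (h : run p = some (E, D))
    (hext : E.Extends Efull) :
    Inv Efull.Reach E D.sp D.nsp ∧ History Efull.Reach E.cur E.accesses D := by
  have hr := hfull.strandOrder
  induction p using List.reverseRecOn generalizing E D with
  | nil =>
    obtain ⟨rfl, rfl⟩ := Prod.ext_iff.1 (Option.some_injective _ h)
    exact ⟨.init hr, .init⟩
  | append_singleton p i ih =>
    obtain ⟨E, D, hp, hi, rfl⟩ := run_concat.1 h
    obtain ⟨hinv, hhist⟩ := ih hp (.trans (.step hi) hext)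
    exact ⟨hinv.step hr (.run (exec_run hp)) hi hext.immediatePreds,
      hhist.step hr (fun u hu => query_iff hr hinv.nsp hinv.bags hu) hi⟩

end Detector

end

end MultiBagsPlus

/-- `p ++ q` are the instructions issued by a depth-first eager execution, and `p` is what has been
executed so far: `E` and `D` are the present states of the execution and of the detector, and
`Efull` holds the full computation dag. -/
theorem mainTheorem2 {Loc : Type*} [DecidableEq Loc]
    (p q : List (MultiBagsPlus.Instr Loc))
    (E Efull : MultiBagsPlus.Exec Loc) (D : MultiBagsPlus.Detector Loc)
    (hp : MultiBagsPlus.Detector.run p = some (E, D))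
    (hpq : MultiBagsPlus.Exec.run (p ++ q) = some Efull) :
    (∀ u < E.cur, D.query u E.cur = true ↔ Efull.Precedes u E.cur) ∧
    (∀ r ∈ D.races,
      MultiBagsPlus.Conflict E.accesses r.loc r.fst r.snd ∧ Efull.Parallel r.fst r.snd) ∧
    (∀ l : Loc, (∃ r ∈ D.races, r.loc = l) ↔
      ∃ u v, MultiBagsPlus.Conflict E.accesses l u v ∧ Efull.Parallel u v) := by
  have hfull : Efull.Forward := .run hpq
  have hr := hfull.strandOrder
  have hext : E.Extends Efull := .run (MultiBagsPlus.Detector.exec_run hp) hpq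
  obtain ⟨hinv, hhist⟩ := MultiBagsPlus.Detector.inv_history_of_run hfull hp hext
  simp only [MultiBagsPlus.Exec.parallel_iff]
  refine ⟨fun u hu => ?_, hhist.races, fun l => ⟨?_, ?_⟩⟩
  · rw [MultiBagsPlus.Exec.precedes_iff_reach hu.ne]
    exact MultiBagsPlus.Detector.query_iff hr hinv.nsp hinv.bags hu.le
  · rintro ⟨ρ, hρ, rfl⟩
    exact ⟨ρ.fst, ρ.snd, hhist.races ρ hρ⟩
  · rintro ⟨u, v, hconflict, huv, hvu⟩
    by_contra! hnorace
    exact (hhist.rel_or_rel hr hnorace hconflict).elim huv hvu
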